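/- **Theorem (local convergence of bi-level distributed ALADIN).** Consider the problem $$\min_{x}\ \sum_{i=1}^N f_i(x_i)\quad\text{s.t.}\quad h_i(x_i)\le 0\ (i=1,\dots,N),\qquad \sum_{i=1}^N A_ix_i=0,$$ with $f_i:\mathbb R^{n_i}\to\mathbb R$ and $h_i:\mathbb R^{n_i}\to\mathbb R^{n_{h_i}}$ twice continuously differentiable, $A_i\in\mathbb R^{n_c\times n_i}$, and Lagrangian $\mathcal L(x,\lambda,\kappa)=\sum_i\big(f_i(x_i)+\lambda^\top A_ix_i+\kappa_i^\top h_i(x_i)\big)$. All vector norms are Euclidean. Fix $\rho>0$ and symmetric positive definite matrices $\Sigma_i$. *The algorithm.* For $p=(x,\lambda,\kappa)$ let $C_i$ be the Jacobian of the constraints of $h_i$ that are active at $x_i$, $g_i=\nabla f_i(x_i)$, and $$m(p)=\big(-(g_i+C_i^\top\kappa_i+A_i^\top\lambda)_{i},\ -\textstyle\sum_iA_ix_i,\ 0\big).$$ (In products with $C_i$ only the entries of $\kappa_i$ for active constraints are used.) Given $\delta>0$, penalties $\mu^k>0$, tolerances $\eta^k\ge0$ and symmetric matrices $H_i^k$,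 iteration $k=0,1,2,\dots$ goes from $q^k=(z^k,\lambda^k,\kappa^{\mathrm{QP},k-1})$ to $p^k=(x^k,\lambda^k,\kappa^k)$ and then to $q^{k+1}=(z^{k+1},\lambda^{k+1},\kappa^{\mathrm{QP},k})$ as follows ($\kappa^{\mathrm{QP},-1}$ is an arbitrary initial guess). 1. For each $i$, $x_i^k$ is a local minimizer, with $\|x_i^k-z_i^k\|<\delta$, of $f_i(y)+(\lambda^k)^\top A_iy+\frac\rho2(y-z_i^k)^\top\Sigma_i(y-z_i^k)$ subject to $h_i(y)\le0$, and $\kappa_i^k$ is a Karush–Kuhn–Tucker (KKT) multiplier for it. 2. Let the columns of $Z_i$ form a basis of $\ker C_i$ at $p^k$, and put $\bar H_i=Z_i^\top H_i^kZ_i$, $\bar g_i=Z_i^\top g_i$, $\bar A_i=A_iZ_i$, $S_i=\bar A_i\bar H_i^{-1}\bar A_i^\top$, $s_i=A_ix_i^k-\bar A_i\bar H_i^{-1}\bar g_i$. The vector $\lambda^{k+1}$ solves the condensed system inexactly: $$\Big\|\Big(\tfrac1{\mu^k}I+\sum_iS_i\Big)\lambda^{k+1}-\tfrac1{\mu^k}\lambda^k-\sum_is_i\Big\|\le\eta^k\,\|m(p^k)\|.$$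 3. $z_i^{k+1}=x_i^k+\Delta x_i^k$ with $\Delta x_i^k=Z_i\bar H_i^{-1}(-\bar A_i^\top\lambda^{k+1}-\bar g_i)$, and $\kappa_i^{\mathrm{QP},k}$ is the multiplier of the constraint $C_i\Delta x_i=0$ in the coordination QP, i.e. $H_i^k\Delta x_i^k+g_i+A_i^\top\lambda^{k+1}+C_i^\top\kappa_i^{\mathrm{QP},k}=0$, with zero entries for inactive constraints. *Assumptions.* Let $p^\star=(x^\star,\lambda^\star,\kappa^\star)$ be a KKT point of the problem at which the following hold: the gradients of all consensus constraints and all active inequality constraints are linearly independent (LICQ); $\kappa^\star_{ij}>0$ whenever $h_{ij}(x_i^\star)=0$ (strict complementarity, SCC); and, for every $i$, $\nabla^2(f_i+\kappa_i^{\star\top}h_i)(x_i^\star)$ is positive definite on the null space of the Jacobian of the active constraints of $h_i$ (second-order sufficiency, SOSC). Let $\nabla\mathcal L$ and $\nabla^2\mathcal L$ be Lipschitz in a neighbourhood of $p^\star$. *Conclusion.* There are $\delta,\chi,\bar\eta>0$ and $c\in(0,1)$ such that for all constants $c_\mu>0$, $c_H\ge0$ the following hold. * (Well-posedness.) There is $\varepsilon>0$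 such that for every $q=(z,\lambda,\kappa)$ with $\|q-p^\star\|<\varepsilon$, step 1 at $q$ has a solution $p$ such that, for all $\mu>0$ and all symmetric $H_i$ that differ entrywise by at most $c_H\|q-p^\star\|$ from the Hessians of the local Lagrangians $f_i+\kappa_i^\top h_i$ at $p$, steps 2 and 3 can be carried out exactly (with $\eta=0$). * (Linear rate.) There is $\varepsilon>0$ such that every sequence of iterates with $\|q^0-p^\star\|<\varepsilon$ that satisfies, for all $k$, (i) $1/\mu^k\le c_\mu\|q^k-p^\star\|$ if $q^k\ne p^\star$, (ii) the entries of $H_i^k$ differ from those of $\nabla^2(f_i+\kappa_i^{k\top}h_i)(x_i^k)$ by at most $c_H\|q^k-p^\star\|$ (exact Hessians: $c_H=0$), (iii) $\eta^k<\bar\eta$, has $q^k\to p^\star$, $p^k\to p^\star$ and, for all $k$, $\|q^{k+1}-p^\star\|\le c\|q^k-p^\star\|$ and $\|p^k-p^\star\|\le\chi\|q^k-p^\star\|$. * (Quadratic rate.) For every $c_\eta>0$ there are $\varepsilon,C>0$ such that every sequence of iterates with $\|q^0-p^\star\|<\varepsilon$ that satisfies (i), (ii) and $\eta^k\le c_\eta\|q^k-p^\star\|$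 for all $k$ has $q^k\to p^\star$, $p^k\to p^\star$ and, for all $k$, $\|q^{k+1}-p^\star\|\le C\|q^k-p^\star\|^2$ and $\|p^k-p^\star\|\le\chi\|q^k-p^\star\|$. -/

import Mathlib

open Filter Topology

noncomputable section

/-- Data of the separable problem
`min ∑ i, f i (x i)` subject to `h i (x i) ≤ 0` for all `i` and `∑ i, A i * x i = 0`. -/
structure SepProblem where
  /-- number of subproblems -/
  N : ℕ
  /-- number of decision variables of each subproblem -/
  n : Fin N → ℕ
  /-- number of inequality constraints of each subproblem -/
  nh : Fin N → ℕ
  /-- number of consensus constraints -/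
  nc : ℕ
  f : ∀ i, EuclideanSpace ℝ (Fin (n i)) → ℝ
  h : ∀ i, EuclideanSpace ℝ (Fin (n i)) → EuclideanSpace ℝ (Fin (nh i))
  A : ∀ i, Matrix (Fin nc) (Fin (n i)) ℝ

namespace SepProblem

variable (P : SepProblem)

/-- Local decision space. -/
abbrev Xi (i : Fin P.N) : Type := EuclideanSpace ℝ (Fin (P.n i))

/-- The space of overall decision vectors `x = (x_1, …, x_N)`, with the Euclidean norm. -/
abbrev X : Type := PiLp 2 fun i : Fin P.N => EuclideanSpace ℝ (Fin (P.n i))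

/-- The space of multipliers of the consensus constraint. -/
abbrev Lam : Type := EuclideanSpace ℝ (Fin P.nc)

/-- The space of multipliers `κ = (κ_1, …, κ_N)` of the inequality constraints. -/
abbrev Kap : Type := PiLp 2 fun i : Fin P.N => EuclideanSpace ℝ (Fin (P.nh i))

/-- Primal-dual vectors `(x, λ, κ)`, with the Euclidean norm. -/
abbrev PD : Type := WithLp 2 (P.X × WithLp 2 (P.Lam × P.Kap))

variable {P}

/-- The vector `(x, λ, κ)`. -/
def pd (x : P.X) (l : P.Lam) (κ : P.Kap) : P.PD := WithLp.toLp 2 (x, WithLp.toLp 2 (l, κ))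

/-- Primal part of `(x, λ, κ)`. -/
def PD.x (p : P.PD) : P.X := p.fst

/-- Consensus multiplier part of `(x, λ, κ)`. -/
def PD.lam (p : P.PD) : P.Lam := p.snd.fst

/-- Inequality multiplier part of `(x, λ, κ)`. -/
def PD.kap (p : P.PD) : P.Kap := p.snd.snd

variable (P)

/-- The Lagrangian `f(x) + λᵀ A x + κᵀ h(x)`. -/
def lagrangian (p : P.PD) : ℝ :=
  ∑ i, (P.f i (PD.x p i) + (PD.lam p).ofLp ⬝ᵥ (P.A i).mulVec (PD.x p i).ofLp
    + (PD.kap p i).ofLp ⬝ᵥ (P.h i (PD.x p i)).ofLp)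

/-- The gradient of the `j`-th inequality constraint of subproblem `i`. -/
def gradh (i : Fin P.N) (j : Fin (P.nh i)) (y : P.Xi i) : P.Xi i :=
  gradient (fun w => P.h i w j) y

/-- The Hessian matrix of the local Lagrangian `f_i + κ_iᵀ h_i` at `y`. -/
def hess (i : Fin P.N) (y : P.Xi i) (κ : EuclideanSpace ℝ (Fin (P.nh i))) :
    Matrix (Fin (P.n i)) (Fin (P.n i)) ℝ :=
  Matrix.of fun a b =>
    fderiv ℝ (fderiv ℝ fun w : P.Xi i => P.f i w + κ.ofLp ⬝ᵥ (P.h i w).ofLp) y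
      (EuclideanSpace.single a 1) (EuclideanSpace.single b 1)

/-- The Jacobian of the active constraints of subproblem `i` at `y`. It is stored with one row for
every constraint, the rows of inactive constraints being zero. -/
def Cact (i : Fin P.N) (y : P.Xi i) : Matrix (Fin (P.nh i)) (Fin (P.n i)) ℝ :=
  open Classical in
  Matrix.of fun j a => if P.h i y j = 0 then P.gradh i j y a else 0

/-! ### Regularity of a primal-dual point -/

/-- `(x, λ, κ)` satisfies the KKT conditions. -/
structure IsKKT (p : P.PD) : Prop where
  stationary : ∀ i, (gradient (P.f i) (PD.x p i)).ofLp + (P.A i).transpose.mulVec (PD.lam p).ofLp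
    + ∑ j, PD.kap p i j • (P.gradh i j (PD.x p i)).ofLp = 0
  feasible : ∀ i j, P.h i (PD.x p i) j ≤ 0
  consensus : ∑ i, (P.A i).mulVec (PD.x p i).ofLp = 0
  nonneg : ∀ i j, 0 ≤ PD.kap p i j
  compl : ∀ i j, PD.kap p i j * P.h i (PD.x p i) j = 0

/-- LICQ: the gradients of the consensus constraints and of all active inequality constraints,
as vectors in the overall decision space, are linearly independent. -/
def LICQ (x : P.X) : Prop :=
  LinearIndependent ℝ
    (Sum.elim
      (fun c : Fin P.nc => (WithLp.toLp 2 fun i => WithLp.toLp 2 (P.A i c) : P.X))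
      (fun s : Σ i : Fin P.N, {j : Fin (P.nh i) // P.h i (x i) j = 0} =>
        (WithLp.toLp 2 (Pi.single s.1 (P.gradh s.1 s.2 (x s.1))) : P.X)))

/-- Strict complementarity: active inequality constraints have positive multipliers. -/
def SCC (p : P.PD) : Prop :=
  ∀ i j, P.h i (PD.x p i) j = 0 → 0 < PD.kap p i j

/-- SOSC: the Hessian of each local Lagrangian is positive definite on the null space of the
active constraint Jacobian of that subproblem. -/
def SOSC (p : P.PD) : Prop :=
  ∀ i, ∀ v : Fin (P.n i) → ℝ, v ≠ 0 → (P.Cact i (PD.x p i)).mulVec v = 0 →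
    0 < v ⬝ᵥ (P.hess i (PD.x p i) (PD.kap p i)).mulVec v

/-! ### The algorithm -/

/-- Objective `f_i(y) + λᵀ A_i y + (ρ/2) ‖y - z_i‖²_{Σ_i}` of the `i`-th local problem. -/
def localObj (Sig : ∀ i, Matrix (Fin (P.n i)) (Fin (P.n i)) ℝ) (ρ : ℝ)
    (z : P.X) (l : P.Lam) (i : Fin P.N) (y : P.Xi i) : ℝ :=
  P.f i y + l.ofLp ⬝ᵥ (P.A i).mulVec y.ofLp
    + ρ / 2 * ((y - z i).ofLp ⬝ᵥ (Sig i).mulVec (y - z i).ofLp)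

/-- Parallelizable step: from `q = (z, λ, ·)` to `p = (x, λ, κ)`, where `x_i` is a local minimizer
of the `i`-th local problem at distance less than `δ` from `z_i`, and `κ_i` is a multiplier of the
constraint `h_i ≤ 0` in that problem. -/
structure LocalStep (Sig : ∀ i, Matrix (Fin (P.n i)) (Fin (P.n i)) ℝ) (ρ δ : ℝ)
    (q p : P.PD) : Prop where
  lam_eq : PD.lam p = PD.lam q
  near : ∀ i, dist (PD.x p i) (PD.x q i) < δ
  feasible : ∀ i j, P.h i (PD.x p i) j ≤ 0
  localMin : ∀ i, IsLocalMinOn (P.localObj Sig ρ (PD.x q) (PD.lam q) i)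
    {y | ∀ j, P.h i y j ≤ 0} (PD.x p i)
  stationary : ∀ i, gradient (P.localObj Sig ρ (PD.x q) (PD.lam q) i) (PD.x p i)
    + ∑ j, PD.kap p i j • P.gradh i j (PD.x p i) = 0
  nonneg : ∀ i j, 0 ≤ PD.kap p i j
  compl : ∀ i j, PD.kap p i j * P.h i (PD.x p i) j = 0

/-- The columns of `Z` form a basis of the null space of `C`. -/
def IsNullBasis {a b d : ℕ} (C : Matrix (Fin a) (Fin b) ℝ) (Z : Matrix (Fin b) (Fin d) ℝ) : Prop :=
  LinearIndependent ℝ Z.col ∧ Submodule.span ℝ (Set.range Z.col) = LinearMap.ker C.mulVecLin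

section Condensed

variable {d : Fin P.N → ℕ} (Z : ∀ i, Matrix (Fin (P.n i)) (Fin (d i)) ℝ)
  (H : ∀ i, Matrix (Fin (P.n i)) (Fin (P.n i)) ℝ)

/-- Reduced Hessian `Z_iᵀ H_i Z_i`. -/
def Hbar (i : Fin P.N) : Matrix (Fin (d i)) (Fin (d i)) ℝ := (Z i).transpose * H i * Z i

/-- Reduced gradient `Z_iᵀ ∇f_i(x_i)`. -/
def gbar (x : P.X) (i : Fin P.N) : Fin (d i) → ℝ :=
  (Z i).transpose.mulVec (gradient (P.f i) (x i)).ofLp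

/-- Reduced coupling matrix `A_i Z_i`. -/
def Abar (i : Fin P.N) : Matrix (Fin P.nc) (Fin (d i)) ℝ := P.A i * Z i

/-- Schur complement `S_i`. -/
def schur (i : Fin P.N) : Matrix (Fin P.nc) (Fin P.nc) ℝ :=
  P.Abar Z i * (P.Hbar Z H i)⁻¹ * (P.Abar Z i).transpose

/-- Condensed vector `s_i = A_i x_i - Abar_i Hbar_i⁻¹ gbar_i`. -/
def svec (x : P.X) (i : Fin P.N) : Fin P.nc → ℝ :=
  (P.A i).mulVec (x i).ofLp - (P.Abar Z i).mulVec ((P.Hbar Z H i)⁻¹.mulVec (P.gbar Z x i))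

/-- Residual of the condensed system `(μ⁻¹ I + ∑ S_i) lQP = μ⁻¹ λ + ∑ s_i` at `lQP`. -/
def condensedResidual (μ : ℝ) (p : P.PD) (lQP : P.Lam) : P.Lam :=
  WithLp.toLp 2 ((μ⁻¹ • (1 : Matrix (Fin P.nc) (Fin P.nc) ℝ) + ∑ i, P.schur Z H i).mulVec lQP.ofLp
    - μ⁻¹ • (PD.lam p).ofLp - ∑ i, P.svec Z H (PD.x p) i)

/-- Back substitution `Δx_i = Z_i Hbar_i⁻¹ (-Abar_iᵀ lQP - gbar_i)`. -/
def backSub (x : P.X) (lQP : P.Lam) (i : Fin P.N) : Fin (P.n i) → ℝ :=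
  (Z i).mulVec ((P.Hbar Z H i)⁻¹.mulVec
    (-(P.Abar Z i).transpose.mulVec lQP.ofLp - P.gbar Z x i))

end Condensed

/-- Right-hand side `m(p) = (-g - Cᵀ κ - Aᵀ λ, -A x, 0)` of the optimality system of the
coordination QP, `C` being the Jacobian of the active constraints. -/
def mvec (p : P.PD) : P.PD :=
  pd
    (WithLp.toLp 2 fun i => WithLp.toLp 2
      (-(gradient (P.f i) (PD.x p i)).ofLp
        - (P.Cact i (PD.x p i)).transpose.mulVec (PD.kap p i).ofLp
        - (P.A i).transpose.mulVec (PD.lam p).ofLp))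
    (WithLp.toLp 2 (-∑ i, (P.A i).mulVec (PD.x p i).ofLp))
    0

/-- The matrix-vector product `M(p) Δ`, where `M(p)` is the KKT matrix
`[H, Aᵀ, Cᵀ; A, -μ⁻¹ I, 0; C, 0, 0]` of the coordination QP. -/
def Mmap (μ : ℝ) (H : ∀ i, Matrix (Fin (P.n i)) (Fin (P.n i)) ℝ) (p Δ : P.PD) : P.PD :=
  pd
    (WithLp.toLp 2 fun i => WithLp.toLp 2
      ((H i).mulVec (PD.x Δ i).ofLp + (P.A i).transpose.mulVec (PD.lam Δ).ofLp
        + (P.Cact i (PD.x p i)).transpose.mulVec (PD.kap Δ i).ofLp))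
    (WithLp.toLp 2 (∑ i, (P.A i).mulVec (PD.x Δ i).ofLp - μ⁻¹ • (PD.lam Δ).ofLp))
    (WithLp.toLp 2 fun i => WithLp.toLp 2 ((P.Cact i (PD.x p i)).mulVec (PD.x Δ i).ofLp))

/-- The residual `r_p = M(p) (q' - p) - m(p)`. -/
def kktResidual (μ : ℝ) (H : ∀ i, Matrix (Fin (P.n i)) (Fin (P.n i)) ℝ) (p q' : P.PD) : P.PD :=
  P.Mmap μ H p (q' - p) - P.mvec p

/-- Coordination and update step without its tolerance: `q' = (z', λ', κ')` is obtained from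
`p = (x, λ, κ)` and an approximate solution `λ'` of the condensed system, where `z' = x + Δx` by back
substitution and `κ'` is the multiplier of the linearized active constraints in the coordination QP:
it is determined by the stationarity condition of that QP and is zero for inactive constraints.
The columns of the `Z i` are any bases of the null spaces of the active constraint Jacobians. -/
structure Update {d : Fin P.N → ℕ} (Z : ∀ i, Matrix (Fin (P.n i)) (Fin (d i)) ℝ)
    (H : ∀ i, Matrix (Fin (P.n i)) (Fin (P.n i)) ℝ) (p q' : P.PD) : Prop where
  basis : ∀ i, IsNullBasis (P.Cact i (PD.x p i)) (Z i)
  primal : ∀ i, (PD.x q' i).ofLp = (PD.x p i).ofLp + P.backSub Z H (PD.x p) (PD.lam q') i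
  stationary : ∀ i, (H i).mulVec (PD.x q' i - PD.x p i).ofLp + (gradient (P.f i) (PD.x p i)).ofLp
    + (P.A i).transpose.mulVec (PD.lam q').ofLp
    + (P.Cact i (PD.x p i)).transpose.mulVec (PD.kap q' i).ofLp = 0
  inactive : ∀ i j, P.h i (PD.x p i) j ≠ 0 → PD.kap q' i j = 0

/-- Only the consensus row of the residual `r_p` is nonzero, and it is, up to sign, the residual of
the condensed system. So bounding one residual is the same as bounding the other. -/
theorem norm_kktResidual {d : Fin P.N → ℕ} {Z : ∀ i, Matrix (Fin (P.n i)) (Fin (d i)) ℝ}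
    {H : ∀ i, Matrix (Fin (P.n i)) (Fin (P.n i)) ℝ} {p q' : P.PD} (μ : ℝ)
    (hu : P.Update Z H p q') :
    ‖P.kktResidual μ H p q'‖ = ‖P.condensedResidual Z H μ p (PD.lam q')‖ := by
  have hx : ∀ i, (PD.x (q' - p) i).ofLp = P.backSub Z H (PD.x p) (PD.lam q') i := by
    intro i
    have := hu.primal i
    change (PD.x q' i).ofLp - (PD.x p i).ofLp = _
    rw [this]; simp
  have key : P.kktResidual μ H p q' = pd 0 (-P.condensedResidual Z H μ p (PD.lam q')) 0 := by
    have e1 : PD.x (P.kktResidual μ H p q') = 0 := by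
      ext i a
      have h1 := congrFun (hu.stationary i) a
      change (((H i).mulVec (PD.x q' i - PD.x p i).ofLp
        + (P.A i).transpose.mulVec ((PD.lam q').ofLp - (PD.lam p).ofLp)
        + (P.Cact i (PD.x p i)).transpose.mulVec ((PD.kap q' i).ofLp - (PD.kap p i).ofLp))
        - (-(gradient (P.f i) (PD.x p i)).ofLp
          - (P.Cact i (PD.x p i)).transpose.mulVec (PD.kap p i).ofLp
          - (P.A i).transpose.mulVec (PD.lam p).ofLp)) a = 0
      rw [Matrix.mulVec_sub, Matrix.mulVec_sub]
      simp only [Pi.add_apply, Pi.sub_apply, Pi.neg_apply, Pi.zero_apply] at h1 ⊢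
      linarith
    have e3 : PD.kap (P.kktResidual μ H p q') = 0 := by
      ext i a
      change ((P.Cact i (PD.x p i)).mulVec (PD.x (q' - p) i).ofLp - 0) a = 0
      rw [hx, sub_zero]
      have hz : (P.Cact i (PD.x p i)) * Z i = 0 := by
        ext r c
        have hc : (Z i).col c ∈ LinearMap.ker (P.Cact i (PD.x p i)).mulVecLin := by
          rw [← (hu.basis i).2]
          exact Submodule.subset_span ⟨c, rfl⟩
        exact congrFun (LinearMap.mem_ker.1 hc) r
      rw [backSub, Matrix.mulVec_mulVec, hz]
      simp
    have e2 : PD.lam (P.kktResidual μ H p q') = -P.condensedResidual Z H μ p (PD.lam q') := by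
      have h2 : (PD.lam (P.kktResidual μ H p q')).ofLp
          = (∑ i, (P.A i).mulVec (PD.x (q' - p) i).ofLp
              - μ⁻¹ • ((PD.lam q').ofLp - (PD.lam p).ofLp))
            - -∑ i, (P.A i).mulVec (PD.x p i).ofLp := rfl
      apply (WithLp.ofLp_injective 2)
      rw [h2]
      have h3 : ∀ i, (P.A i).mulVec (PD.x (q' - p) i).ofLp
          = -(P.schur Z H i).mulVec (PD.lam q').ofLp
            - (P.Abar Z i).mulVec ((P.Hbar Z H i)⁻¹.mulVec (P.gbar Z (PD.x p) i)) := by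
        intro i
        rw [hx, backSub, schur, ← Matrix.mulVec_mulVec, ← Matrix.mulVec_mulVec,
          Matrix.mulVec_sub, Matrix.mulVec_neg, Abar, Matrix.mulVec_mulVec, Matrix.mulVec_sub,
          Matrix.mulVec_neg]
      simp only [h3, condensedResidual, svec, WithLp.ofLp_neg, Finset.sum_sub_distrib,
        Finset.sum_neg_distrib, Matrix.add_mulVec, Matrix.smul_mulVec, Matrix.one_mulVec,
        Matrix.sum_mulVec, smul_sub]
      abel
    rw [← e2]
    calc P.kktResidual μ H p q' = pd (PD.x (P.kktResidual μ H p q'))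
          (PD.lam (P.kktResidual μ H p q')) (PD.kap (P.kktResidual μ H p q')) := rfl
      _ = _ := by rw [e1, e3]
  rw [key]
  simp [pd]

/-- Coordination and update step with penalty `μ`, Hessian matrices `H` and tolerance `η`: the
condensed system is solved up to a residual bounded by `η ‖m(p)‖`. -/
def CoordStep (μ η : ℝ) (H : ∀ i, Matrix (Fin (P.n i)) (Fin (P.n i)) ℝ) (p q' : P.PD) : Prop :=
  ∃ (d : Fin P.N → ℕ) (Z : ∀ i, Matrix (Fin (P.n i)) (Fin (d i)) ℝ), P.Update Z H p q' ∧
    ‖P.condensedResidual Z H μ p (PD.lam q')‖ ≤ η * ‖P.mvec p‖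

/-- The symmetric matrices `H i` agree with the Hessians of the local Lagrangians at `p`, up to an
error of at most `e` in each entry (`e = 0`: exact Hessians). -/
def HessApprox (e : ℝ) (H : ∀ i, Matrix (Fin (P.n i)) (Fin (P.n i)) ℝ) (p : P.PD) : Prop :=
  ∀ i, (H i).IsSymm ∧ ∀ a b, |H i a b - P.hess i (PD.x p i) (PD.kap p i) a b| ≤ e

/-- `q^k`, `p^k` are the iterates of bi-level distributed ALADIN with parameters `Σ`, `ρ`, penalties
`μ^k`, Hessian matrices `H^k`, and tolerances `η^k` of the inexact coordination step. -/
def IsRun (Sig : ∀ i, Matrix (Fin (P.n i)) (Fin (P.n i)) ℝ) (ρ δ : ℝ) (μ η : ℕ → ℝ)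
    (H : ℕ → ∀ i, Matrix (Fin (P.n i)) (Fin (P.n i)) ℝ) (q p : ℕ → P.PD) : Prop :=
  ∀ k, 0 < μ k ∧ 0 ≤ η k ∧ P.LocalStep Sig ρ δ (q k) (p k) ∧
    P.CoordStep (μ k) (η k) (H k) (p k) (q (k + 1))

end SepProblem

end

section LocalConvergence

set_option maxSynthPendingDepth 3

/-!
Stack the blocks into one decision vector `x`. The local steps together solve one proximal problem
with prox-center `z` and linear perturbation `Aᵀ λ`. Near a KKT point with LICQ, strict
complementarity and second-order sufficiency its active set is constant, so its KKT conditions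
become a square system with invertible derivative, and `‖p - p⋆‖ ≤ χ * ‖q - p⋆‖`.

The coordination step is a Newton step on the KKT system of the whole problem with the active set
held fixed, in which the consensus constraint `A x = 0` is relaxed to `A x = (1 / μ) * Δλ`, the
Hessian is perturbed, and the tolerance `η` leaves a residual of size `η * ‖m(p)‖`. Saddle-point
operators close to that of the solution are uniformly invertible, so `‖q⁺ - p⋆‖` is at most a
constant times `(‖p - p⋆‖ + 1 / μ + ‖H - ∇²L‖ + η) * ‖p - p⋆‖`, and the conditions on `μ`, `H` and
`η` give the rates.
-/

/-! ### Quadratic forms penalized along functionals -/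

section PenalizedForm

variable {X : Type*} [NormedAddCommGroup X] [NormedSpace ℝ X] {J : Type*}

/-- The bilinear form `Q + T ∑ j ∈ s, D j ⊗ D j`, which is the Hessian of an augmented Lagrangian
with penalty parameter `T` and active set `s`. -/
noncomputable def penalizedForm (s : Finset J) (T : ℝ) (D : J → X →L[ℝ] ℝ)
    (Q : X →L[ℝ] X →L[ℝ] ℝ) : X →L[ℝ] X →L[ℝ] ℝ :=
  Q + T • ∑ j ∈ s, (D j).smulRight (D j)

theorem penalizedForm_apply (s : Finset J) (T : ℝ) (D : J → X →L[ℝ] ℝ) (Q : X →L[ℝ] X →L[ℝ] ℝ)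
    (u v : X) : penalizedForm s T D Q u v = Q u v + T * ∑ j ∈ s, D j u * D j v := by
  simp [penalizedForm]

theorem penalizedForm_apply_eq (s : Finset J) (T : ℝ) {D : J → X →L[ℝ] ℝ}
    (Q : X →L[ℝ] X →L[ℝ] ℝ) {v : X} (hv : ∀ j ∈ s, D j v = 0) :
    penalizedForm s T D Q v v = Q v v := by
  rw [penalizedForm_apply, Finset.sum_eq_zero fun j hj => by rw [hv j hj, zero_mul], mul_zero,
    add_zero]

theorem continuous_penalizedForm (s : Finset J) (T : ℝ) :
    Continuous fun w : (J → X →L[ℝ] ℝ) × (X →L[ℝ] X →L[ℝ] ℝ) => penalizedForm s T w.1 w.2 := by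
  have hsquare (j : J) : Continuous fun w : (J → X →L[ℝ] ℝ) × (X →L[ℝ] X →L[ℝ] ℝ) =>
      (w.1 j).smulRight (w.1 j) :=
    have heval : Continuous fun w : (J → X →L[ℝ] ℝ) × (X →L[ℝ] X →L[ℝ] ℝ) => w.1 j := by fun_prop
    (ContinuousLinearMap.smulRightL ℝ X (X →L[ℝ] ℝ)).continuous₂.comp (heval.prodMk heval)
  exact continuous_snd.add ((continuous_finsetSum s fun j _ => hsquare j).const_smul T)

theorem eventually_mul_sq_le_of_continuous {Y : Type*} [TopologicalSpace Y]
    {Q : Y → X →L[ℝ] X →L[ℝ] ℝ} {y : Y} (hcont : ContinuousAt Q y) {c : ℝ} (hc : 0 < c)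
    (hQ : ∀ v, c * ‖v‖ ^ 2 ≤ Q y v v) : ∀ᶠ w in 𝓝 y, ∀ v, c / 2 * ‖v‖ ^ 2 ≤ Q w v v := by
  filter_upwards [hcont (Metric.ball_mem_nhds _ (half_pos hc))] with w hw v
  have hdiff : |Q w v v - Q y v v| ≤ c / 2 * ‖v‖ * ‖v‖ :=
    ((Q w - Q y).le_opNorm₂ v v).trans (by gcongr; exact (mem_ball_iff_norm.1 hw).le)
  nlinarith [hQ v, neg_abs_le (Q w v v - Q y v v)]

theorem exists_forall_pos_add_mul_of_isCompact {Y : Type*} [TopologicalSpace Y] {K : Set Y}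
    (hK : IsCompact K) {φ ψ : Y → ℝ} (hφ : Continuous φ) (hψ : Continuous ψ)
    (hψ0 : ∀ y, 0 ≤ ψ y) (hpos : ∀ y ∈ K, ψ y = 0 → 0 < φ y) :
    ∃ T : ℕ, ∀ y ∈ K, 0 < φ y + T * ψ y := by
  refine hK.elim_directed_cover (fun T : ℕ => {y | 0 < φ y + T * ψ y})
    (fun T => isOpen_lt continuous_const (by fun_prop)) (fun y hy => Set.mem_iUnion.2 ?_)
    (Monotone.directed_le fun a b hab y (hy : 0 < φ y + a * ψ y) =>
      hy.trans_le (by gcongr; exact hψ0 y))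
  rcases (hψ0 y).eq_or_lt with h0 | h0
  · exact ⟨0, by simpa using hpos y hy h0.symm⟩
  · obtain ⟨T, hT⟩ := exists_nat_gt (-φ y / ψ y)
    rw [div_lt_iff₀ h0] at hT
    exact ⟨T, show 0 < φ y + T * ψ y by linarith⟩

variable [FiniteDimensional ℝ X]

theorem exists_mul_sq_le_of_pos (Q : X →L[ℝ] X →L[ℝ] ℝ) (hQ : ∀ v, v ≠ 0 → 0 < Q v v) :
    ∃ c > 0, ∀ v, c * ‖v‖ ^ 2 ≤ Q v v := by
  rcases subsingleton_or_nontrivial X with _ | _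
  · exact ⟨1, one_pos, fun v => by simp [Subsingleton.elim v 0]⟩
  obtain ⟨u, hu, hmin⟩ := (isCompact_sphere (0 : X) 1).exists_isMinOn
    (NormedSpace.sphere_nonempty.2 zero_le_one)
    (show Continuous fun v => Q v v by fun_prop).continuousOn
  refine ⟨Q u u, hQ u (ne_zero_of_mem_unit_sphere ⟨u, hu⟩), fun v => ?_⟩
  rcases eq_or_ne v 0 with rfl | hv
  · simp
  have hn : ‖v‖ ≠ 0 := norm_ne_zero_iff.2 hv
  have hle : Q u u ≤ Q (‖v‖⁻¹ • v) (‖v‖⁻¹ • v) := hmin (by simp [norm_smul, hn])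
  simp only [map_smul, smul_apply, smul_eq_mul] at hle
  calc Q u u * ‖v‖ ^ 2 ≤ (‖v‖⁻¹ * (‖v‖⁻¹ * Q v v)) * ‖v‖ ^ 2 := by gcongr
    _ = Q v v := by field_simp

/-- Finsler's lemma. -/
theorem exists_penalizedForm_coercive (s : Finset J) (D : J → X →L[ℝ] ℝ)
    (Q : X →L[ℝ] X →L[ℝ] ℝ) (hQ : ∀ v, v ≠ 0 → (∀ j ∈ s, D j v = 0) → 0 < Q v v) :
    ∃ T : ℝ, ∃ c > 0, ∀ v, c * ‖v‖ ^ 2 ≤ penalizedForm s T D Q v v := by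
  have hnull {v : X} (h0 : ∑ j ∈ s, D j v * D j v = 0) : ∀ j ∈ s, D j v = 0 := fun j hj =>
    mul_self_eq_zero.1
      ((Finset.sum_eq_zero_iff_of_nonneg fun j _ => mul_self_nonneg (D j v)).1 h0 j hj)
  obtain ⟨T, hT⟩ := exists_forall_pos_add_mul_of_isCompact (isCompact_sphere (0 : X) 1)
    (φ := fun v => Q v v) (ψ := fun v => ∑ j ∈ s, D j v * D j v) (by fun_prop) (by fun_prop)
    (fun v => Finset.sum_nonneg fun j _ => mul_self_nonneg _)
    fun v hv h0 => hQ v (ne_zero_of_mem_unit_sphere ⟨v, hv⟩) (hnull h0)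
  refine ⟨T, exists_mul_sq_le_of_pos _ fun v hv => ?_⟩
  have hunit := hT (‖v‖⁻¹ • v) (by simp [norm_smul, norm_ne_zero_iff.2 hv])
  rw [← penalizedForm_apply] at hunit
  simp only [map_smul, smul_apply, smul_eq_mul, ← mul_assoc] at hunit
  exact pos_of_mul_pos_right hunit (mul_self_nonneg _)

theorem eventually_penalizedForm_coercive (s : Finset J) (D : J → X →L[ℝ] ℝ)
    (Q : X →L[ℝ] X →L[ℝ] ℝ) (hQ : ∀ v, v ≠ 0 → (∀ j ∈ s, D j v = 0) → 0 < Q v v) :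
    ∃ T : ℝ, ∃ c > 0, ∀ᶠ w : (J → X →L[ℝ] ℝ) × (X →L[ℝ] X →L[ℝ] ℝ) in 𝓝 (D, Q),
      ∀ v, c * ‖v‖ ^ 2 ≤ penalizedForm s T w.1 w.2 v v := by
  obtain ⟨T, c, hc, hT⟩ := exists_penalizedForm_coercive s D Q hQ
  exact ⟨T, c / 2, half_pos hc,
    eventually_mul_sq_le_of_continuous (continuous_penalizedForm s T).continuousAt hc hT⟩

theorem eventually_pos_on_null_space (s : Finset J) (D : J → X →L[ℝ] ℝ)
    (Q : X →L[ℝ] X →L[ℝ] ℝ) (hQ : ∀ v, v ≠ 0 → (∀ j ∈ s, D j v = 0) → 0 < Q v v) :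
    ∀ᶠ w : (J → X →L[ℝ] ℝ) × (X →L[ℝ] X →L[ℝ] ℝ) in 𝓝 (D, Q),
      ∀ v, v ≠ 0 → (∀ j ∈ s, w.1 j v = 0) → 0 < w.2 v v := by
  obtain ⟨T, c, hc, hT⟩ := eventually_penalizedForm_coercive s D Q hQ
  filter_upwards [hT] with w hw v hv hnull
  rw [← penalizedForm_apply_eq s T w.2 hnull]
  exact lt_of_lt_of_le (by positivity) (hw v)

end PenalizedForm

/-! ### Saddle-point operators -/

section SaddleMap

variable {X : Type*} [NormedAddCommGroup X] [NormedSpace ℝ X] {J : Type*} [Fintype J]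

open Classical in
/-- The regularized KKT operator
`(v, k) ↦ (Q v + ∑ j, k j • D j, (D j v - θ j * k j for j ∈ s, k j for j ∉ s))` with Hessian `Q`,
constraint gradients `D` and active set `s`. It is the derivative of the KKT system of a nonlinear
program (`θ = 0`) and the optimality operator of the coordination QP (`θ` is `μ⁻¹` on the consensus
constraints). The multipliers of inactive constraints are kept, so that the domain does not depend
on `s`. -/
noncomputable def saddleMap (s : Finset J) (θ : J → ℝ) (Q : X →L[ℝ] X →L[ℝ] ℝ)
    (D : J → X →L[ℝ] ℝ) : X × (J → ℝ) →L[ℝ] (X →L[ℝ] ℝ) × (J → ℝ) :=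
  let mult (j : J) : X × (J → ℝ) →L[ℝ] ℝ :=
    (ContinuousLinearMap.proj j).comp (ContinuousLinearMap.snd ℝ X (J → ℝ))
  (Q.comp (ContinuousLinearMap.fst ℝ X (J → ℝ)) + ∑ j, (mult j).smulRight (D j)).prod
    (ContinuousLinearMap.pi fun j =>
      if j ∈ s then (D j).comp (ContinuousLinearMap.fst ℝ X (J → ℝ)) - θ j • mult j else mult j)

variable {s : Finset J} {θ : J → ℝ} {Q : X →L[ℝ] X →L[ℝ] ℝ} {D : J → X →L[ℝ] ℝ}

open Classical in
theorem saddleMap_apply (w : X × (J → ℝ)) : saddleMap s θ Q D w =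
    (Q w.1 + ∑ j, w.2 j • D j, fun j => if j ∈ s then D j w.1 - θ j * w.2 j else w.2 j) := by
  refine Prod.ext ?_ (funext fun j => ?_)
  · ext v
    simp [saddleMap]
  · by_cases hj : j ∈ s <;> simp [saddleMap, hj]

theorem saddleMap_apply_snd_of_mem (w : X × (J → ℝ)) {j : J} (hj : j ∈ s) :
    (saddleMap s θ Q D w).2 j = D j w.1 - θ j * w.2 j := by
  simp [saddleMap_apply, hj]

theorem saddleMap_apply_snd_of_notMem (w : X × (J → ℝ)) {j : J} (hj : j ∉ s) :
    (saddleMap s θ Q D w).2 j = w.2 j := by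
  simp [saddleMap_apply, hj]

/-- Testing the first row with `v` gives `Q v v + ∑ j ∈ s, θ j * k j ^ 2 = 0` on the kernel. -/
theorem saddleMap_injective (hθ : ∀ j ∈ s, 0 ≤ θ j) (hD : LinearIndepOn ℝ D (s : Set J))
    (hQ : ∀ v, v ≠ 0 → (∀ j ∈ s, θ j = 0 → D j v = 0) → 0 < Q v v) :
    Function.Injective (saddleMap s θ Q D) := by
  rw [injective_iff_map_eq_zero]
  rintro ⟨v, k⟩ hw
  have hactive (j : J) (hj : j ∈ s) : D j v = θ j * k j := by
    simpa [saddleMap_apply_snd_of_mem _ hj, sub_eq_zero] using congrFun (congrArg Prod.snd hw) j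
  have hinactive (j : J) (hj : j ∉ s) : k j = 0 := by
    simpa [saddleMap_apply_snd_of_notMem _ hj] using congrFun (congrArg Prod.snd hw) j
  have hstat : Q v + ∑ j ∈ s, k j • D j = 0 := by
    rw [Finset.sum_subset s.subset_univ fun j _ hj => by rw [hinactive j hj, zero_smul]]
    simpa [saddleMap_apply] using congrArg Prod.fst hw
  have hv : v = 0 := by
    by_contra hv
    have htest : Q v v + ∑ j ∈ s, θ j * k j ^ 2 = 0 := by
      have := congrArg (· v) hstat
      simp only [add_apply, sum_apply, smul_apply, smul_eq_mul, zero_apply] at this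
      rw [← this]
      congr 1
      exact Finset.sum_congr rfl fun j hj => by rw [hactive j hj]; ring
    have hpos := hQ v hv fun j hj h0 => by rw [hactive j hj, h0, zero_mul]
    have hnonneg : 0 ≤ ∑ j ∈ s, θ j * k j ^ 2 :=
      Finset.sum_nonneg fun j hj => mul_nonneg (hθ j hj) (sq_nonneg _)
    linarith
  subst hv
  rw [map_zero, zero_add] at hstat
  refine Prod.ext rfl (funext fun j => ?_)
  by_cases hj : j ∈ s
  · exact linearIndepOn_finset_iff.1 hD k hstat j hj
  · exact hinactive j hj

variable [FiniteDimensional ℝ X]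

theorem continuous_saddleMap :
    Continuous fun a : (J → ℝ) × (X →L[ℝ] X →L[ℝ] ℝ) × (J → X →L[ℝ] ℝ) =>
      saddleMap s a.1 a.2.1 a.2.2 := by
  refine continuous_clm_apply.2 fun w => ?_
  simp only [saddleMap_apply]
  refine Continuous.prodMk (by fun_prop) (continuous_pi fun j => ?_)
  split_ifs <;> fun_prop

theorem saddleMap_surjective (h : Function.Injective (saddleMap s θ Q D)) :
    Function.Surjective (saddleMap s θ Q D) := by
  have hrank : Module.finrank ℝ (X × (J → ℝ)) = Module.finrank ℝ ((X →L[ℝ] ℝ) × (J → ℝ)) := by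
    rw [Module.finrank_prod, Module.finrank_prod,
      ← LinearEquiv.finrank_eq (LinearMap.toContinuousLinearMap (𝕜 := ℝ) (E := X) (F' := ℝ)),
      Subspace.dual_finrank_eq]
  exact (LinearMap.injective_iff_surjective_of_finrank_eq_finrank
    (f := (saddleMap s θ Q D).toLinearMap) hrank).1 h

theorem eventually_norm_le_mul_of_injective {E F Y : Type*} [NormedAddCommGroup E]
    [NormedSpace ℝ E] [FiniteDimensional ℝ E] [NormedAddCommGroup F] [NormedSpace ℝ F]
    [TopologicalSpace Y] {L : Y → E →L[ℝ] F} {y : Y} (hL : ContinuousAt L y)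
    (hinj : Function.Injective (L y)) :
    ∃ M > 0, ∀ᶠ y' in 𝓝 y, ∀ v, ‖v‖ ≤ M * ‖L y' v‖ := by
  obtain ⟨K, hK, hbound⟩ := LinearMap.exists_antilipschitzWith (L y : E →ₗ[ℝ] F)
    (LinearMap.ker_eq_bot.2 hinj)
  have hradius : 0 < (2 * (K : ℝ))⁻¹ := inv_pos.2 (mul_pos two_pos hK)
  refine ⟨2 * K, by positivity, ?_⟩
  filter_upwards [hL (Metric.ball_mem_nhds _ hradius)] with y' hy' v
  have hv : ‖v‖ ≤ K * ‖L y v‖ := by simpa using hbound.le_mul_dist v 0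
  have hdiff : ‖L y v‖ ≤ ‖L y' v‖ + (2 * (K : ℝ))⁻¹ * ‖v‖ := by
    have := (L y' - L y).le_of_opNorm_le (mem_ball_iff_norm.1 hy').le v
    rw [sub_apply] at this
    linarith [norm_le_norm_add_norm_sub' (L y v) (L y' v), norm_sub_rev (L y v) (L y' v)]
  have habsorb : ‖v‖ ≤ K * ‖L y' v‖ + 2⁻¹ * ‖v‖ :=
    calc ‖v‖ ≤ K * (‖L y' v‖ + (2 * (K : ℝ))⁻¹ * ‖v‖) := hv.trans (by gcongr)
      _ = _ := by field_simp
  linarith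

theorem eventually_norm_le_mul_saddleMap (h : Function.Injective (saddleMap s θ Q D)) :
    ∃ M > 0, ∀ᶠ a : (J → ℝ) × (X →L[ℝ] X →L[ℝ] ℝ) × (J → X →L[ℝ] ℝ) in 𝓝 (θ, Q, D),
      ∀ w, ‖w‖ ≤ M * ‖saddleMap s a.1 a.2.1 a.2.2 w‖ :=
  eventually_norm_le_mul_of_injective continuous_saddleMap.continuousAt h

end SaddleMap

/-! ### The Lagrangian of a nonlinear program -/

section Lagrangian

variable {J : Type*} [Fintype J]

open Classical in
/-- The indices of the constraints `h j ≤ 0` that are active at `x`. -/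
noncomputable def activeSet {X : Type*} (h : J → X → ℝ) (x : X) : Finset J := {j | h j x = 0}

@[simp]
theorem mem_activeSet {X : Type*} {h : J → X → ℝ} {x : X} {j : J} :
    j ∈ activeSet h x ↔ h j x = 0 := by
  simp [activeSet]

variable {X : Type*} [NormedAddCommGroup X] [NormedSpace ℝ X] {f : X → ℝ} {h : J → X → ℝ}

/-- The derivative in `x` of the Lagrangian `f x + ∑ j, κ j * h j x`. -/
noncomputable def lagGrad (f : X → ℝ) (h : J → X → ℝ) (x : X) (κ : J → ℝ) : X →L[ℝ] ℝ :=
  fderiv ℝ f x + ∑ j, κ j • fderiv ℝ (h j) x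

/-- The second derivative in `x` of the Lagrangian `f x + ∑ j, κ j * h j x`. -/
noncomputable def lagHess (f : X → ℝ) (h : J → X → ℝ) (x : X) (κ : J → ℝ) : X →L[ℝ] X →L[ℝ] ℝ :=
  fderiv ℝ (fderiv ℝ f) x + ∑ j, κ j • fderiv ℝ (fderiv ℝ (h j)) x

theorem lagGrad_sub_lagGrad (x : X) (κ κ' : J → ℝ) :
    lagGrad f h x κ - lagGrad f h x κ' = ∑ j, (κ j - κ' j) • fderiv ℝ (h j) x := by
  simp only [lagGrad, sub_smul, Finset.sum_sub_distrib]
  abel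

theorem lagHess_sub_lagHess (x : X) (κ κ' : J → ℝ) :
    lagHess f h x κ - lagHess f h x κ' = ∑ j, (κ j - κ' j) • fderiv ℝ (fderiv ℝ (h j)) x := by
  simp only [lagHess, sub_smul, Finset.sum_sub_distrib]
  abel

theorem hasFDerivAt_of_contDiff_two (hf : ContDiff ℝ 2 f) (x : X) :
    HasFDerivAt f (fderiv ℝ f x) x :=
  ((hf.differentiable two_ne_zero) x).hasFDerivAt

theorem contDiff_fderiv_of_contDiff_two (hf : ContDiff ℝ 2 f) : ContDiff ℝ 1 (fderiv ℝ f) :=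
  hf.fderiv_right one_add_one_eq_two.le

theorem hasStrictFDerivAt_fderiv (hf : ContDiff ℝ 2 f) (x : X) :
    HasStrictFDerivAt (fderiv ℝ f) (fderiv ℝ (fderiv ℝ f) x) x :=
  (contDiff_fderiv_of_contDiff_two hf).contDiffAt.hasStrictFDerivAt one_ne_zero

theorem hasFDerivAt_lagrangian (hf : ContDiff ℝ 2 f) (hh : ∀ j, ContDiff ℝ 2 (h j)) (κ : J → ℝ)
    (x : X) : HasFDerivAt (fun y => f y + ∑ j, κ j * h j y) (lagGrad f h x κ) x :=
  (hasFDerivAt_of_contDiff_two hf x).fun_add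
    (HasFDerivAt.fun_sum fun j _ => (hasFDerivAt_of_contDiff_two (hh j) x).const_mul (κ j))

theorem hasFDerivAt_lagGrad (hf : ContDiff ℝ 2 f) (hh : ∀ j, ContDiff ℝ 2 (h j)) (κ : J → ℝ)
    (x : X) : HasFDerivAt (fun y => lagGrad f h y κ) (lagHess f h x κ) x :=
  (hasStrictFDerivAt_fderiv hf x).hasFDerivAt.fun_add
    (HasFDerivAt.fun_sum fun j _ =>
      (hasStrictFDerivAt_fderiv (hh j) x).hasFDerivAt.const_smul (κ j))

theorem fderiv_fderiv_lagrangian (hf : ContDiff ℝ 2 f) (hh : ∀ j, ContDiff ℝ 2 (h j)) (κ : J → ℝ)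
    (x : X) : fderiv ℝ (fderiv ℝ fun y => f y + ∑ j, κ j * h j y) x = lagHess f h x κ := by
  rw [funext fun y => (hasFDerivAt_lagrangian hf hh κ y).fderiv,
    (hasFDerivAt_lagGrad hf hh κ x).fderiv]

theorem continuous_lagGrad (hf : ContDiff ℝ 2 f) (hh : ∀ j, ContDiff ℝ 2 (h j)) :
    Continuous fun w : X × (J → ℝ) => lagGrad f h w.1 w.2 := by
  have hobj := (contDiff_fderiv_of_contDiff_two hf).continuous
  have hcon (j : J) := (contDiff_fderiv_of_contDiff_two (hh j)).continuous
  unfold lagGrad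
  fun_prop

theorem continuous_lagHess (hf : ContDiff ℝ 2 f) (hh : ∀ j, ContDiff ℝ 2 (h j)) :
    Continuous fun w : X × (J → ℝ) => lagHess f h w.1 w.2 := by
  have hsecond {g : X → ℝ} (hg : ContDiff ℝ 2 g) :
      Continuous fun w : X × (J → ℝ) => fderiv ℝ (fderiv ℝ g) w.1 :=
    ((contDiff_fderiv_of_contDiff_two hg).continuous_fderiv one_ne_zero).comp continuous_fst
  exact (hsecond hf).add (continuous_finsetSum _ fun j _ =>
    ((continuous_apply j).comp continuous_snd).smul (hsecond (hh j)))

theorem isBigO_sum_smul_sub {Y F : Type*} [NormedAddCommGroup Y] [NormedAddCommGroup F]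
    [NormedSpace ℝ F] {g : J → Y → F} (hg : ∀ j, Continuous (g j)) (xs : Y) (κs : J → ℝ) :
    (fun w : Y × (J → ℝ) => ∑ j, (w.2 j - κs j) • g j w.1) =O[𝓝 (xs, κs)]
      fun w => w - (xs, κs) := by
  refine Asymptotics.IsBigO.fun_sum fun j _ => ?_
  have hcoord : (fun w : Y × (J → ℝ) => w.2 j - κs j) =O[𝓝 (xs, κs)] fun w => w - (xs, κs) :=
    Asymptotics.isBigO_pi.1 (Asymptotics.isBigO_snd_prod' (f' := fun w => w - (xs, κs))) j
  have hbounded : (fun w : Y × (J → ℝ) => g j w.1) =O[𝓝 (xs, κs)] fun _ => (1 : ℝ) :=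
    ((hg j).comp continuous_fst).continuousAt.norm.isBoundedUnder_le.isBigO_one ℝ
  simpa using (hcoord.norm_right.smul hbounded)

theorem isBigO_lagGrad_sub (hf : ContDiff ℝ 2 f) (hh : ∀ j, ContDiff ℝ 2 (h j)) (xs : X)
    (κs : J → ℝ) : (fun w : X × (J → ℝ) => lagGrad f h w.1 w.2 - lagGrad f h xs κs)
      =O[𝓝 (xs, κs)] fun w => w - (xs, κs) := by
  have hbase : (fun w : X × (J → ℝ) => lagGrad f h w.1 κs - lagGrad f h xs κs)
      =O[𝓝 (xs, κs)] fun w => w - (xs, κs) :=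
    ((hasFDerivAt_lagGrad hf hh κs xs).isBigO_sub.comp_tendsto
      (continuousAt_fst (p := (xs, κs)))).trans
      (Asymptotics.isBigO_fst_prod' (f' := fun w => w - (xs, κs)))
  refine ((isBigO_sum_smul_sub (fun j => (contDiff_fderiv_of_contDiff_two (hh j)).continuous)
    xs κs).add hbase).congr_left fun w => ?_
  rw [← lagGrad_sub_lagGrad, sub_add_sub_cancel]

theorem isBigO_lagHess_sub_prod (hh : ∀ j, ContDiff ℝ 2 (h j)) {xs : X} {κs : J → ℝ}
    (hcalm : (fun x => lagHess f h x κs - lagHess f h xs κs) =O[𝓝 xs] fun x => x - xs) :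
    (fun w : X × (J → ℝ) => lagHess f h w.1 w.2 - lagHess f h xs κs)
      =O[𝓝 (xs, κs)] fun w => w - (xs, κs) := by
  have hfst : (fun w : X × (J → ℝ) => w.1 - xs) =O[𝓝 (xs, κs)] fun w => w - (xs, κs) :=
    Asymptotics.isBigO_fst_prod' (f' := fun w => w - (xs, κs))
  have hbase := (hcalm.comp_tendsto (continuousAt_fst (p := (xs, κs)))).trans hfst
  refine ((isBigO_sum_smul_sub (fun j => (contDiff_fderiv_of_contDiff_two (hh j)).continuous_fderiv
    one_ne_zero) xs κs).add hbase).congr_left fun w => ?_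
  rw [← lagHess_sub_lagHess, Function.comp_apply, sub_add_sub_cancel]

end Lagrangian

/-! ### The second-order sufficient condition -/

section SecondOrder

variable {X : Type*} [NormedAddCommGroup X] [NormedSpace ℝ X] {J : Type*} [Fintype J]
  {f : X → ℝ} {h : J → X → ℝ}

theorem isLocalMin_of_coercive_fderiv {f' : X → X →L[ℝ] ℝ} {f'' : X →L[ℝ] X →L[ℝ] ℝ} {x : X}
    (hf : ∀ y, HasFDerivAt f (f' y) y) (h0 : f' x = 0) (hf' : HasFDerivAt f' f'' x) {c : ℝ}
    (hc : 0 < c) (hpos : ∀ v, c * ‖v‖ ^ 2 ≤ f'' v v) : IsLocalMin f x := by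
  obtain ⟨r, hr, hball⟩ := Metric.eventually_nhds_iff_ball.1 (hf'.isLittleO.def hc)
  have hradial (y : X) (hy : y ∈ Metric.ball x r) : 0 ≤ f' y (y - x) := by
    have herr : |f' y (y - x) - f'' (y - x) (y - x)| ≤ c * ‖y - x‖ * ‖y - x‖ := by
      have := hball y hy
      rw [h0, sub_zero] at this
      exact (f' y - f'' (y - x)).le_of_opNorm_le this (y - x)
    nlinarith [hpos (y - x), neg_abs_le (f' y (y - x) - f'' (y - x) (y - x))]
  filter_upwards [Metric.ball_mem_nhds x hr] with y hy
  obtain ⟨u, hu, hmean⟩ := domain_mvt (fun u _ => (hf u).hasFDerivWithinAt) (convex_ball x r)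
    (Metric.mem_ball_self hr) hy
  have hu_ball := (convex_ball x r).segment_subset (Metric.mem_ball_self hr) hy hu
  rw [segment_eq_image'] at hu
  obtain ⟨t, ht, rfl⟩ := hu
  suffices 0 ≤ f' (x + t • (y - x)) (y - x) by linarith
  rcases ht.1.eq_or_lt with rfl | ht0
  · simp [h0]
  · have := hradial _ hu_ball
    rw [add_sub_cancel_left, map_smul, smul_eq_mul] at this
    exact nonneg_of_mul_nonneg_right this ht0

/-- The augmented Lagrangian `f + ∑ j, κ j * h j + T / 2 * ∑ j ∈ s, h j ^ 2`. It is at most `f` at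
feasible points near a stationary point with active set `s` and positive multipliers, which reduces
constrained to unconstrained minimality. -/
noncomputable def augLagrangian {Y : Type*} (s : Finset J) (T : ℝ) (f : Y → ℝ) (h : J → Y → ℝ)
    (κ : J → ℝ) (y : Y) : ℝ :=
  f y + ∑ j, κ j * h j y + ∑ j ∈ s, T / 2 * (h j y * h j y)

theorem hasFDerivAt_augLagrangian (hf : ContDiff ℝ 2 f) (hh : ∀ j, ContDiff ℝ 2 (h j))
    (s : Finset J) (T : ℝ) (κ : J → ℝ) (y : X) :
    HasFDerivAt (augLagrangian s T f h κ)
      (lagGrad f h y κ + ∑ j ∈ s, T • (h j y • fderiv ℝ (h j) y)) y := by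
  refine (hasFDerivAt_lagrangian hf hh κ y).fun_add (HasFDerivAt.fun_sum fun j _ => ?_)
  have hj := hasFDerivAt_of_contDiff_two (hh j) y
  refine ((hj.mul hj).const_mul (T / 2)).congr_fderiv ?_
  ext v
  simp only [smul_apply, add_apply, smul_eq_mul]
  ring

theorem hasFDerivAt_augLagrangian_gradient (hf : ContDiff ℝ 2 f) (hh : ∀ j, ContDiff ℝ 2 (h j))
    {s : Finset J} (T : ℝ) (κ : J → ℝ) {x : X} (hs : ∀ j ∈ s, h j x = 0) :
    HasFDerivAt (fun y => lagGrad f h y κ + ∑ j ∈ s, T • (h j y • fderiv ℝ (h j) y))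
      (penalizedForm s T (fun j => fderiv ℝ (h j) x) (lagHess f h x κ)) x := by
  have hpenalty (j : J) (hj : j ∈ s) : HasFDerivAt (fun y => T • (h j y • fderiv ℝ (h j) y))
      (T • (fderiv ℝ (h j) x).smulRight (fderiv ℝ (h j) x)) x := by
    refine (((hasFDerivAt_of_contDiff_two (hh j) x).smul
      (hasStrictFDerivAt_fderiv (hh j) x).hasFDerivAt).const_smul T).congr_fderiv ?_
    rw [hs j hj, zero_smul, zero_add]
  refine ((hasFDerivAt_lagGrad hf hh κ x).fun_add (HasFDerivAt.fun_sum hpenalty)).congr_fderiv ?_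
  rw [penalizedForm, Finset.smul_sum]

/-- On the feasible set `κ j * h j + T / 2 * h j ^ 2 ≤ 0` as long as `T / 2 * |h j| ≤ κ j`. -/
theorem eventually_augLagrangian_le {Y : Type*} [TopologicalSpace Y] (f : Y → ℝ)
    {h : J → Y → ℝ} (hh : ∀ j, Continuous (h j)) {s : Finset J} (T : ℝ) {κ : J → ℝ} {x : Y}
    (hs : ∀ j ∈ s, h j x = 0) (hpos : ∀ j ∈ s, 0 < κ j)
    (hnonneg : ∀ j, 0 ≤ κ j) :
    ∀ᶠ y in 𝓝 x, (∀ j, h j y ≤ 0) → augLagrangian s T f h κ y ≤ f y := by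
  have hsmall : ∀ᶠ y in 𝓝 x, ∀ j ∈ s, |T / 2 * h j y| < κ j := by
    refine (Finset.eventually_all s).2 fun j hj => ?_
    have hcont : Continuous fun y => |T / 2 * h j y| := by fun_prop
    exact hcont.continuousAt.eventually (gt_mem_nhds (by simpa [hs j hj] using hpos j hj))
  filter_upwards [hsmall] with y hy hfeas
  have hmult : ∑ j, κ j * h j y ≤ ∑ j ∈ s, κ j * h j y := by
    classical
    rw [← Finset.sum_sdiff (Finset.subset_univ s)]
    exact add_le_of_nonpos_left (Finset.sum_nonpos fun j _ =>
      mul_nonpos_of_nonneg_of_nonpos (hnonneg j) (hfeas j))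
  have hpenalty : ∑ j ∈ s, κ j * h j y + ∑ j ∈ s, T / 2 * (h j y * h j y) ≤ 0 := by
    rw [← Finset.sum_add_distrib]
    refine Finset.sum_nonpos fun j hj => ?_
    have hfactor : 0 ≤ κ j + T / 2 * h j y := by
      linarith [neg_abs_le (T / 2 * h j y), hy j hj]
    calc κ j * h j y + T / 2 * (h j y * h j y) = (κ j + T / 2 * h j y) * h j y := by ring
      _ ≤ 0 := mul_nonpos_of_nonneg_of_nonpos hfactor (hfeas j)
  rw [augLagrangian]
  linarith

theorem isLocalMinOn_of_second_order [FiniteDimensional ℝ X] (hf : ContDiff ℝ 2 f)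
    (hh : ∀ j, ContDiff ℝ 2 (h j)) {x : X} {κ : J → ℝ} (hstat : lagGrad f h x κ = 0)
    (hpos : ∀ j ∈ activeSet h x, 0 < κ j) (hzero : ∀ j ∉ activeSet h x, κ j = 0)
    (hsosc : ∀ v, v ≠ 0 → (∀ j ∈ activeSet h x, fderiv ℝ (h j) x v = 0) →
      0 < lagHess f h x κ v v) :
    IsLocalMinOn f {y | ∀ j, h j y ≤ 0} x := by
  have hactive (j : J) (hj : j ∈ activeSet h x) : h j x = 0 := mem_activeSet.1 hj
  have hnonneg (j : J) : 0 ≤ κ j := by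
    by_cases hj : j ∈ activeSet h x
    exacts [(hpos j hj).le, (hzero j hj).ge]
  obtain ⟨T, c, hc, hcoercive⟩ := exists_penalizedForm_coercive _ _ _ hsosc
  have hgrad : lagGrad f h x κ + ∑ j ∈ activeSet h x, T • (h j x • fderiv ℝ (h j) x) = 0 := by
    rw [hstat, zero_add]
    exact Finset.sum_eq_zero fun j hj => by rw [hactive j hj, zero_smul, smul_zero]
  have hmin := isLocalMin_of_coercive_fderiv (hasFDerivAt_augLagrangian hf hh _ T κ) hgrad
    (hasFDerivAt_augLagrangian_gradient hf hh T κ hactive) hc hcoercive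
  have hvalue : augLagrangian (activeSet h x) T f h κ x = f x := by
    have hcompl (j : J) : κ j * h j x = 0 := by
      by_cases hj : j ∈ activeSet h x
      · rw [hactive j hj, mul_zero]
      · rw [hzero j hj, zero_mul]
    simp only [augLagrangian, hcompl, Finset.sum_const_zero, add_zero]
    rw [Finset.sum_eq_zero fun j hj => by rw [hactive j hj, mul_zero, mul_zero], add_zero]
  filter_upwards [nhdsWithin_le_nhds hmin, nhdsWithin_le_nhds (eventually_augLagrangian_le f
    (fun j => (hh j).continuous) T hactive hpos hnonneg), self_mem_nhdsWithin] with y hy hle hfeas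
  exact hvalue ▸ hy.trans (hle hfeas)

end SecondOrder

/-! ### The proximal problem near a regular KKT point -/

section Proximal

variable {X : Type*} [NormedAddCommGroup X] [NormedSpace ℝ X] {J : Type*} [Fintype J]

/-- The objective `f y + a y + 1 / 2 * B (y - z) (y - z)` of the proximal problem with prox-center
`z` and linear term `a`. All local problems of the parallel step together form one such problem. -/
noncomputable def proxObj (f : X → ℝ) (B : X →L[ℝ] X →L[ℝ] ℝ) (z : X) (a : X →L[ℝ] ℝ) (y : X) : ℝ :=
  f y + a y + 1 / 2 * B (y - z) (y - z)

/-- The KKT conditions of `min proxObj f B z a y` subject to `h y ≤ 0`, for symmetric `B`. -/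
structure ProxKKT (f : X → ℝ) (h : J → X → ℝ) (B : X →L[ℝ] X →L[ℝ] ℝ) (z : X) (a : X →L[ℝ] ℝ)
    (x : X) (κ : J → ℝ) : Prop where
  stationary : lagGrad f h x κ + a + B (x - z) = 0
  feasible : ∀ j, h j x ≤ 0
  nonneg : ∀ j, 0 ≤ κ j
  compl : ∀ j, κ j * h j x = 0

/-- `(x, κ)` is a KKT point of the `C²` problem `min f y + a y` subject to `h y ≤ 0` at which the
active gradients are linearly independent, strict complementarity holds, and the Hessian of the
Lagrangian is positive on the null space of the active gradients. -/
structure RegularPoint (f : X → ℝ) (h : J → X → ℝ) (a : X →L[ℝ] ℝ) (x : X) (κ : J → ℝ) :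
    Prop where
  contDiff_obj : ContDiff ℝ 2 f
  contDiff_con : ∀ j, ContDiff ℝ 2 (h j)
  stationary : lagGrad f h x κ + a = 0
  feasible : ∀ j, h j x ≤ 0
  pos : ∀ j ∈ activeSet h x, 0 < κ j
  zero : ∀ j ∉ activeSet h x, κ j = 0
  indep : LinearIndepOn ℝ (fun j => fderiv ℝ (h j) x) (activeSet h x : Set J)
  sosc : ∀ v, v ≠ 0 → (∀ j ∈ activeSet h x, fderiv ℝ (h j) x v = 0) → 0 < lagHess f h x κ v v

open Classical in
/-- The square system behind `ProxKKT` for a prescribed active set `s`: its solutions satisfy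
`kktMap s f h B (x, κ) = (B z - a, 0)`. -/
noncomputable def kktMap (s : Finset J) (f : X → ℝ) (h : J → X → ℝ) (B : X →L[ℝ] X →L[ℝ] ℝ)
    (w : X × (J → ℝ)) : (X →L[ℝ] ℝ) × (J → ℝ) :=
  (lagGrad f h w.1 w.2 + B w.1, fun j => if j ∈ s then h j w.1 else w.2 j)

variable {f : X → ℝ} {h : J → X → ℝ} {B : X →L[ℝ] X →L[ℝ] ℝ} {z x : X} {a : X →L[ℝ] ℝ} {κ : J → ℝ}

theorem kktMap_eq_iff {s : Finset J} : kktMap s f h B (x, κ) = (B z - a, 0) ↔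
    lagGrad f h x κ + a + B (x - z) = 0 ∧ (∀ j ∈ s, h j x = 0) ∧ ∀ j ∉ s, κ j = 0 := by
  have hstat : lagGrad f h x κ + B x = B z - a ↔ lagGrad f h x κ + a + B (x - z) = 0 := by
    rw [← sub_eq_zero, map_sub]
    exact Eq.congr_left (by abel)
  rw [kktMap, Prod.mk.injEq, hstat, funext_iff, ← forall_and]
  refine and_congr_right' (forall_congr' fun j => ?_)
  by_cases hj : j ∈ s <;> simp [hj]

theorem ProxKKT.kktMap_eq (hkkt : ProxKKT f h B z a x κ) :
    kktMap (activeSet h x) f h B (x, κ) = (B z - a, 0) :=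
  kktMap_eq_iff.2 ⟨hkkt.stationary, fun _ => mem_activeSet.1, fun j hj =>
    (mul_eq_zero.1 (hkkt.compl j)).resolve_right (mt mem_activeSet.2 hj)⟩

theorem hasStrictFDerivAt_kktMap (hf : ContDiff ℝ 2 f) (hh : ∀ j, ContDiff ℝ 2 (h j))
    (s : Finset J) (w : X × (J → ℝ)) :
    HasStrictFDerivAt (kktMap s f h B)
      (saddleMap s 0 (lagHess f h w.1 w.2 + B) fun j => fderiv ℝ (h j) w.1) w := by
  have hfst : HasStrictFDerivAt Prod.fst (ContinuousLinearMap.fst ℝ X (J → ℝ)) w :=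
    hasStrictFDerivAt_fst
  have hmult (j : J) : HasStrictFDerivAt (fun w : X × (J → ℝ) => w.2 j)
      ((ContinuousLinearMap.proj j).comp (ContinuousLinearMap.snd ℝ X (J → ℝ))) w :=
    ((ContinuousLinearMap.proj (R := ℝ) (φ := fun _ : J => ℝ) j).comp
      (ContinuousLinearMap.snd ℝ X (J → ℝ))).hasStrictFDerivAt
  have hlag := ((hasStrictFDerivAt_fderiv hf w.1).comp w hfst).fun_add
    (HasStrictFDerivAt.fun_sum (u := Finset.univ) fun j _ =>
      (hmult j).smul ((hasStrictFDerivAt_fderiv (hh j) w.1).comp w hfst))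
  have hcon : HasStrictFDerivAt (fun w => (kktMap s f h B w).2)
      ((ContinuousLinearMap.snd ℝ _ _).comp (saddleMap s 0 (lagHess f h w.1 w.2 + B)
        fun j => fderiv ℝ (h j) w.1)) w := by
    refine hasStrictFDerivAt_pi'.2 fun j => ?_
    by_cases hj : j ∈ s
    · simp only [kktMap, hj, if_true]
      have hdiff : HasStrictFDerivAt (h j) (fderiv ℝ (h j) w.1) w.1 :=
        (hh j).contDiffAt.hasStrictFDerivAt two_ne_zero
      exact (hdiff.comp w hfst).congr_fderiv (ContinuousLinearMap.ext fun v => by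
        simp [saddleMap_apply_snd_of_mem _ hj])
    · simp only [kktMap, hj, if_false]
      exact (hmult j).congr_fderiv (ContinuousLinearMap.ext fun v => by
        simp [saddleMap_apply_snd_of_notMem _ hj])
  refine ((hlag.fun_add (B.hasStrictFDerivAt.comp w hfst)).prodMk hcon).congr_fderiv ?_
  refine ContinuousLinearMap.ext fun v => Prod.ext (ContinuousLinearMap.ext fun u => ?_) rfl
  simp only [lagHess, saddleMap_apply, Finset.sum_add_distrib, ContinuousLinearMap.prod_apply,
    add_apply, sum_apply, smul_apply, smul_eq_mul, ContinuousLinearMap.comp_apply,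
    ContinuousLinearMap.coe_fst', ContinuousLinearMap.coe_snd', ContinuousLinearMap.proj_apply,
    ContinuousLinearMap.smulRight_apply]
  ring

section Derivatives

variable (hf : ContDiff ℝ 2 f) (hsymm : ∀ u v, B u v = B v u)
include hf hsymm

theorem hasFDerivAt_proxObj (y : X) :
    HasFDerivAt (proxObj f B z a) (fderiv ℝ f y + a + B (y - z)) y := by
  have hsub : HasFDerivAt (fun y => y - z) (ContinuousLinearMap.id ℝ X) y :=
    (hasFDerivAt_id y).sub_const z
  have hquad := ((B.hasFDerivAt.comp y hsub).clm_apply hsub).const_mul (1 / 2)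
  refine (((hasFDerivAt_of_contDiff_two hf y).fun_add a.hasFDerivAt).fun_add hquad).congr_fderiv ?_
  ext v
  simp only [one_div, Function.comp_apply, map_sub, ContinuousLinearMap.comp_id, smul_add,
    add_apply, smul_apply, sub_apply, smul_eq_mul, ContinuousLinearMap.flip_apply, hsymm v]
  ring

theorem lagGrad_proxObj : lagGrad (proxObj f B z a) h x κ = lagGrad f h x κ + a + B (x - z) := by
  rw [lagGrad, (hasFDerivAt_proxObj hf hsymm x).fderiv, lagGrad]
  abel

theorem lagHess_proxObj : lagHess (proxObj f B z a) h x κ = lagHess f h x κ + B := by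
  have hderiv : HasFDerivAt (fun y => fderiv ℝ f y + a + B (y - z))
      (fderiv ℝ (fderiv ℝ f) x + B) x := by
    simpa using ((hasStrictFDerivAt_fderiv hf x).hasFDerivAt.add_const a).fun_add
      (B.hasFDerivAt.comp x ((hasFDerivAt_id x).sub_const z))
  have hgrad : fderiv ℝ (proxObj f B z a) = fun y => fderiv ℝ f y + a + B (y - z) :=
    funext fun y => (hasFDerivAt_proxObj hf hsymm y).fderiv
  rw [lagHess, hgrad, hderiv.fderiv, lagHess]
  abel

end Derivatives

theorem contDiff_proxObj (hf : ContDiff ℝ 2 f) : ContDiff ℝ 2 (proxObj f B z a) := by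
  unfold proxObj
  fun_prop

end Proximal

section ProximalEstimates

variable {X : Type*} [NormedAddCommGroup X] [NormedSpace ℝ X] {J : Type*} [Fintype J]
  {f : X → ℝ} {h : J → X → ℝ} {B : X →L[ℝ] X →L[ℝ] ℝ} {as : X →L[ℝ] ℝ} {xs : X} {κs : J → ℝ}

namespace RegularPoint

variable (hreg : RegularPoint f h as xs κs)
include hreg

theorem nonneg (j : J) : 0 ≤ κs j := by
  by_cases hj : j ∈ activeSet h xs
  exacts [(hreg.pos j hj).le, (hreg.zero j hj).ge]

theorem mul_eq_zero (j : J) : κs j * h j xs = 0 := by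
  by_cases hj : j ∈ activeSet h xs
  · rw [mem_activeSet.1 hj, mul_zero]
  · rw [hreg.zero j hj, zero_mul]

theorem proxKKT : ProxKKT f h B xs as xs κs where
  stationary := by rw [sub_self, map_zero, add_zero, hreg.stationary]
  feasible := hreg.feasible
  nonneg := hreg.nonneg
  compl := hreg.mul_eq_zero

theorem continuous_con (j : J) : Continuous (h j) := (hreg.contDiff_con j).continuous

theorem continuous_fderiv_con : Continuous fun x j => fderiv ℝ (h j) x :=
  continuous_pi fun j => (contDiff_fderiv_of_contDiff_two (hreg.contDiff_con j)).continuous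

theorem eventually_con_neg : ∀ᶠ x in 𝓝 xs, ∀ j ∉ activeSet h xs, h j x < 0 := by
  refine eventually_all.2 fun j => ?_
  by_cases hj : j ∈ activeSet h xs
  · exact Eventually.of_forall fun _ hj' => absurd hj hj'
  have hneg : h j xs < 0 := (hreg.feasible j).lt_of_ne (mt mem_activeSet.2 hj)
  filter_upwards [(hreg.continuous_con j).continuousAt.eventually_lt_const hneg] with x hx _
  exact hx

theorem eventually_multiplier_pos : ∀ᶠ κ : J → ℝ in 𝓝 κs, ∀ j ∈ activeSet h xs, 0 < κ j := by
  refine eventually_all.2 fun j => ?_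
  by_cases hj : j ∈ activeSet h xs
  · filter_upwards [(continuous_apply j).continuousAt.eventually_const_lt (hreg.pos j hj)]
      with κ hκ _
    exact hκ
  · exact Eventually.of_forall fun _ hj' => absurd hj' hj

theorem eventually_activeSet_eq : ∀ᶠ w : X × (J → ℝ) in 𝓝 (xs, κs),
    (∀ j, w.2 j * h j w.1 = 0) → activeSet h w.1 = activeSet h xs := by
  filter_upwards [continuousAt_fst.eventually hreg.eventually_con_neg,
    continuousAt_snd.eventually hreg.eventually_multiplier_pos] with w hneg hpos hcompl
  ext j
  rw [mem_activeSet]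
  refine ⟨fun hzero => ?_, fun hj =>
    (_root_.mul_eq_zero.1 (hcompl j)).resolve_left (hpos j hj).ne'⟩
  by_contra hj
  exact (hneg j hj).ne hzero

variable (hB : ∀ v, 0 ≤ B v v)
include hB

theorem pos_on_null_space (v : X) (hv : v ≠ 0)
    (hnull : ∀ j ∈ activeSet h xs, fderiv ℝ (h j) xs v = 0) :
    0 < (lagHess f h xs κs + B) v v :=
  add_pos_of_pos_of_nonneg (hreg.sosc v hv hnull) (hB v)

theorem injective_saddleMap : Function.Injective (saddleMap (activeSet h xs) 0
    (lagHess f h xs κs + B) fun j => fderiv ℝ (h j) xs) :=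
  saddleMap_injective (fun _ _ => le_rfl) hreg.indep fun v hv hnull =>
    hreg.pos_on_null_space hB v hv fun j hj => hnull j hj rfl

variable [FiniteDimensional ℝ X]

/-- The active gradients remain linearly independent near `xs`, so multipliers that are
complementary are determined by the gradient of the Lagrangian. -/
theorem exists_norm_multiplier_sub_le : ∃ M > 0, ∀ᶠ x in 𝓝 xs, ∀ κ : J → ℝ,
    (∀ j, κ j * h j x = 0) → ‖κ - κs‖ ≤ M * ‖lagGrad f h x κ - lagGrad f h x κs‖ := by
  obtain ⟨M, hM, hbound⟩ := eventually_norm_le_mul_saddleMap (hreg.injective_saddleMap hB)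
  have hcont : Continuous fun x : X => ((0 : J → ℝ), lagHess f h xs κs + B,
      fun j => fderiv ℝ (h j) x) :=
    continuous_const.prodMk (continuous_const.prodMk hreg.continuous_fderiv_con)
  refine ⟨M, hM, ?_⟩
  filter_upwards [hcont.continuousAt.eventually hbound, hreg.eventually_con_neg]
    with x hinj hneg κ hcompl
  have hsaddle : saddleMap (activeSet h xs) 0 (lagHess f h xs κs + B)
      (fun j => fderiv ℝ (h j) x) (0, κ - κs) =
        (lagGrad f h x κ - lagGrad f h x κs, 0) := by
    rw [saddleMap_apply, lagGrad_sub_lagGrad]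
    refine Prod.ext (by simp) (funext fun j => ?_)
    by_cases hj : j ∈ activeSet h xs
    · simp [hj]
    · have hκ : κ j = 0 := (_root_.mul_eq_zero.1 (hcompl j)).resolve_right (hneg j hj).ne
      simp [hj, hκ, hreg.zero j hj]
  calc ‖κ - κs‖ ≤ ‖((0 : X), κ - κs)‖ := norm_snd_le (0, κ - κs)
    _ ≤ M * ‖lagGrad f h x κ - lagGrad f h x κs‖ := (hinj _).trans_eq (by rw [hsaddle]; simp)

/-- KKT multipliers of nearby proximal problems converge to `κs`. -/
theorem eventually_of_proxKKT {p : X × (J → ℝ) → Prop} (hp : ∀ᶠ w in 𝓝 (xs, κs), p w) :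
    ∀ᶠ u : (X × (X →L[ℝ] ℝ)) × X in 𝓝 ((xs, as), xs), ∀ κ, ProxKKT f h B u.1.1 u.1.2 u.2 κ →
      p (u.2, κ) := by
  obtain ⟨r, hr, hball⟩ := Metric.eventually_nhds_iff.1 hp
  obtain ⟨M, -, hbound⟩ := hreg.exists_norm_multiplier_sub_le hB
  let residual (u : (X × (X →L[ℝ] ℝ)) × X) : ℝ :=
    M * ‖lagGrad f h u.2 κs + u.1.2 + B (u.2 - u.1.1)‖
  have hcont : Continuous residual := by
    have hgrad : Continuous fun u : (X × (X →L[ℝ] ℝ)) × X => lagGrad f h u.2 κs :=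
      (continuous_lagGrad hreg.contDiff_obj hreg.contDiff_con).comp
        (continuous_snd.prodMk continuous_const)
    fun_prop
  have hzero : residual ((xs, as), xs) = 0 := by simp [residual, hreg.stationary]
  filter_upwards [hcont.continuousAt.eventually_lt_const (hzero ▸ hr),
    continuousAt_snd.eventually hbound, continuousAt_snd.eventually (Metric.ball_mem_nhds xs hr)]
    with u hsmall hmult hx κ hkkt
  have hgrad : lagGrad f h u.2 κ - lagGrad f h u.2 κs =
      -(lagGrad f h u.2 κs + u.1.2 + B (u.2 - u.1.1)) := by
    rw [eq_neg_iff_add_eq_zero, ← hkkt.stationary]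
    abel
  refine hball (max_lt hx ?_)
  calc dist κ κs = ‖κ - κs‖ := dist_eq_norm _ _
    _ ≤ residual u := (hmult κ hkkt.compl).trans_eq (by rw [hgrad, norm_neg])
    _ < r := hsmall

theorem exists_norm_sub_le_mul_kktMap : ∃ χ > 0, ∀ᶠ w in 𝓝 (xs, κs), ‖w - (xs, κs)‖ ≤
    χ * ‖kktMap (activeSet h xs) f h B w - kktMap (activeSet h xs) f h B (xs, κs)‖ := by
  obtain ⟨K, -, hK⟩ := LinearMap.exists_antilipschitzWith
    (saddleMap (activeSet h xs) 0 (lagHess f h xs κs + B) fun j => fderiv ℝ (h j) xs).toLinearMap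
    (LinearMap.ker_eq_bot.2 (hreg.injective_saddleMap hB))
  have hderiv := (hasStrictFDerivAt_kktMap (B := B) hreg.contDiff_obj hreg.contDiff_con
    (activeSet h xs) (xs, κs)).hasFDerivAt
  obtain ⟨χ, hχ, hbound⟩ :=
    (hderiv.isTheta_sub (hK.isInducing (ContinuousLinearMap.continuous _))).isBigO_symm.exists_pos
  exact ⟨χ, hχ, hbound.bound⟩

theorem exists_proxKKT_bound : ∃ χ > 0, ∀ᶠ u : (X × (X →L[ℝ] ℝ)) × X in 𝓝 ((xs, as), xs),
    ∀ κ, ProxKKT f h B u.1.1 u.1.2 u.2 κ → activeSet h u.2 = activeSet h xs ∧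
      ‖(u.2, κ) - (xs, κs)‖ ≤ χ * ‖u.1 - (xs, as)‖ := by
  obtain ⟨χ, hχ, hbound⟩ := hreg.exists_norm_sub_le_mul_kktMap hB
  refine ⟨χ * (‖B‖ + 1), by positivity, ?_⟩
  filter_upwards [hreg.eventually_of_proxKKT hB hreg.eventually_activeSet_eq,
    hreg.eventually_of_proxKKT hB hbound] with u hactive hnorm κ hkkt
  refine ⟨hactive κ hkkt hkkt.compl, (hnorm κ hkkt).trans ?_⟩
  rw [mul_assoc]
  gcongr
  have hdiff : kktMap (activeSet h xs) f h B (u.2, κ) - kktMap (activeSet h xs) f h B (xs, κs) =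
      (B (u.1.1 - xs) - (u.1.2 - as), 0) := by
    rw [← hactive κ hkkt hkkt.compl, hkkt.kktMap_eq, hactive κ hkkt hkkt.compl,
      (hreg.proxKKT (B := B)).kktMap_eq, Prod.mk_sub_mk, sub_self, map_sub]
    congr 1
    abel
  calc ‖kktMap (activeSet h xs) f h B (u.2, κ) - kktMap (activeSet h xs) f h B (xs, κs)‖
      = ‖B (u.1.1 - xs) - (u.1.2 - as)‖ := by rw [hdiff]; simp
    _ ≤ ‖B‖ * ‖u.1.1 - xs‖ + ‖u.1.2 - as‖ := (norm_sub_le _ _).trans (by grw [B.le_opNorm])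
    _ ≤ ‖B‖ * ‖u.1 - (xs, as)‖ + ‖u.1 - (xs, as)‖ := by
      gcongr
      exacts [norm_fst_le (u.1 - (xs, as)), norm_snd_le (u.1 - (xs, as))]
    _ = (‖B‖ + 1) * ‖u.1 - (xs, as)‖ := by ring

theorem eventually_exists_kktMap_eq {p : X × (J → ℝ) → Prop} (hp : ∀ᶠ w in 𝓝 (xs, κs), p w) :
    ∀ᶠ b : X × (X →L[ℝ] ℝ) in 𝓝 (xs, as), ∃ x κ, p (x, κ) ∧
      kktMap (activeSet h xs) f h B (x, κ) = (B b.1 - b.2, 0) := by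
  have hopen : map (kktMap (activeSet h xs) f h B) (𝓝 (xs, κs)) = 𝓝 (B xs - as, 0) := by
    have : CompleteSpace X := FiniteDimensional.complete ℝ X
    have hderiv := hasStrictFDerivAt_kktMap (B := B) hreg.contDiff_obj hreg.contDiff_con
      (activeSet h xs) (xs, κs)
    have hsurj := saddleMap_surjective (hreg.injective_saddleMap hB)
    rw [hderiv.map_nhds_eq_of_surj (LinearMap.range_eq_top.2 hsurj), hreg.proxKKT.kktMap_eq]
  have hrhs : Tendsto (fun b : X × (X →L[ℝ] ℝ) => (B b.1 - b.2, (0 : J → ℝ))) (𝓝 (xs, as))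
      (map (kktMap (activeSet h xs) f h B) (𝓝 (xs, κs))) := by
    rw [hopen]
    exact Continuous.tendsto' (by fun_prop) _ _ rfl
  filter_upwards [hrhs (image_mem_map hp)] with b ⟨⟨x, κ⟩, hw, heq⟩
  exact ⟨x, κ, hw, heq⟩

theorem eventually_pos_on_null_space_lagHess : ∀ᶠ w : X × (J → ℝ) in 𝓝 (xs, κs), ∀ v, v ≠ 0 →
    (∀ j ∈ activeSet h xs, fderiv ℝ (h j) w.1 v = 0) → 0 < (lagHess f h w.1 w.2 + B) v v := by
  let data (w : X × (J → ℝ)) : (J → X →L[ℝ] ℝ) × (X →L[ℝ] X →L[ℝ] ℝ) :=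
    (fun j => fderiv ℝ (h j) w.1, lagHess f h w.1 w.2 + B)
  have hcont : Continuous data :=
    (hreg.continuous_fderiv_con.comp continuous_fst).prodMk
      ((continuous_lagHess hreg.contDiff_obj hreg.contDiff_con).add continuous_const)
  exact hcont.continuousAt.eventually (eventually_pos_on_null_space _ (data (xs, κs)).1
    (data (xs, κs)).2 (hreg.pos_on_null_space hB))

theorem eventually_exists_proxKKT (hsymm : ∀ u v, B u v = B v u) {δ : ℝ} (hδ : 0 < δ) :
    ∀ᶠ b : X × (X →L[ℝ] ℝ) in 𝓝 (xs, as), ∃ x κ, ProxKKT f h B b.1 b.2 x κ ∧ dist x b.1 < δ ∧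
      IsLocalMinOn (proxObj f B b.1 b.2) {y | ∀ j, h j y ≤ 0} x := by
  have hball := Metric.ball_mem_nhds xs (half_pos hδ)
  filter_upwards [hreg.eventually_exists_kktMap_eq hB
      ((((hreg.eventually_pos_on_null_space_lagHess hB).and
        (continuousAt_fst.eventually hreg.eventually_con_neg)).and
        (continuousAt_snd.eventually hreg.eventually_multiplier_pos)).and
        (continuousAt_fst.eventually hball)),
    continuousAt_fst.eventually hball] with b ⟨x, κ, ⟨⟨⟨hpos, hneg⟩, hκ⟩, hx⟩, heq⟩ hb
  obtain ⟨hstat, hactive, hoff⟩ := kktMap_eq_iff.1 heq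
  have hset : activeSet h x = activeSet h xs := by
    ext j
    refine ⟨fun hj => ?_, fun hj => mem_activeSet.2 (hactive j hj)⟩
    by_contra hj'
    exact (hneg j hj').ne (mem_activeSet.1 hj)
  have hkkt : ProxKKT f h B b.1 b.2 x κ := by
    refine ⟨hstat, fun j => ?_, fun j => ?_, fun j => ?_⟩ <;> by_cases hj : j ∈ activeSet h xs
    exacts [(hactive j hj).le, (hneg j hj).le, (hκ j hj).le, (hoff j hj).ge,
      by rw [hactive j hj, mul_zero], by rw [hoff j hj, zero_mul]]
  have hnear : dist x b.1 < δ :=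
    (dist_triangle_right x b.1 xs).trans_lt ((add_lt_add hx hb).trans_eq (add_halves δ))
  have hf := hreg.contDiff_obj
  exact ⟨x, κ, hkkt, hnear, isLocalMinOn_of_second_order (contDiff_proxObj hf) hreg.contDiff_con
    (by rw [lagGrad_proxObj hf hsymm, hstat]) (by rwa [hset]) (by rwa [hset])
    (by rwa [hset, lagHess_proxObj hf hsymm])⟩

end RegularPoint

end ProximalEstimates

/-! ### The regularized sequential quadratic programming step -/

section SQPStep

theorem isBigO_sub_sub_norm_sq {E F : Type*} [NormedAddCommGroup E] [NormedSpace ℝ E]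
    [NormedAddCommGroup F] [NormedSpace ℝ F] {f : E → F} {f' : E → E →L[ℝ] F} {x : E}
    (hf : ∀ᶠ y in 𝓝 x, HasFDerivAt f (f' y) y)
    (hcalm : (fun y => f' y - f' x) =O[𝓝 x] fun y => y - x) :
    (fun y => f y - f x - f' x (y - x)) =O[𝓝 x] fun y => ‖y - x‖ ^ 2 := by
  obtain ⟨C, hCpos, hC⟩ := hcalm.exists_pos
  obtain ⟨r, hr, hball⟩ := Metric.eventually_nhds_iff_ball.1 (hf.and hC.bound)
  refine Asymptotics.IsBigO.of_bound C ?_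
  filter_upwards [Metric.ball_mem_nhds x hr] with y hy
  have hsub : Metric.closedBall x ‖y - x‖ ⊆ Metric.ball x r :=
    Metric.closedBall_subset_ball (by rwa [← dist_eq_norm])
  have hbound (u : E) (hu : u ∈ Metric.closedBall x ‖y - x‖) :
      ‖f' u - f' x‖ ≤ C * ‖y - x‖ := by
    rw [mem_closedBall_iff_norm] at hu
    exact (hball u (hsub (mem_closedBall_iff_norm.2 hu))).2.trans (by gcongr)
  calc ‖f y - f x - f' x (y - x)‖ ≤ C * ‖y - x‖ * ‖y - x‖ :=
        (convex_closedBall x ‖y - x‖).norm_image_sub_le_of_norm_hasFDerivWithin_le'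
          (fun u hu => (hball u (hsub hu)).1.hasFDerivWithinAt) hbound (by simp)
          (mem_closedBall_iff_norm.2 le_rfl)
    _ = C * ‖‖y - x‖ ^ 2‖ := by rw [norm_pow, norm_norm]; ring

variable {X : Type*} [NormedAddCommGroup X] [NormedSpace ℝ X] {J : Type*} [Fintype J]

/-- `(z, κ')` solves, up to the residual `r` in the linearized constraints, the optimality system of
the quadratic program with Hessian `H` at `(x, κ)`, in which the constraints from `s` are linearized
at `x` and relaxed by the regularization `θ j * (κ' j - κ j)`, and the others are dropped. -/
structure SQPStep (s : Finset J) (f : X → ℝ) (h : J → X → ℝ) (θ : J → ℝ) (H : X →L[ℝ] X →L[ℝ] ℝ)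
    (x : X) (κ r : J → ℝ) (z : X) (κ' : J → ℝ) : Prop where
  stationary : H (z - x) + lagGrad f h x κ' = 0
  linearized : ∀ j ∈ s, h j x + fderiv ℝ (h j) x (z - x) - θ j * (κ' j - κ j) = r j
  dropped : ∀ j ∉ s, κ' j = 0

variable {s : Finset J} {f : X → ℝ} {h : J → X → ℝ} {θ : J → ℝ} {H : X →L[ℝ] X →L[ℝ] ℝ}
  {x z xs : X} {κ κ' κs r : J → ℝ}

section Solution

variable (hstat : lagGrad f h xs κs = 0) (hactive : ∀ j ∈ s, h j xs = 0) (hzero : ∀ j ∉ s, κs j = 0)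
include hstat hactive hzero

open Classical in
theorem SQPStep.saddleMap_sub (hstep : SQPStep s f h θ H x κ r z κ') :
    saddleMap s θ H (fun j => fderiv ℝ (h j) x) ((z, κ') - (xs, κs)) =
      (H (x - xs) - (lagGrad f h x κs - lagGrad f h xs κs), fun j => if j ∈ s then
        r j - θ j * (κ j - κs j) - (h j x - h j xs - fderiv ℝ (h j) x (x - xs)) else 0) := by
  rw [saddleMap_apply, Prod.mk_sub_mk]
  refine Prod.ext ?_ (funext fun j => ?_)
  · simp only [Pi.sub_apply, ← lagGrad_sub_lagGrad (f := f)]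
    rw [hstat, sub_zero, eq_sub_iff_add_eq, ← sub_eq_zero, ← hstep.stationary,
      ← sub_add_sub_cancel z x xs, map_add]
    abel
  · by_cases hj : j ∈ s
    · simp only [hj, if_true, ← hstep.linearized j hj, hactive j hj, map_sub, Pi.sub_apply]
      ring
    · simp [hj, hstep.dropped j hj, hzero j hj]

theorem SQPStep.norm_saddleMap_sub_le (hstep : SQPStep s f h θ H x κ r z κ')
    (Q : X →L[ℝ] X →L[ℝ] ℝ) :
    ‖saddleMap s θ H (fun j => fderiv ℝ (h j) x) ((z, κ') - (xs, κs))‖ ≤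
      ‖H - Q‖ * ‖x - xs‖ + ‖lagGrad f h x κs - lagGrad f h xs κs - Q (x - xs)‖ +
        ‖fun j => h j x - h j xs - fderiv ℝ (h j) x (x - xs)‖ + ‖θ‖ * ‖κ - κs‖ + ‖r‖ := by
  set gradErr := lagGrad f h x κs - lagGrad f h xs κs - Q (x - xs)
  set conErr := fun j => h j x - h j xs - fderiv ℝ (h j) x (x - xs)
  rw [hstep.saddleMap_sub hstat hactive hzero]
  refine norm_prod_le_iff.2 ⟨?_, (pi_norm_le_iff_of_nonneg (by positivity)).2 fun j => ?_⟩
  · have hsplit : H (x - xs) - (lagGrad f h x κs - lagGrad f h xs κs) =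
        (H - Q) (x - xs) - gradErr := by
      simp only [gradErr, sub_apply]
      abel
    calc _ ≤ ‖H - Q‖ * ‖x - xs‖ + ‖gradErr‖ := by
          rw [hsplit]
          exact (norm_sub_le _ _).trans (by grw [ContinuousLinearMap.le_opNorm])
      _ ≤ _ := by linarith [norm_nonneg conErr, norm_nonneg r,
          mul_nonneg (norm_nonneg θ) (norm_nonneg (κ - κs))]
  · have hrow : ‖r j - θ j * (κ j - κs j) - conErr j‖ ≤ ‖r‖ + ‖θ‖ * ‖κ - κs‖ + ‖conErr‖ := by
      refine (norm_sub_le _ _).trans (add_le_add ((norm_sub_le _ _).trans (add_le_add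
        (norm_le_pi_norm r j) ?_)) (norm_le_pi_norm conErr j))
      rw [norm_mul]
      exact mul_le_mul (norm_le_pi_norm θ j) (norm_le_pi_norm (κ - κs) j) (norm_nonneg _)
        (norm_nonneg _)
    calc _ ≤ ‖r j - θ j * (κ j - κs j) - conErr j‖ := by
          by_cases hj : j ∈ s <;> simp [hj, conErr]
      _ ≤ _ := by linarith [norm_nonneg gradErr,
          mul_nonneg (norm_nonneg (H - Q)) (norm_nonneg (x - xs))]

theorem SQPStep.eq_of_eq (hstep : SQPStep s f h θ (lagHess f h xs κs) xs κs 0 z κ')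
    (hinj : Function.Injective (saddleMap s θ (lagHess f h xs κs) fun j => fderiv ℝ (h j) xs)) :
    (z, κ') = (xs, κs) := by
  refine sub_eq_zero.1 ((injective_iff_map_eq_zero _).1 hinj _ ?_)
  rw [hstep.saddleMap_sub hstat hactive hzero]
  simp [Pi.zero_def]

end Solution

theorem isBigO_con_sub_sub (hh : ∀ j, ContDiff ℝ 2 (h j)) (xs : X) :
    (fun x j => h j x - h j xs - fderiv ℝ (h j) x (x - xs)) =O[𝓝 xs] fun x => ‖x - xs‖ ^ 2 := by
  refine Asymptotics.isBigO_pi.2 fun j => ?_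
  have hcalm : (fun x => fderiv ℝ (h j) x - fderiv ℝ (h j) xs) =O[𝓝 xs] fun x => x - xs :=
    (hasStrictFDerivAt_fderiv (hh j) xs).hasFDerivAt.isBigO_sub
  have hbase := isBigO_sub_sub_norm_sq (Eventually.of_forall (hasFDerivAt_of_contDiff_two (hh j)))
    hcalm
  have hmove : (fun x => (fderiv ℝ (h j) x - fderiv ℝ (h j) xs) (x - xs)) =O[𝓝 xs]
      fun x => ‖x - xs‖ ^ 2 := by
    have hprod : (fun x => ‖fderiv ℝ (h j) x - fderiv ℝ (h j) xs‖ * ‖x - xs‖) =O[𝓝 xs]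
        fun x => ‖x - xs‖ ^ 2 := by
      simpa only [pow_two] using hcalm.norm_norm.mul (Asymptotics.isBigO_refl (‖· - xs‖) _)
    exact (Asymptotics.IsBigO.of_norm_le fun x => ContinuousLinearMap.le_opNorm _ _).trans hprod
  refine (hbase.sub hmove).congr_left fun x => ?_
  simp only [sub_apply]
  ring

variable [FiniteDimensional ℝ X]

theorem exists_sqpStep_bound (hf : ContDiff ℝ 2 f) (hh : ∀ j, ContDiff ℝ 2 (h j))
    (hstat : lagGrad f h xs κs = 0) (hactive : ∀ j ∈ s, h j xs = 0) (hzero : ∀ j ∉ s, κs j = 0)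
    (hinj : Function.Injective (saddleMap s 0 (lagHess f h xs κs) fun j => fderiv ℝ (h j) xs))
    (hcalm : (fun x => lagHess f h x κs - lagHess f h xs κs) =O[𝓝 xs] fun x => x - xs) :
    ∃ M > 0, ∀ᶠ u : (J → ℝ) × (X →L[ℝ] X →L[ℝ] ℝ) × X in 𝓝 (0, lagHess f h xs κs, xs),
      ∀ κ r z κ', SQPStep s f h u.1 u.2.1 u.2.2 κ r z κ' → ‖(z, κ') - (xs, κs)‖ ≤
        M * (‖u.2.2 - xs‖ ^ 2 + ‖u.2.1 - lagHess f h xs κs‖ * ‖u.2.2 - xs‖ +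
          ‖u.1‖ * ‖κ - κs‖ + ‖r‖) := by
  obtain ⟨M, hM, hbound⟩ := eventually_norm_le_mul_saddleMap hinj
  obtain ⟨C, hC, hgrad⟩ := (isBigO_sub_sub_norm_sq
    (Eventually.of_forall (hasFDerivAt_lagGrad hf hh κs)) hcalm).exists_pos
  obtain ⟨C', hC', hcon⟩ := (isBigO_con_sub_sub hh xs).exists_pos
  let data (u : (J → ℝ) × (X →L[ℝ] X →L[ℝ] ℝ) × X) :
      (J → ℝ) × (X →L[ℝ] X →L[ℝ] ℝ) × (J → X →L[ℝ] ℝ) :=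
    (u.1, u.2.1, fun j => fderiv ℝ (h j) u.2.2)
  have hdata : Tendsto data (𝓝 (0, lagHess f h xs κs, xs))
      (𝓝 (0, lagHess f h xs κs, fun j => fderiv ℝ (h j) xs)) := by
    have (j : J) := (contDiff_fderiv_of_contDiff_two (hh j)).continuous
    exact Continuous.tendsto' (by fun_prop) _ _ rfl
  have hpoint : Tendsto (fun u : (J → ℝ) × (X →L[ℝ] X →L[ℝ] ℝ) × X => u.2.2)
      (𝓝 (0, lagHess f h xs κs, xs)) (𝓝 xs) := Continuous.tendsto' (by fun_prop) _ _ rfl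
  refine ⟨M * (C + C' + 1), by positivity, ?_⟩
  filter_upwards [hdata.eventually hbound, hpoint.eventually hgrad.bound,
    hpoint.eventually hcon.bound] with ⟨θ, H, x⟩ hinv hgrad hcon κ r z κ' hstep
  rw [norm_pow, norm_norm] at hgrad hcon
  rw [mul_assoc]
  refine (hinv _).trans (mul_le_mul_of_nonneg_left ?_ hM.le)
  refine (hstep.norm_saddleMap_sub_le hstat hactive hzero (lagHess f h xs κs)).trans ?_
  have hrest : 0 ≤ (C + C') * (‖H - lagHess f h xs κs‖ * ‖x - xs‖ + ‖θ‖ * ‖κ - κs‖ + ‖r‖) := by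
    positivity
  linarith [sq_nonneg ‖x - xs‖]

end SQPStep

/-! ### The separable problem on the overall decision space -/

section Coordinates

theorem fderiv_fderiv_comp_const_add {E F : Type*} [NormedAddCommGroup E] [NormedSpace ℝ E]
    [NormedAddCommGroup F] [NormedSpace ℝ F] {g : F → ℝ} (hg : ContDiff ℝ 2 g) (T : E →L[ℝ] F)
    (c : F) (y u v : E) :
    fderiv ℝ (fderiv ℝ fun y => g (c + T y)) y u v =
      fderiv ℝ (fderiv ℝ g) (c + T y) (T u) (T v) := by
  have haffine (y : E) : HasFDerivAt (fun y => c + T y) T y := T.hasFDerivAt.const_add c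
  have hfirst : (fderiv ℝ fun y => g (c + T y)) = fun y => (fderiv ℝ g (c + T y)).comp T :=
    funext fun y => ((hasFDerivAt_of_contDiff_two hg _).comp y (haffine y)).fderiv
  have hsecond : HasFDerivAt (fun y => (fderiv ℝ g (c + T y)).comp T)
      (((ContinuousLinearMap.compL ℝ E F ℝ).flip T).comp
        ((fderiv ℝ (fderiv ℝ g) (c + T y)).comp T)) y :=
    (((ContinuousLinearMap.compL ℝ E F ℝ).flip T).hasFDerivAt).comp y
      ((hasStrictFDerivAt_fderiv hg _).hasFDerivAt.comp y (haffine y))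
  rw [hfirst, hsecond.fderiv]
  rfl

theorem fderiv_fderiv_sum {E ι : Type*} [NormedAddCommGroup E] [NormedSpace ℝ E] [Fintype ι]
    {g : ι → E → ℝ} (hg : ∀ i, ContDiff ℝ 2 (g i)) (y : E) :
    fderiv ℝ (fderiv ℝ fun y => ∑ i, g i y) y = ∑ i, fderiv ℝ (fderiv ℝ (g i)) y := by
  have hfirst : (fderiv ℝ fun y => ∑ i, g i y) = fun y => ∑ i, fderiv ℝ (g i) y :=
    funext fun y =>
      (HasFDerivAt.fun_sum fun i _ => hasFDerivAt_of_contDiff_two (hg i) y).fderiv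
  rw [hfirst]
  exact (HasFDerivAt.fun_sum fun i _ => (hasStrictFDerivAt_fderiv (hg i) y).hasFDerivAt).fderiv

variable {n : ℕ}

theorem gradient_dotProduct (g : EuclideanSpace ℝ (Fin n) → ℝ) (y v : EuclideanSpace ℝ (Fin n)) :
    (gradient g y).ofLp ⬝ᵥ v.ofLp = fderiv ℝ g y v := by
  have hinner : inner ℝ (gradient g y) v = fderiv ℝ g y v := by
    rw [gradient, InnerProductSpace.toDual_symm_apply]
  rw [← hinner, EuclideanSpace.inner_eq_star_dotProduct, dotProduct_comm, star_trivial]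

theorem bilinear_eq_dotProduct_mulVec
    (B : EuclideanSpace ℝ (Fin n) →L[ℝ] EuclideanSpace ℝ (Fin n) →L[ℝ] ℝ)
    (u v : EuclideanSpace ℝ (Fin n)) :
    B u v = u.ofLp ⬝ᵥ (Matrix.of fun a b =>
      B (EuclideanSpace.single a 1) (EuclideanSpace.single b 1)).mulVec v.ofLp := by
  have hexpand (w : EuclideanSpace ℝ (Fin n)) :
      w = ∑ a, w a • EuclideanSpace.single a (1 : ℝ) := by
    simpa using ((EuclideanSpace.basisFun (Fin n) ℝ).sum_repr w).symm
  conv_lhs => rw [hexpand u, hexpand v]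
  simp only [map_sum, map_smul, sum_apply, smul_apply, smul_eq_mul, dotProduct, Matrix.mulVec,
    Matrix.of_apply, Finset.mul_sum]
  rw [Finset.sum_comm]
  exact Finset.sum_congr rfl fun a _ => Finset.sum_congr rfl fun b _ => by ring

end Coordinates

namespace SepProblem

section TotalSpace

variable (P : SepProblem)

/-- The index set of all inequality constraints, across the subproblems. -/
abbrev Idx : Type := Σ i : Fin P.N, Fin (P.nh i)

/-- The objective `∑ i, f i (x i)` on the overall decision space. -/
noncomputable def totalObj (x : P.X) : ℝ := ∑ i, P.f i (x i)

/-- The inequality constraints of all subproblems, as functions on the overall decision space. -/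
noncomputable def totalCon (s : P.Idx) (x : P.X) : ℝ := P.h s.1 (x s.1) s.2

/-- The projection of the overall decision space onto the `i`-th subproblem. -/
noncomputable def blockProj (i : Fin P.N) : P.X →L[ℝ] P.Xi i :=
  PiLp.proj 2 (fun i : Fin P.N => EuclideanSpace ℝ (Fin (P.n i))) i

@[simp]
theorem blockProj_apply (i : Fin P.N) (x : P.X) : P.blockProj i x = x i := rfl

/-- The coordinate functional `x ↦ x i a` on the overall decision space. -/
noncomputable def coord (i : Fin P.N) (a : Fin (P.n i)) : P.X →L[ℝ] ℝ :=
  (EuclideanSpace.proj a).comp (P.blockProj i)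

@[simp]
theorem coord_apply (i : Fin P.N) (a : Fin (P.n i)) (x : P.X) : P.coord i a x = x i a := rfl

theorem norm_coord_le (i : Fin P.N) (a : Fin (P.n i)) : ‖P.coord i a‖ ≤ 1 :=
  ContinuousLinearMap.opNorm_le_bound _ zero_le_one fun x => by
    rw [one_mul]
    exact (PiLp.norm_apply_le (x i) a).trans (PiLp.norm_apply_le x i)

/-- The linear map `x ↦ ∑ i, A i * x i` of the consensus constraint. -/
noncomputable def consensusMap : P.X →L[ℝ] P.Lam :=
  ∑ i, (LinearMap.toContinuousLinearMap (Matrix.toLpLin 2 2 (P.A i))).comp (P.blockProj i)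

@[simp]
theorem ofLp_consensusMap (x : P.X) :
    (P.consensusMap x).ofLp = ∑ i, (P.A i).mulVec (x i).ofLp := by
  simp [consensusMap]

/-- The functional `x ↦ (A x) c` of the `c`-th consensus constraint. -/
noncomputable def consensusRow (c : Fin P.nc) : P.X →L[ℝ] ℝ :=
  (EuclideanSpace.proj c).comp P.consensusMap

/-- The transpose of `consensusMap`, with values in the dual space: it maps `λ` to the functional
`x ↦ λᵀ A x`. -/
noncomputable def consensusDual : P.Lam →L[ℝ] P.X →L[ℝ] ℝ :=
  ∑ c, (EuclideanSpace.proj c : P.Lam →L[ℝ] ℝ).smulRight (P.consensusRow c)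

theorem consensusDual_eq_sum (l : P.Lam) : P.consensusDual l = ∑ c, l c • P.consensusRow c := by
  simp [consensusDual]

theorem consensusRow_apply (c : Fin P.nc) (x : P.X) :
    P.consensusRow c x = (∑ i, (P.A i).mulVec (x i).ofLp) c := by
  rw [← ofLp_consensusMap]
  rfl

theorem consensusDual_apply (l : P.Lam) (x : P.X) :
    P.consensusDual l x = ∑ i, l.ofLp ⬝ᵥ (P.A i).mulVec (x i).ofLp := by
  rw [← dotProduct_sum]
  simp [consensusDual_eq_sum, consensusRow_apply, dotProduct]

variable {P}

/-- The bilinear form `(u, v) ↦ ∑ i, (u i)ᵀ H i (v i)` of a block diagonal matrix. -/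
noncomputable def blockForm (H : ∀ i, Matrix (Fin (P.n i)) (Fin (P.n i)) ℝ) :
    P.X →L[ℝ] P.X →L[ℝ] ℝ :=
  ∑ i, ∑ a, ∑ b, H i a b • (P.coord i a).smulRight (P.coord i b)

theorem blockForm_apply (H : ∀ i, Matrix (Fin (P.n i)) (Fin (P.n i)) ℝ) (u v : P.X) :
    blockForm H u v = ∑ i, (u i).ofLp ⬝ᵥ (H i).mulVec (v i).ofLp := by
  simp only [blockForm, sum_apply, smul_apply, ContinuousLinearMap.smulRight_apply, coord_apply,
    smul_eq_mul, dotProduct, Matrix.mulVec, Finset.mul_sum]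
  refine Finset.sum_congr rfl fun i _ => Finset.sum_congr rfl fun a _ =>
    Finset.sum_congr rfl fun b _ => by ring

theorem norm_blockForm_sub_le {H H' : ∀ i, Matrix (Fin (P.n i)) (Fin (P.n i)) ℝ} {e : ℝ}
    (he : ∀ i a b, |H i a b - H' i a b| ≤ e) :
    ‖blockForm H - blockForm H'‖ ≤ (∑ i, (P.n i : ℝ) * P.n i) * e := by
  have hdiff : blockForm H - blockForm H'
      = ∑ i, ∑ a, ∑ b, (H i a b - H' i a b) • (P.coord i a).smulRight (P.coord i b) := by
    simp only [blockForm, ← Finset.sum_sub_distrib, sub_smul]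
  have hentry (i : Fin P.N) (a b : Fin (P.n i)) :
      ‖(H i a b - H' i a b) • (P.coord i a).smulRight (P.coord i b)‖ ≤ e := by
    have hcoord : ‖P.coord i a‖ * ‖P.coord i b‖ ≤ 1 :=
      mul_le_one₀ (P.norm_coord_le i a) (norm_nonneg _) (P.norm_coord_le i b)
    rw [norm_smul, ContinuousLinearMap.norm_smulRight_apply]
    exact (mul_le_of_le_one_right (norm_nonneg _) hcoord).trans (he i a b)
  rw [hdiff, Finset.sum_mul]
  refine norm_sum_le_of_le _ fun i _ => ?_
  calc _ ≤ ∑ _ : Fin (P.n i), ∑ _ : Fin (P.n i), e :=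
        norm_sum_le_of_le _ fun a _ => norm_sum_le_of_le _ fun b _ => hentry i a b
    _ = _ := by simp only [Finset.sum_const, Finset.card_univ, Fintype.card_fin, nsmul_eq_mul,
      mul_assoc]

/-- The inequality multipliers as one family over `Idx`. -/
def flatKap (κ : P.Kap) : P.Idx → ℝ := fun s => κ s.1 s.2

end TotalSpace

section Derivatives

variable {P : SepProblem}

theorem contDiff_con (hh : ∀ i, ContDiff ℝ 2 (P.h i)) (i : Fin P.N) (j : Fin (P.nh i)) :
    ContDiff ℝ 2 fun y => P.h i y j :=
  (EuclideanSpace.proj j : EuclideanSpace ℝ (Fin (P.nh i)) →L[ℝ] ℝ).contDiff.comp (hh i)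

theorem contDiff_totalObj (hf : ∀ i, ContDiff ℝ 2 (P.f i)) : ContDiff ℝ 2 P.totalObj :=
  ContDiff.sum fun i _ => (hf i).comp (P.blockProj i).contDiff

theorem contDiff_totalCon (hh : ∀ i, ContDiff ℝ 2 (P.h i)) (s : P.Idx) :
    ContDiff ℝ 2 (P.totalCon s) :=
  (contDiff_con hh s.1 s.2).comp (P.blockProj s.1).contDiff

theorem fderiv_separable {g : ∀ i, P.Xi i → ℝ} (hg : ∀ i, Differentiable ℝ (g i)) (x v : P.X) :
    fderiv ℝ (fun x : P.X => ∑ i, g i (x i)) x v =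
      ∑ i, (gradient (g i) (x i)).ofLp ⬝ᵥ (v i).ofLp := by
  have hderiv : HasFDerivAt (fun x : P.X => ∑ i, g i (x i))
      (∑ i, (fderiv ℝ (g i) (x i)).comp (P.blockProj i)) x :=
    HasFDerivAt.fun_sum fun i _ =>
      (hg i (x i)).hasFDerivAt.comp x (P.blockProj i).hasFDerivAt
  rw [hderiv.fderiv]
  simp [gradient_dotProduct]

theorem fderiv_totalObj (hf : ∀ i, ContDiff ℝ 2 (P.f i)) (x v : P.X) :
    fderiv ℝ P.totalObj x v = ∑ i, (gradient (P.f i) (x i)).ofLp ⬝ᵥ (v i).ofLp :=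
  fderiv_separable (fun i => (hf i).differentiable two_ne_zero) x v

theorem fderiv_totalCon (hh : ∀ i, ContDiff ℝ 2 (P.h i)) (s : P.Idx) (x v : P.X) :
    fderiv ℝ (P.totalCon s) x v = (P.gradh s.1 s.2 (x s.1)).ofLp ⬝ᵥ (v s.1).ofLp := by
  have hderiv : HasFDerivAt (P.totalCon s)
      ((fderiv ℝ (fun y => P.h s.1 y s.2) (x s.1)).comp (P.blockProj s.1)) x :=
    (hasFDerivAt_of_contDiff_two (contDiff_con hh s.1 s.2) (P.blockProj s.1 x)).comp x
      (P.blockProj s.1).hasFDerivAt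
  rw [hderiv.fderiv, gradh, gradient_dotProduct]
  rfl

theorem lagGrad_total (hf : ∀ i, ContDiff ℝ 2 (P.f i)) (hh : ∀ i, ContDiff ℝ 2 (P.h i))
    (x v : P.X) (κ : P.Kap) : lagGrad P.totalObj P.totalCon x (flatKap κ) v =
      ∑ i, ((gradient (P.f i) (x i)).ofLp
        + ∑ j, κ i j • (P.gradh i j (x i)).ofLp) ⬝ᵥ (v i).ofLp := by
  simp only [lagGrad, add_apply, sum_apply, smul_apply, smul_eq_mul, fderiv_totalObj hf,
    fderiv_totalCon hh, add_dotProduct, sum_dotProduct, smul_dotProduct, Finset.sum_add_distrib]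
  rw [Fintype.sum_sigma]
  rfl

theorem lagHess_total (hf : ∀ i, ContDiff ℝ 2 (P.f i)) (hh : ∀ i, ContDiff ℝ 2 (P.h i))
    (x : P.X) (κ : P.Kap) : lagHess P.totalObj P.totalCon x (flatKap κ) =
      blockForm fun i => P.hess i (x i) (κ i) := by
  let φ (i : Fin P.N) (w : P.Xi i) : ℝ := P.f i w + (κ i).ofLp ⬝ᵥ (P.h i w).ofLp
  have hφ (i : Fin P.N) : ContDiff ℝ 2 (φ i) :=
    (hf i).add (ContDiff.sum fun j _ => contDiff_const.mul (contDiff_con hh i j))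
  have hsum : (fun y => P.totalObj y + ∑ s, flatKap κ s * P.totalCon s y)
      = fun y => ∑ i, φ i (0 + P.blockProj i y) := by
    funext y
    simp only [Fintype.sum_sigma, totalObj, ← Finset.sum_add_distrib, zero_add]
    rfl
  have hblock (i : Fin P.N) : ContDiff ℝ 2 fun y : P.X => φ i (0 + P.blockProj i y) :=
    (hφ i).comp (contDiff_const.add (P.blockProj i).contDiff)
  rw [← fderiv_fderiv_lagrangian (contDiff_totalObj hf) (contDiff_totalCon hh), hsum,
    fderiv_fderiv_sum hblock]
  ext u v
  rw [sum_apply, sum_apply, blockForm_apply]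
  refine Finset.sum_congr rfl fun i _ => ?_
  rw [fderiv_fderiv_comp_const_add (hφ i), zero_add]
  exact bilinear_eq_dotProduct_mulVec _ _ _

end Derivatives

end SepProblem

/-! ### The problem with its consensus constraints -/

section LinearConstraints

variable {X : Type*} [NormedAddCommGroup X] [NormedSpace ℝ X] {I J : Type*} [Fintype I]
  [Fintype J]

theorem lagGrad_sumElim_linear (f : X → ℝ) (L : I → X →L[ℝ] ℝ) (h : J → X → ℝ) (x : X) (l : I → ℝ)
    (κ : J → ℝ) : lagGrad f (Sum.elim (fun c => L c) h) x (Sum.elim l κ) =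
      lagGrad f h x κ + ∑ c, l c • L c := by
  simp [lagGrad, Fintype.sum_sum_type, add_assoc, add_comm (∑ c, l c • L c)]

theorem lagHess_sumElim_linear (f : X → ℝ) (L : I → X →L[ℝ] ℝ) (h : J → X → ℝ) (x : X) (l : I → ℝ)
    (κ : J → ℝ) :
    lagHess f (Sum.elim (fun c => L c) h) x (Sum.elim l κ) = lagHess f h x κ := by
  have hlinear (c : I) : fderiv ℝ (fderiv ℝ (L c)) x = 0 := by
    rw [show fderiv ℝ (L c) = fun _ => L c from funext fun _ => (L c).fderiv, fderiv_const_apply]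
  simp [lagHess, Fintype.sum_sum_type, hlinear]

end LinearConstraints

namespace SepProblem

variable {P : SepProblem}

/-- The consensus constraints together with the inequality constraints. -/
noncomputable def jointCon (P : SepProblem) : Fin P.nc ⊕ P.Idx → P.X → ℝ :=
  Sum.elim (fun c => P.consensusRow c) P.totalCon

/-- The constraints of the coordination QP at `x`: all consensus constraints and the active
inequality constraints. -/
noncomputable def workingSet (P : SepProblem) (x : P.X) : Finset (Fin P.nc ⊕ P.Idx) :=
  Finset.univ.disjSum (activeSet P.totalCon x)

/-- All multipliers of `p`, as one family. -/
def jointMul (p : P.PD) : Fin P.nc ⊕ P.Idx → ℝ := Sum.elim (PD.lam p).ofLp (flatKap (PD.kap p))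

/-- A primal-dual vector as the pair of its primal part and all its multipliers. -/
noncomputable def pdEquiv (P : SepProblem) : P.PD ≃L[ℝ] P.X × (Fin P.nc ⊕ P.Idx → ℝ) :=
  LinearEquiv.toContinuousLinearEquiv
    { toFun := fun p => (PD.x p, jointMul p)
      map_add' := fun p q => by
        refine Prod.ext rfl (funext ?_)
        rintro (c | s) <;> rfl
      map_smul' := fun t p => by
        refine Prod.ext rfl (funext ?_)
        rintro (c | s) <;> rfl
      invFun := fun w => pd w.1 (WithLp.toLp 2 fun c => w.2 (.inl c))
        (WithLp.toLp 2 fun i => WithLp.toLp 2 fun j => w.2 (.inr ⟨i, j⟩))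
      left_inv := fun _ => rfl
      right_inv := fun w => by
        refine Prod.ext rfl (funext ?_)
        rintro (c | s) <;> rfl }

@[simp]
theorem pdEquiv_apply (p : P.PD) : P.pdEquiv p = (PD.x p, jointMul p) := rfl

/-- The inclusion `x ↦ (x, 0, 0)` of the primal space. -/
noncomputable def primalIncl (P : SepProblem) : P.X →L[ℝ] P.PD :=
  (P.pdEquiv.symm : P.X × (Fin P.nc ⊕ P.Idx → ℝ) →L[ℝ] P.PD).comp (ContinuousLinearMap.inl ℝ _ _)

theorem pd_add_primalIncl (x y : P.X) (l : P.Lam) (κ : P.Kap) :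
    pd x l κ + P.primalIncl y = pd (x + y) l κ := by
  rw [show P.primalIncl y = pd y 0 0 from rfl]
  simp [pd, ← WithLp.toLp_add]

theorem contDiff_jointCon (hh : ∀ i, ContDiff ℝ 2 (P.h i)) (j : Fin P.nc ⊕ P.Idx) :
    ContDiff ℝ 2 (P.jointCon j) := by
  rcases j with c | s
  · exact (P.consensusRow c).contDiff
  · exact contDiff_totalCon hh s

theorem lagGrad_joint (x : P.X) (p : P.PD) :
    lagGrad P.totalObj P.jointCon x (jointMul p) =
      lagGrad P.totalObj P.totalCon x (flatKap (PD.kap p)) + P.consensusDual (PD.lam p) := by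
  rw [consensusDual_eq_sum]
  exact lagGrad_sumElim_linear _ _ _ _ _ _

theorem lagHess_joint (x : P.X) (p : P.PD) :
    lagHess P.totalObj P.jointCon x (jointMul p) =
      lagHess P.totalObj P.totalCon x (flatKap (PD.kap p)) :=
  lagHess_sumElim_linear _ _ _ _ _ _

theorem lagrangian_eq (p : P.PD) : P.lagrangian p =
    P.totalObj (PD.x p) + ∑ j, jointMul p j * P.jointCon j (PD.x p) := by
  have hconsensus : ∑ c, PD.lam p c * P.consensusRow c (PD.x p)
      = ∑ i, (PD.lam p).ofLp ⬝ᵥ (P.A i).mulVec (PD.x p i).ofLp := by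
    rw [← consensusDual_apply, consensusDual_eq_sum]
    simp
  have hineq : ∑ s, flatKap (PD.kap p) s * P.totalCon s (PD.x p)
      = ∑ i, (PD.kap p i).ofLp ⬝ᵥ (P.h i (PD.x p i)).ofLp := by
    rw [Fintype.sum_sigma]
    rfl
  simp only [jointMul, jointCon, Fintype.sum_sum_type, Sum.elim_inl, Sum.elim_inr, hconsensus,
    hineq, lagrangian, totalObj, Finset.sum_add_distrib, add_assoc]

theorem contDiff_lagrangian (hf : ∀ i, ContDiff ℝ 2 (P.f i)) (hh : ∀ i, ContDiff ℝ 2 (P.h i)) :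
    ContDiff ℝ 2 P.lagrangian := by
  have hx : ContDiff ℝ 2 fun p => (P.pdEquiv p).1 := contDiff_fst.comp P.pdEquiv.contDiff
  have hmul (j : Fin P.nc ⊕ P.Idx) : ContDiff ℝ 2 fun p => (P.pdEquiv p).2 j :=
    (contDiff_apply ℝ ℝ j).comp (contDiff_snd.comp P.pdEquiv.contDiff)
  rw [funext (lagrangian_eq (P := P))]
  exact ((contDiff_totalObj hf).comp hx).add (ContDiff.sum fun j _ =>
    (hmul j).mul ((contDiff_jointCon hh j).comp hx))

theorem fderiv_fderiv_lagrangian_primalIncl (hf : ∀ i, ContDiff ℝ 2 (P.f i))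
    (hh : ∀ i, ContDiff ℝ 2 (P.h i)) (ps : P.PD) (x u v : P.X) :
    fderiv ℝ (fderiv ℝ P.lagrangian) (pd x (PD.lam ps) (PD.kap ps)) (P.primalIncl u)
      (P.primalIncl v) = lagHess P.totalObj P.jointCon x (jointMul ps) u v := by
  have hincl (y : P.X) : pd 0 (PD.lam ps) (PD.kap ps) + P.primalIncl y
      = pd y (PD.lam ps) (PD.kap ps) := by
    rw [pd_add_primalIncl, zero_add]
  have hrestrict : (fun y => P.lagrangian (pd 0 (PD.lam ps) (PD.kap ps) + P.primalIncl y))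
      = fun y => P.totalObj y + ∑ j, jointMul ps j * P.jointCon j y := funext fun y => by
    rw [hincl, lagrangian_eq]
    rfl
  rw [← hincl, ← fderiv_fderiv_comp_const_add (contDiff_lagrangian hf hh), hrestrict,
    fderiv_fderiv_lagrangian (contDiff_totalObj hf) (contDiff_jointCon hh)]

theorem isBigO_lagHess_sub (hf : ∀ i, ContDiff ℝ 2 (P.f i)) (hh : ∀ i, ContDiff ℝ 2 (P.h i))
    {ps : P.PD} {U : Set P.PD} (hU : U ∈ 𝓝 ps) {K : NNReal}
    (hK : LipschitzOnWith K (fderiv ℝ (fderiv ℝ P.lagrangian)) U) :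
    (fun x => lagHess P.totalObj P.jointCon x (jointMul ps)
      - lagHess P.totalObj P.jointCon (PD.x ps) (jointMul ps)) =O[𝓝 (PD.x ps)]
        fun x => x - PD.x ps := by
  have hpd (x : P.X) : pd x (PD.lam ps) (PD.kap ps) = ps + P.primalIncl (x - PD.x ps) := by
    rw [show ps = pd (PD.x ps) (PD.lam ps) (PD.kap ps) from rfl, pd_add_primalIncl]
    simp [pd, PD.x, PD.lam, PD.kap]
  have hnear : ∀ᶠ x in 𝓝 (PD.x ps), pd x (PD.lam ps) (PD.kap ps) ∈ U := by
    have hcont : Continuous fun x => pd x (PD.lam ps) (PD.kap ps) := by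
      simp only [hpd]
      fun_prop
    exact hcont.continuousAt.eventually_mem hU
  refine Asymptotics.IsBigO.of_bound (K * ‖P.primalIncl‖ * ‖P.primalIncl‖ * ‖P.primalIncl‖) ?_
  filter_upwards [hnear] with x hx
  have hlip := hK.norm_sub_le hx (mem_of_mem_nhds hU)
  rw [hpd, add_sub_cancel_left] at hlip
  refine ContinuousLinearMap.opNorm_le_bound₂ _ (by positivity) fun u v => ?_
  rw [sub_apply, sub_apply, ← fderiv_fderiv_lagrangian_primalIncl hf hh,
    ← fderiv_fderiv_lagrangian_primalIncl hf hh, ← sub_apply, ← sub_apply, hpd]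
  calc _ ≤ K * (‖P.primalIncl‖ * ‖x - PD.x ps‖) * (‖P.primalIncl‖ * ‖u‖)
        * (‖P.primalIncl‖ * ‖v‖) := by
        refine (ContinuousLinearMap.le_opNorm₂ _ _ _).trans ?_
        gcongr
        · exact hlip.trans (by gcongr; exact P.primalIncl.le_opNorm _)
        · exact P.primalIncl.le_opNorm u
        · exact P.primalIncl.le_opNorm v
    _ = _ := by ring

end SepProblem

/-! ### Regularity of the joint problem -/

theorem linearIndependent_of_linearIndependent_gradient {E ι : Type*} [NormedAddCommGroup E]
    [InnerProductSpace ℝ E] {g : ι → E} {D : ι → E →L[ℝ] ℝ} (hg : LinearIndependent ℝ g)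
    (hD : ∀ i v, D i v = inner ℝ (g i) v) : LinearIndependent ℝ D := by
  have hker : LinearMap.ker (innerSL ℝ (E := E)).toLinearMap = ⊥ :=
    LinearMap.ker_eq_bot'.2 fun u hu =>
      (inner_self_eq_zero (𝕜 := ℝ)).1 (DFunLike.congr_fun hu u)
  have hDg : D = (innerSL ℝ (E := E)).toLinearMap ∘ g := by
    ext i v
    exact hD i v
  rw [hDg]
  exact hg.map' _ hker

namespace SepProblem

section Cact

variable {P : SepProblem} {i : Fin P.N} {y : P.Xi i}

theorem Cact_mulVec_apply (v : Fin (P.n i) → ℝ) {j : Fin (P.nh i)} (hj : P.h i y j = 0) :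
    (P.Cact i y).mulVec v j = (P.gradh i j y).ofLp ⬝ᵥ v := by
  simp [Cact, Matrix.mulVec, hj, dotProduct]

theorem Cact_mulVec_eq_zero_iff (v : Fin (P.n i) → ℝ) :
    (P.Cact i y).mulVec v = 0 ↔ ∀ j, P.h i y j = 0 → (P.gradh i j y).ofLp ⬝ᵥ v = 0 := by
  refine ⟨fun h j hj => by rw [← Cact_mulVec_apply v hj, h, Pi.zero_apply],
    fun h => funext fun j => ?_⟩
  by_cases hj : P.h i y j = 0
  · rw [Cact_mulVec_apply v hj, h j hj, Pi.zero_apply]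
  · simp [Cact, Matrix.mulVec, hj, dotProduct]

theorem Cact_transpose_mulVec {κ : Fin (P.nh i) → ℝ} (hκ : ∀ j, P.h i y j ≠ 0 → κ j = 0) :
    (P.Cact i y).transpose.mulVec κ = ∑ j, κ j • (P.gradh i j y).ofLp := by
  funext a
  simp only [Matrix.mulVec, dotProduct, Matrix.transpose_apply, Finset.sum_apply, Pi.smul_apply,
    smul_eq_mul]
  refine Finset.sum_congr rfl fun j _ => ?_
  by_cases hj : P.h i y j = 0
  · simp [Cact, hj, mul_comm]
  · simp [hκ j hj]

end Cact

variable {P : SepProblem}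

/-- `ps` is a KKT point at which the assumptions of the convergence theorem hold, except for the
Lipschitz continuity of the derivatives of the Lagrangian. -/
structure IsRegularKKT (P : SepProblem) (ps : P.PD) : Prop where
  contDiff_obj : ∀ i, ContDiff ℝ 2 (P.f i)
  contDiff_con : ∀ i, ContDiff ℝ 2 (P.h i)
  kkt : P.IsKKT ps
  licq : P.LICQ (PD.x ps)
  scc : P.SCC ps
  sosc : P.SOSC ps

theorem inl_mem_workingSet (x : P.X) (c : Fin P.nc) : .inl c ∈ P.workingSet x :=
  Finset.inl_mem_disjSum.2 (Finset.mem_univ c)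

theorem inr_mem_workingSet {x : P.X} {s : P.Idx} : .inr s ∈ P.workingSet x ↔ P.totalCon s x = 0 :=
  Finset.inr_mem_disjSum.trans mem_activeSet

theorem LICQ.linearIndepOn (hh : ∀ i, ContDiff ℝ 2 (P.h i)) {x : P.X} (hL : P.LICQ x) :
    LinearIndepOn ℝ (fun j => fderiv ℝ (P.jointCon j) x)
      (P.workingSet x : Set (Fin P.nc ⊕ P.Idx)) := by
  let toLICQ (j : {j // j ∈ P.workingSet x}) :
      Fin P.nc ⊕ (Σ i : Fin P.N, {j : Fin (P.nh i) // P.h i (x i) j = 0}) :=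
    match j with
    | ⟨.inl c, _⟩ => .inl c
    | ⟨.inr s, hs⟩ => .inr ⟨s.1, s.2, inr_mem_workingSet.1 hs⟩
  have hinj : Function.Injective toLICQ := by
    rintro ⟨c | s, hj⟩ ⟨c' | s', hj'⟩ heq
    all_goals simp only [toLICQ, Sum.inl.injEq, Sum.inr.injEq, reduceCtorEq] at heq
    · rw [Subtype.mk.injEq, heq]
    · obtain ⟨i, j⟩ := s
      obtain ⟨i', j'⟩ := s'
      obtain ⟨rfl, hj⟩ := Sigma.mk.inj_iff.1 heq
      obtain rfl : j = j' := congrArg Subtype.val (eq_of_heq hj)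
      rfl
  refine linearIndependent_of_linearIndependent_gradient (hL.comp toLICQ hinj) ?_
  rintro ⟨c | s, hj⟩ v
  · simp only [jointCon, Sum.elim_inl, ContinuousLinearMap.fderiv, consensusRow_apply,
      Function.comp_apply, toLICQ, PiLp.inner_apply, Finset.sum_apply, Matrix.mulVec, dotProduct]
    simp [mul_comm]
  · change fderiv ℝ (P.totalCon s) x v =
      inner ℝ (WithLp.toLp 2 (Pi.single s.1 (P.gradh s.1 s.2 (x s.1))) : P.X) v
    rw [fderiv_totalCon hh, PiLp.inner_apply, Finset.sum_eq_single s.1]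
    · simp [EuclideanSpace.inner_eq_star_dotProduct, dotProduct_comm]
    · intro i _ hi
      simp [Pi.single_eq_of_ne hi]
    · simp

theorem SOSC.lagHess_pos (hf : ∀ i, ContDiff ℝ 2 (P.f i)) (hh : ∀ i, ContDiff ℝ 2 (P.h i))
    {ps : P.PD} (hS : P.SOSC ps) {v : P.X} (hv : v ≠ 0)
    (hker : ∀ s ∈ activeSet P.totalCon (PD.x ps), fderiv ℝ (P.totalCon s) (PD.x ps) v = 0) :
    0 < lagHess P.totalObj P.totalCon (PD.x ps) (flatKap (PD.kap ps)) v v := by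
  have hblock (i : Fin P.N) (hi : (v i).ofLp ≠ 0) :
      0 < (v i).ofLp ⬝ᵥ (P.hess i (PD.x ps i) (PD.kap ps i)).mulVec (v i).ofLp := by
    refine hS i _ hi ((Cact_mulVec_eq_zero_iff _).2 fun j hj => ?_)
    rw [← fderiv_totalCon hh ⟨i, j⟩]
    exact hker ⟨i, j⟩ (mem_activeSet.2 hj)
  obtain ⟨i, hi⟩ : ∃ i, (v i).ofLp ≠ 0 := by
    by_contra! hzero
    exact hv (by ext i a; exact congrFun (hzero i) a)
  rw [lagHess_total hf hh, blockForm_apply]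
  refine Finset.sum_pos' (fun i _ => ?_) ⟨i, Finset.mem_univ i, hblock i hi⟩
  by_cases hzero : (v i).ofLp = 0
  · simp [hzero]
  · exact (hblock i hzero).le

namespace IsRegularKKT

variable {ps : P.PD} (hps : P.IsRegularKKT ps)
include hps

theorem lagGrad_jointCon_eq_zero :
    lagGrad P.totalObj P.jointCon (PD.x ps) (jointMul ps) = 0 := by
  ext v
  rw [lagGrad_joint, add_apply, lagGrad_total hps.contDiff_obj hps.contDiff_con,
    consensusDual_apply, ← Finset.sum_add_distrib]
  refine Finset.sum_eq_zero fun i _ => ?_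
  rw [← Matrix.dotProduct_transpose_mulVec, dotProduct_comm _ (Matrix.mulVec _ _),
    ← add_dotProduct, add_right_comm, hps.kkt.stationary i, zero_dotProduct]

theorem jointCon_eq_zero (j : Fin P.nc ⊕ P.Idx) (hj : j ∈ P.workingSet (PD.x ps)) :
    P.jointCon j (PD.x ps) = 0 := by
  rcases j with c | s
  · exact (P.consensusRow_apply c _).trans (congrFun hps.kkt.consensus c)
  · exact inr_mem_workingSet.1 hj

theorem jointMul_eq_zero (j : Fin P.nc ⊕ P.Idx) (hj : j ∉ P.workingSet (PD.x ps)) :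
    jointMul ps j = 0 := by
  rcases j with c | s
  · exact absurd (inl_mem_workingSet _ c) hj
  · exact (mul_eq_zero.1 (hps.kkt.compl s.1 s.2)).resolve_right (mt inr_mem_workingSet.2 hj)

theorem regularPoint : RegularPoint P.totalObj P.totalCon (P.consensusDual (PD.lam ps))
    (PD.x ps) (flatKap (PD.kap ps)) where
  contDiff_obj := contDiff_totalObj hps.contDiff_obj
  contDiff_con := contDiff_totalCon hps.contDiff_con
  stationary := by rw [← lagGrad_joint, hps.lagGrad_jointCon_eq_zero]
  feasible s := hps.kkt.feasible s.1 s.2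
  pos s hs := hps.scc s.1 s.2 ((mem_activeSet (h := P.totalCon)).1 hs)
  zero s hs := hps.jointMul_eq_zero (.inr s) fun h => hs (mem_activeSet.2 (inr_mem_workingSet.1 h))
  indep := (hps.licq.linearIndepOn hps.contDiff_con).comp
    (fun s : (activeSet P.totalCon (PD.x ps) : Set P.Idx) =>
      ⟨.inr s.1, inr_mem_workingSet.2 (mem_activeSet.1 s.2)⟩)
    fun _ _ h => Subtype.ext (Sum.inr_injective (congrArg Subtype.val h))
  sosc _ hv hker := hps.sosc.lagHess_pos hps.contDiff_obj hps.contDiff_con hv hker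

theorem injective_saddleMap_joint {θ : Fin P.nc ⊕ P.Idx → ℝ} (hcons : ∀ c, 0 ≤ θ (.inl c))
    (hineq : ∀ s, θ (.inr s) = 0) : Function.Injective (saddleMap (P.workingSet (PD.x ps)) θ
      (lagHess P.totalObj P.jointCon (PD.x ps) (jointMul ps))
      fun j => fderiv ℝ (P.jointCon j) (PD.x ps)) := by
  refine saddleMap_injective ?_ (hps.licq.linearIndepOn hps.contDiff_con) fun v hv hker => ?_
  · rintro (c | s) -
    exacts [hcons c, (hineq s).ge]
  · rw [lagHess_joint]
    exact hps.sosc.lagHess_pos hps.contDiff_obj hps.contDiff_con hv fun s hs =>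
      hker (.inr s) (inr_mem_workingSet.2 (mem_activeSet.1 hs)) (hineq s)

end IsRegularKKT

end SepProblem

/-! ### The local step -/

namespace SepProblem

variable {P : SepProblem}

theorem eq_zero_of_sum_dotProduct_eq_zero {w : ∀ i, P.Xi i}
    (hw : ∀ v : P.X, ∑ i, (w i).ofLp ⬝ᵥ (v i).ofLp = 0) (i : Fin P.N) : w i = 0 := by
  have hinner : inner ℝ (WithLp.toLp 2 w : P.X) (WithLp.toLp 2 w) = 0 := by
    rw [PiLp.inner_apply, ← hw (WithLp.toLp 2 w)]
    simp only [EuclideanSpace.inner_eq_star_dotProduct, star_trivial]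
  exact congrFun (congrArg WithLp.ofLp (inner_self_eq_zero.1 hinner)) i

theorem isLocalMinOn_block {g : ∀ i, P.Xi i → ℝ} {x : P.X}
    (hmin : IsLocalMinOn (fun y : P.X => ∑ i, g i (y i)) {y | ∀ s, P.totalCon s y ≤ 0} x)
    (hx : ∀ s, P.totalCon s x ≤ 0) (i : Fin P.N) :
    IsLocalMinOn (g i) {y | ∀ j, P.h i y j ≤ 0} (x i) := by
  let replace (w : P.Xi i) : P.X := WithLp.toLp 2 (Function.update x.ofLp i w)
  have hself : replace (x i) = x := by simp [replace]
  have hcont : Continuous replace :=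
    (PiLp.continuous_toLp 2 _).comp (continuous_const.update i continuous_id)
  have htendsto : Tendsto replace (𝓝[{y | ∀ j, P.h i y j ≤ 0}] (x i))
      (𝓝[{y | ∀ s, P.totalCon s y ≤ 0}] x) := by
    refine tendsto_nhdsWithin_iff.2
      ⟨(hself ▸ hcont.tendsto (x i)).mono_left nhdsWithin_le_nhds, ?_⟩
    filter_upwards [self_mem_nhdsWithin] with w hw
    rintro ⟨k, j⟩
    rcases eq_or_ne k i with rfl | hk
    · simpa [totalCon, replace] using hw j
    · simpa [totalCon, replace, Function.update_of_ne hk] using hx ⟨k, j⟩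
  filter_upwards [htendsto.eventually hmin] with w hw
  have hother : ∑ k ∈ Finset.univ.erase i, g k (replace w k)
      = ∑ k ∈ Finset.univ.erase i, g k (x k) :=
    Finset.sum_congr rfl fun k hk => by
      simp [replace, Function.update_of_ne (Finset.ne_of_mem_erase hk)]
  rw [← Finset.add_sum_erase _ _ (Finset.mem_univ i),
    ← Finset.add_sum_erase _ (fun k => g k (replace w k)) (Finset.mem_univ i), hother,
    show replace w i = w from Function.update_self i w x.ofLp] at hw
  exact le_of_add_le_add_right hw

/-- The bilinear form of the proximal terms of all subproblems. -/
noncomputable def proxForm (Sig : ∀ i, Matrix (Fin (P.n i)) (Fin (P.n i)) ℝ) (ρ : ℝ) :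
    P.X →L[ℝ] P.X →L[ℝ] ℝ :=
  blockForm fun i => ρ • Sig i

variable {Sig : ∀ i, Matrix (Fin (P.n i)) (Fin (P.n i)) ℝ} {ρ : ℝ}

theorem blockForm_comm {H : ∀ i, Matrix (Fin (P.n i)) (Fin (P.n i)) ℝ} (hH : ∀ i, (H i).IsSymm)
    (u v : P.X) : blockForm H u v = blockForm H v u := by
  simp only [blockForm_apply]
  refine Finset.sum_congr rfl fun i _ => ?_
  rw [← Matrix.dotProduct_transpose_mulVec, (hH i).eq]

theorem proxForm_comm (hSig : ∀ i, (Sig i).PosSemidef) (u v : P.X) :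
    proxForm Sig ρ u v = proxForm Sig ρ v u :=
  blockForm_comm (fun i => .smul (by simpa using (hSig i).isHermitian) ρ) u v

theorem proxForm_nonneg (hSig : ∀ i, (Sig i).PosSemidef) (hρ : 0 ≤ ρ) (v : P.X) :
    0 ≤ proxForm Sig ρ v v := by
  rw [proxForm, blockForm_apply]
  refine Finset.sum_nonneg fun i _ => ?_
  simpa using ((hSig i).smul hρ).dotProduct_mulVec_nonneg (v i).ofLp

theorem sum_localObj (z : P.X) (l : P.Lam) (y : P.X) : ∑ i, P.localObj Sig ρ z l i (y i) =
    proxObj P.totalObj (proxForm Sig ρ) z (P.consensusDual l) y := by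
  simp only [localObj, proxObj, Finset.sum_add_distrib, consensusDual_apply, proxForm,
    blockForm_apply, totalObj, ← Finset.mul_sum, Matrix.smul_mulVec, dotProduct_smul, smul_eq_mul]
  rw [← mul_assoc, one_div_mul_eq_div]
  rfl

theorem differentiable_localObj (hf : ∀ i, ContDiff ℝ 2 (P.f i)) (z : P.X) (l : P.Lam)
    (i : Fin P.N) : Differentiable ℝ (P.localObj Sig ρ z l i) := by
  have hobj := (hf i).differentiable two_ne_zero
  unfold localObj
  simp only [dotProduct, Matrix.mulVec]
  fun_prop

theorem sum_localObj_stationary_dotProduct (hf : ∀ i, ContDiff ℝ 2 (P.f i))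
    (hh : ∀ i, ContDiff ℝ 2 (P.h i)) (hSig : ∀ i, (Sig i).PosSemidef) (z x : P.X) (l : P.Lam)
    (κ : P.Kap) (v : P.X) :
    ∑ i, (gradient (P.localObj Sig ρ z l i) (x i)
        + ∑ j, κ i j • P.gradh i j (x i)).ofLp ⬝ᵥ (v i).ofLp =
      (lagGrad P.totalObj P.totalCon x (flatKap κ) + P.consensusDual l
        + proxForm Sig ρ (x - z)) v := by
  have hlocal := fderiv_separable (differentiable_localObj (Sig := Sig) (ρ := ρ) hf z l) x v
  rw [funext (sum_localObj z l), (hasFDerivAt_proxObj (contDiff_totalObj hf)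
    (proxForm_comm hSig) x).fderiv] at hlocal
  have hlag := lagGrad_total hf hh x v κ
  have hobj := fderiv_totalObj hf x v
  simp only [WithLp.ofLp_add, WithLp.ofLp_sum, WithLp.ofLp_smul, add_dotProduct,
    Finset.sum_add_distrib, add_apply] at hlocal hlag ⊢
  linarith

theorem LocalStep.proxKKT (hf : ∀ i, ContDiff ℝ 2 (P.f i)) (hh : ∀ i, ContDiff ℝ 2 (P.h i))
    (hSig : ∀ i, (Sig i).PosSemidef) {δ : ℝ} {q p : P.PD} (hstep : P.LocalStep Sig ρ δ q p) :
    ProxKKT P.totalObj P.totalCon (proxForm Sig ρ) (PD.x q) (P.consensusDual (PD.lam q)) (PD.x p)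
      (flatKap (PD.kap p)) where
  stationary := by
    ext v
    rw [← sum_localObj_stationary_dotProduct hf hh hSig]
    exact Finset.sum_eq_zero fun i _ => by rw [hstep.stationary i]; exact zero_dotProduct _
  feasible s := hstep.feasible s.1 s.2
  nonneg s := hstep.nonneg s.1 s.2
  compl s := hstep.compl s.1 s.2

theorem localStep_of_proxKKT (hf : ∀ i, ContDiff ℝ 2 (P.f i)) (hh : ∀ i, ContDiff ℝ 2 (P.h i))
    (hSig : ∀ i, (Sig i).PosSemidef) {δ : ℝ} {q p : P.PD} (hlam : PD.lam p = PD.lam q)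
    (hnear : dist (PD.x p) (PD.x q) < δ)
    (hprox : ProxKKT P.totalObj P.totalCon (proxForm Sig ρ) (PD.x q) (P.consensusDual (PD.lam q))
      (PD.x p) (flatKap (PD.kap p)))
    (hmin : IsLocalMinOn (proxObj P.totalObj (proxForm Sig ρ) (PD.x q)
      (P.consensusDual (PD.lam q))) {y | ∀ s, P.totalCon s y ≤ 0} (PD.x p)) :
    P.LocalStep Sig ρ δ q p where
  lam_eq := hlam
  near i := by
    rw [dist_eq_norm] at hnear ⊢
    exact (PiLp.norm_apply_le (PD.x p - PD.x q) i).trans_lt hnear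
  feasible i j := hprox.feasible ⟨i, j⟩
  localMin i := by
    rw [← funext (sum_localObj (PD.x q) (PD.lam q))] at hmin
    exact isLocalMinOn_block hmin hprox.feasible i
  stationary := eq_zero_of_sum_dotProduct_eq_zero fun v => by
    rw [sum_localObj_stationary_dotProduct hf hh hSig, hprox.stationary, zero_apply]
  nonneg i j := hprox.nonneg ⟨i, j⟩
  compl i j := hprox.compl ⟨i, j⟩

end SepProblem

/-! ### Solvability of the coordination step -/

namespace SepProblem

section NullBasis

variable {a b d : ℕ} {C : Matrix (Fin a) (Fin b) ℝ} {Z : Matrix (Fin b) (Fin d) ℝ}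

theorem exists_isNullBasis (C : Matrix (Fin a) (Fin b) ℝ) :
    ∃ (d : ℕ) (Z : Matrix (Fin b) (Fin d) ℝ), IsNullBasis C Z := by
  let B := Module.finBasis ℝ (LinearMap.ker C.mulVecLin)
  refine ⟨_, Matrix.of fun r c => (B c : Fin b → ℝ) r, ?_, ?_⟩
  · exact B.linearIndependent.map' (LinearMap.ker C.mulVecLin).subtype (Submodule.ker_subtype _)
  · rw [show (Matrix.of fun r c => (B c : Fin b → ℝ) r).col
        = (LinearMap.ker C.mulVecLin).subtype ∘ B from rfl,
      Set.range_comp, Submodule.span_image, B.span_eq, Submodule.map_top, Submodule.range_subtype]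

theorem IsNullBasis.mul_eq_zero (hZ : IsNullBasis C Z) : C * Z = 0 := by
  ext r c
  have hcol : Z.col c ∈ LinearMap.ker C.mulVecLin := hZ.2 ▸ Submodule.subset_span ⟨c, rfl⟩
  exact congrFun (LinearMap.mem_ker.1 hcol) r

theorem IsNullBasis.exists_mulVec_eq (hZ : IsNullBasis C Z) {u : Fin b → ℝ}
    (hu : C.mulVec u = 0) : ∃ t, Z.mulVec t = u := by
  have hspan : u ∈ Submodule.span ℝ (Set.range Z.col) := hZ.2 ▸ LinearMap.mem_ker.2 hu
  rwa [← Matrix.range_mulVecLin] at hspan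

theorem exists_transpose_mulVec_eq {w : Fin b → ℝ} (hw : ∀ u, C.mulVec u = 0 → w ⬝ᵥ u = 0) :
    ∃ k, C.transpose.mulVec k = w := by
  have hspan : dotProductBilin ℝ ℝ w ∈
      Submodule.span ℝ (Set.range fun j => dotProductBilin ℝ ℝ (C j)) := by
    refine mem_span_of_iInf_ker_le_ker fun u hu => ?_
    rw [Submodule.mem_iInf] at hu
    exact hw u (funext fun j => hu j)
  obtain ⟨k, hk⟩ := (Submodule.mem_span_range_iff_exists_fun ℝ).1 hspan
  refine ⟨k, funext fun c => ?_⟩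
  have hentry := LinearMap.congr_fun hk (Pi.single c 1)
  simp only [LinearMap.sum_apply, LinearMap.smul_apply, dotProductBilin_apply_apply,
    dotProduct_single, mul_one, smul_eq_mul] at hentry
  simp [← hentry, Matrix.mulVec, dotProduct, mul_comm]

end NullBasis

variable {P : SepProblem} {p : P.PD} {H : ∀ i, Matrix (Fin (P.n i)) (Fin (P.n i)) ℝ}
  {d : Fin P.N → ℕ} {Z : ∀ i, Matrix (Fin (P.n i)) (Fin (d i)) ℝ} {μ : ℝ}

theorem posDef_Hbar {i : Fin P.N} (hZ : IsNullBasis (P.Cact i (PD.x p i)) (Z i))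
    (hsymm : (H i).IsSymm) (hpos : ∀ v : Fin (P.n i) → ℝ, v ≠ 0 →
      (P.Cact i (PD.x p i)).mulVec v = 0 → 0 < v ⬝ᵥ (H i).mulVec v) : (P.Hbar Z H i).PosDef := by
  refine .of_dotProduct_mulVec_pos ?_ fun t ht => ?_
  · have hherm : (H i).IsHermitian := by simpa using hsymm
    simpa [Hbar] using Matrix.isHermitian_conjTranspose_mul_mul (Z i) hherm
  · rw [Hbar, ← Matrix.mulVec_mulVec, ← Matrix.mulVec_mulVec, star_trivial,
      Matrix.dotProduct_transpose_mulVec, dotProduct_comm]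
    refine hpos _ (fun hzero => ht ?_) ?_
    · exact Matrix.mulVec_injective_iff.2 hZ.1 (hzero.trans (Matrix.mulVec_zero _).symm)
    · rw [Matrix.mulVec_mulVec, hZ.mul_eq_zero, Matrix.zero_mulVec]

theorem exists_condensedResidual_eq_zero (hμ : 0 < μ) (hpos : ∀ i, (P.Hbar Z H i).PosDef) :
    ∃ l, P.condensedResidual Z H μ p l = 0 := by
  have hschur (i : Fin P.N) : (P.schur Z H i).PosSemidef := by
    simpa [schur] using (hpos i).inv.posSemidef.mul_mul_conjTranspose_same (P.Abar Z i)
  have hcondensed :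
      (μ⁻¹ • (1 : Matrix (Fin P.nc) (Fin P.nc) ℝ) + ∑ i, P.schur Z H i).PosDef :=
    (Matrix.PosDef.one.smul (inv_pos.2 hμ)).add_posSemidef
      (Matrix.posSemidef_sum _ fun i _ => hschur i)
  obtain ⟨l, hl⟩ := (Matrix.mulVec_surjective_iff_isUnit.2 hcondensed.isUnit)
    (μ⁻¹ • (PD.lam p).ofLp + ∑ i, P.svec Z H (PD.x p) i)
  refine ⟨WithLp.toLp 2 l, ?_⟩
  rw [condensedResidual, hl, sub_sub, sub_self, WithLp.toLp_zero]

theorem exists_qpMultiplier {i : Fin P.N} (hZ : IsNullBasis (P.Cact i (PD.x p i)) (Z i))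
    (hpos : (P.Hbar Z H i).PosDef) (l : P.Lam) :
    ∃ κ : Fin (P.nh i) → ℝ, (∀ j, P.h i (PD.x p i) j ≠ 0 → κ j = 0) ∧
      (H i).mulVec (P.backSub Z H (PD.x p) l i) + (gradient (P.f i) (PD.x p i)).ofLp
        + (P.A i).transpose.mulVec l.ofLp + (P.Cact i (PD.x p i)).transpose.mulVec κ = 0 := by
  classical
  have hreduced : (Z i).transpose.mulVec ((H i).mulVec (P.backSub Z H (PD.x p) l i))
      = -(P.Abar Z i).transpose.mulVec l.ofLp - P.gbar Z (PD.x p) i := by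
    have hdet : IsUnit (P.Hbar Z H i).det := (Matrix.isUnit_iff_isUnit_det _).1 hpos.isUnit
    rw [backSub, Matrix.mulVec_mulVec, Matrix.mulVec_mulVec,
      show (Z i).transpose * H i * Z i = P.Hbar Z H i from rfl, Matrix.mulVec_mulVec,
      Matrix.mul_nonsing_inv _ hdet, Matrix.one_mulVec]
  obtain ⟨k, hk⟩ : ∃ k, (P.Cact i (PD.x p i)).transpose.mulVec k
      = -((H i).mulVec (P.backSub Z H (PD.x p) l i) + (gradient (P.f i) (PD.x p i)).ofLp
        + (P.A i).transpose.mulVec l.ofLp) := by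
    refine exists_transpose_mulVec_eq fun u hu => ?_
    obtain ⟨t, rfl⟩ := hZ.exists_mulVec_eq hu
    rw [dotProduct_comm, dotProduct_comm, ← Matrix.dotProduct_transpose_mulVec, Matrix.mulVec_neg,
      Matrix.mulVec_add, Matrix.mulVec_add, hreduced, gbar, sub_add_cancel, Abar,
      Matrix.transpose_mul, ← Matrix.mulVec_mulVec, neg_add_cancel, neg_zero, dotProduct_zero]
  refine ⟨fun j => if P.h i (PD.x p i) j = 0 then k j else 0, fun j hj => if_neg hj, ?_⟩
  have hrestrict : (P.Cact i (PD.x p i)).transpose.mulVec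
      (fun j => if P.h i (PD.x p i) j = 0 then k j else 0)
      = (P.Cact i (PD.x p i)).transpose.mulVec k := by
    funext a
    simp only [Matrix.mulVec, dotProduct]
    refine Finset.sum_congr rfl fun j _ => ?_
    by_cases hj : P.h i (PD.x p i) j = 0 <;> simp [Cact, hj]
  rw [hrestrict, hk, add_neg_cancel]

theorem exists_coordStep (hμ : 0 < μ) (hsymm : ∀ i, (H i).IsSymm)
    (hpos : ∀ i, ∀ v : Fin (P.n i) → ℝ, v ≠ 0 → (P.Cact i (PD.x p i)).mulVec v = 0 →
      0 < v ⬝ᵥ (H i).mulVec v) : ∃ q' : P.PD, P.CoordStep μ 0 H p q' := by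
  choose d Z hZ using fun i => exists_isNullBasis (P.Cact i (PD.x p i))
  have hHbar (i : Fin P.N) : (P.Hbar Z H i).PosDef := posDef_Hbar (hZ i) (hsymm i) (hpos i)
  obtain ⟨l, hl⟩ := exists_condensedResidual_eq_zero (p := p) hμ hHbar
  choose κ hinactive hstat using fun i => exists_qpMultiplier (hZ i) (hHbar i) l
  let z : P.X := WithLp.toLp 2 fun i =>
    WithLp.toLp 2 ((PD.x p i).ofLp + P.backSub Z H (PD.x p) l i)
  refine ⟨pd z l (WithLp.toLp 2 fun i => WithLp.toLp 2 (κ i)), d, Z,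
    ⟨hZ, fun _ => rfl, fun i => ?_, hinactive⟩, ?_⟩
  · have hz : (z i - PD.x p i).ofLp = P.backSub Z H (PD.x p) l i := add_sub_cancel_left _ _
    rw [← hstat i, ← hz]
    rfl
  · rw [zero_mul]
    exact (norm_eq_zero.2 hl).le

end SepProblem

/-! ### The coordination step -/

namespace SepProblem

variable {P : SepProblem} {p q' : P.PD}

theorem norm_lam_le (p : P.PD) : ‖PD.lam p‖ ≤ ‖p‖ :=
  (WithLp.norm_fst_le _ p.snd).trans (WithLp.norm_snd_le _ p)

theorem norm_le_norm_fst_add_norm_snd {E F : Type*} [SeminormedAddCommGroup E]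
    [SeminormedAddCommGroup F] (w : WithLp 2 (E × F)) : ‖w‖ ≤ ‖w.fst‖ + ‖w.snd‖ := by
  refine (pow_le_pow_iff_left₀ (norm_nonneg _) (by positivity) two_ne_zero).1 ?_
  rw [WithLp.prod_norm_sq_eq_of_L2]
  nlinarith [norm_nonneg w.fst, norm_nonneg w.snd]

section SQPStep

variable {H : ∀ i, Matrix (Fin (P.n i)) (Fin (P.n i)) ℝ} {d : Fin P.N → ℕ}
  {Z : ∀ i, Matrix (Fin (P.n i)) (Fin (d i)) ℝ}

theorem Update.blockForm_add_lagGrad_eq_zero (hf : ∀ i, ContDiff ℝ 2 (P.f i))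
    (hh : ∀ i, ContDiff ℝ 2 (P.h i)) (hsymm : ∀ i, (H i).IsSymm) (hu : P.Update Z H p q') :
    blockForm H (PD.x q' - PD.x p) + lagGrad P.totalObj P.jointCon (PD.x p) (jointMul q') = 0 := by
  ext v
  rw [lagGrad_joint, add_apply, add_apply, blockForm_comm hsymm, blockForm_apply,
    lagGrad_total hf hh, consensusDual_apply, ← Finset.sum_add_distrib, ← Finset.sum_add_distrib]
  refine Finset.sum_eq_zero fun i _ => ?_
  rw [dotProduct_comm, ← Matrix.dotProduct_transpose_mulVec,
    dotProduct_comm (v i).ofLp (Matrix.mulVec _ _), ← add_dotProduct, ← add_dotProduct,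
    ← Cact_transpose_mulVec (hu.inactive i)]
  have hstat := hu.stationary i
  rw [add_right_comm] at hstat
  rw [← add_assoc, ← add_assoc, PiLp.sub_apply, hstat, zero_dotProduct]

theorem Update.fderiv_totalCon_eq_zero (hh : ∀ i, ContDiff ℝ 2 (P.h i)) (hu : P.Update Z H p q')
    {s : P.Idx} (hs : P.totalCon s (PD.x p) = 0) :
    fderiv ℝ (P.totalCon s) (PD.x p) (PD.x q' - PD.x p) = 0 := by
  have hdiff : (PD.x q' s.1 - PD.x p s.1).ofLp = P.backSub Z H (PD.x p) (PD.lam q') s.1 := by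
    rw [WithLp.ofLp_sub, hu.primal, add_sub_cancel_left]
  rw [fderiv_totalCon hh, PiLp.sub_apply, hdiff]
  refine (Cact_mulVec_eq_zero_iff _).1 ?_ s.2 hs
  rw [backSub, Matrix.mulVec_mulVec, (hu.basis s.1).mul_eq_zero, Matrix.zero_mulVec]

theorem lam_kktResidual (μ : ℝ) : PD.lam (P.kktResidual μ H p q') =
    P.consensusMap (PD.x p) + P.consensusMap (PD.x q' - PD.x p)
      - μ⁻¹ • (PD.lam q' - PD.lam p) := by
  apply WithLp.ofLp_injective 2
  simp only [WithLp.ofLp_sub, WithLp.ofLp_add, WithLp.ofLp_smul, ofLp_consensusMap]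
  rw [add_comm, add_sub_right_comm, ← sub_neg_eq_add]
  rfl

theorem Update.sqpStep (hf : ∀ i, ContDiff ℝ 2 (P.f i)) (hh : ∀ i, ContDiff ℝ 2 (P.h i))
    (hsymm : ∀ i, (H i).IsSymm) (hu : P.Update Z H p q') (μ : ℝ) :
    SQPStep (P.workingSet (PD.x p)) P.totalObj P.jointCon (Sum.elim (fun _ => μ⁻¹) 0)
      (blockForm H) (PD.x p) (jointMul p)
      (Sum.elim (PD.lam (P.kktResidual μ H p q')).ofLp 0) (PD.x q') (jointMul q') where
  stationary := hu.blockForm_add_lagGrad_eq_zero hf hh hsymm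
  linearized := by
    rintro (c | s) hj
    · simp [lam_kktResidual, jointCon, jointMul, consensusRow]
    · have hs := inr_mem_workingSet.1 hj
      simp [jointCon, hs, hu.fderiv_totalCon_eq_zero hh hs]
  dropped := by
    rintro (c | s) hj
    · exact absurd (inl_mem_workingSet _ c) hj
    · exact hu.inactive s.1 s.2 (mt inr_mem_workingSet.2 hj)

theorem norm_sumElim_lam_kktResidual_le (μ : ℝ) (hu : P.Update Z H p q') :
    ‖(Sum.elim (PD.lam (P.kktResidual μ H p q')).ofLp 0 : Fin P.nc ⊕ P.Idx → ℝ)‖ ≤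
      ‖P.condensedResidual Z H μ p (PD.lam q')‖ := by
  rw [← P.norm_kktResidual μ hu]
  refine le_trans ?_ (norm_lam_le _)
  refine (pi_norm_le_iff_of_nonneg (norm_nonneg _)).2 ?_
  rintro (c | s)
  · exact PiLp.norm_apply_le _ c
  · simp

end SQPStep

section Mvec

theorem norm_x_mvec (hf : ∀ i, ContDiff ℝ 2 (P.f i)) (hh : ∀ i, ContDiff ℝ 2 (P.h i))
    (hκ : ∀ s, P.totalCon s (PD.x p) ≠ 0 → flatKap (PD.kap p) s = 0) :
    ‖PD.x (P.mvec p)‖ = ‖lagGrad P.totalObj P.jointCon (PD.x p) (jointMul p)‖ := by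
  have hinactive (i : Fin P.N) (j : Fin (P.nh i)) (hj : P.h i (PD.x p i) j ≠ 0) :
      (PD.kap p i).ofLp j = 0 := hκ ⟨i, j⟩ hj
  have hdual : innerSL ℝ (PD.x (P.mvec p))
      = -lagGrad P.totalObj P.jointCon (PD.x p) (jointMul p) := by
    ext v
    rw [neg_apply, lagGrad_joint, add_apply, lagGrad_total hf hh, consensusDual_apply,
      ← Finset.sum_add_distrib, ← Finset.sum_neg_distrib, innerSL_apply_apply, PiLp.inner_apply]
    refine Finset.sum_congr rfl fun i _ => ?_
    rw [EuclideanSpace.inner_eq_star_dotProduct, star_trivial, dotProduct_comm,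
      ← Matrix.dotProduct_transpose_mulVec, dotProduct_comm (v i).ofLp (Matrix.mulVec _ _),
      ← add_dotProduct, ← neg_dotProduct,
      ← Cact_transpose_mulVec (hinactive i), neg_add, neg_add, ← sub_eq_add_neg, ← sub_eq_add_neg]
    rfl
  rw [← norm_neg (lagGrad _ _ _ _), ← hdual, innerSL_apply_norm]

theorem norm_mvec_le (hf : ∀ i, ContDiff ℝ 2 (P.f i)) (hh : ∀ i, ContDiff ℝ 2 (P.h i))
    (hκ : ∀ s, P.totalCon s (PD.x p) ≠ 0 → flatKap (PD.kap p) s = 0) :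
    ‖P.mvec p‖ ≤ ‖lagGrad P.totalObj P.jointCon (PD.x p) (jointMul p)‖
      + ‖P.consensusMap (PD.x p)‖ := by
  have hlam : ‖PD.lam (P.mvec p)‖ = ‖P.consensusMap (PD.x p)‖ := by
    rw [← norm_neg (P.consensusMap _)]
    congr 1
    apply WithLp.ofLp_injective 2
    rw [WithLp.ofLp_neg, ofLp_consensusMap]
    rfl
  have hkap : ‖PD.kap (P.mvec p)‖ = 0 := norm_zero
  rw [← norm_x_mvec hf hh hκ, ← hlam, ← add_zero ‖PD.lam (P.mvec p)‖, ← hkap]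
  exact (norm_le_norm_fst_add_norm_snd _).trans
    (add_le_add_right (norm_le_norm_fst_add_norm_snd _) _)

end Mvec

theorem isBigO_pdEquiv_sub (ps : P.PD) :
    (fun p => P.pdEquiv p - P.pdEquiv ps) =O[𝓝 ps] fun p => p - ps :=
  P.pdEquiv.hasFDerivAt.isBigO_sub

theorem IsRegularKKT.exists_norm_mvec_le {ps : P.PD} (hps : P.IsRegularKKT ps) :
    ∃ C > 0, ∀ᶠ p in 𝓝 ps, (∀ s, P.totalCon s (PD.x p) ≠ 0 → flatKap (PD.kap p) s = 0) →
      ‖P.mvec p‖ ≤ C * ‖p - ps‖ := by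
  have hgrad : (fun p => lagGrad P.totalObj P.jointCon (PD.x p) (jointMul p)) =O[𝓝 ps]
      fun p => p - ps := by
    simpa [Function.comp_def, hps.lagGrad_jointCon_eq_zero] using
      ((isBigO_lagGrad_sub (contDiff_totalObj hps.contDiff_obj)
        (contDiff_jointCon hps.contDiff_con) (PD.x ps) (jointMul ps)).comp_tendsto
          P.pdEquiv.continuous.continuousAt).trans (isBigO_pdEquiv_sub ps)
  have hcons : (fun p => P.consensusMap (PD.x p)) =O[𝓝 ps] fun p => p - ps := by
    have hzero : P.consensusMap ps.fst = 0 :=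
      WithLp.ofLp_injective 2 ((ofLp_consensusMap P _).trans hps.kkt.consensus)
    simpa [hzero, PD.x] using (P.consensusMap.comp
      (WithLp.fstL 2 ℝ P.X (WithLp 2 (P.Lam × P.Kap)))).hasFDerivAt.isBigO_sub (x₀ := ps)
  obtain ⟨C, hC, hbound⟩ := (hgrad.norm_left.add hcons.norm_left).exists_pos
  refine ⟨C, hC, ?_⟩
  filter_upwards [hbound.bound] with p hp hκ
  exact (norm_mvec_le hps.contDiff_obj hps.contDiff_con hκ).trans ((le_abs_self _).trans hp)

end SepProblem

/-! ### Error bounds of the two steps -/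

theorem eventually_forall_norm_sub_le {W E : Type*} [SeminormedAddCommGroup E] {l : Filter W}
    {r : W → ℝ} (hr : Tendsto r l (𝓝 0)) {b : E} {Φ : E → Prop} (hΦ : ∀ᶠ y in 𝓝 b, Φ y) :
    ∀ᶠ w in l, ∀ y, ‖y - b‖ ≤ r w → Φ y := by
  obtain ⟨R, hR, hball⟩ := Metric.eventually_nhds_iff_ball.1 hΦ
  filter_upwards [hr.eventually_lt_const hR] with w hw y hy
  exact hball y (mem_ball_iff_norm.2 (hy.trans_lt hw))

namespace SepProblem

variable {P : SepProblem} {ps : P.PD}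

theorem exists_forall_dist_lt_imp_dist_lt {r : ℝ} (hr : 0 < r) :
    ∃ δ > 0, ∀ x y : P.X, (∀ i, dist (x i) (y i) < δ) → dist x y < r := by
  obtain ⟨δ, hδ, hunif⟩ := Metric.uniformContinuous_iff.1
    (PiLp.uniformContinuous_toLp 2 fun i => P.Xi i) r hr
  exact ⟨δ, hδ, fun x y hxy => hunif ((dist_pi_lt_iff hδ).2 hxy)⟩

theorem continuous_x : Continuous fun p : P.PD => PD.x p :=
  (WithLp.fstL 2 ℝ P.X (WithLp 2 (P.Lam × P.Kap))).continuous

theorem exists_norm_sub_le_mul_norm_primal_jointMul_sub (P : SepProblem) : ∃ C > 0, ∀ p q : P.PD,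
    ‖p - q‖ ≤ C * ‖(PD.x p, jointMul p) - (PD.x q, jointMul q)‖ := by
  simp only [← pdEquiv_apply]
  obtain ⟨C, hC, hbound⟩ := P.pdEquiv.symm.toContinuousLinearMap.bound
  refine ⟨C, hC, fun p q => ?_⟩
  simpa [-pdEquiv_apply] using hbound (P.pdEquiv p - P.pdEquiv q)

theorem norm_primal_jointMul_sub_le (p q : P.PD) :
    ‖(PD.x p, jointMul p) - (PD.x q, jointMul q)‖ ≤ ‖PD.lam p - PD.lam q‖
      + ‖(PD.x p, flatKap (PD.kap p)) - (PD.x q, flatKap (PD.kap q))‖ := by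
  have hsnd := norm_snd_le ((PD.x p, flatKap (PD.kap p)) - (PD.x q, flatKap (PD.kap q)))
  refine norm_prod_le_iff.2 ⟨(norm_fst_le ((PD.x p, flatKap (PD.kap p))
    - (PD.x q, flatKap (PD.kap q)))).trans (le_add_of_nonneg_left (norm_nonneg _)),
    (pi_norm_le_iff_of_nonneg (by positivity)).2 ?_⟩
  rintro (c | s)
  · exact (PiLp.norm_apply_le (PD.lam p - PD.lam q) c).trans
      (le_add_of_nonneg_right (norm_nonneg _))
  · exact ((norm_le_pi_norm _ s).trans hsnd).trans (le_add_of_nonneg_left (norm_nonneg _))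

/-- The data `(z, Aᵀ λ)` on which the local step at `(z, λ, κ)` depends. -/
noncomputable def proxData (P : SepProblem) : P.PD →L[ℝ] P.X × (P.X →L[ℝ] ℝ) :=
  (WithLp.fstL 2 ℝ P.X (WithLp 2 (P.Lam × P.Kap))).prod
    (P.consensusDual.comp ((WithLp.fstL 2 ℝ P.Lam P.Kap).comp
      (WithLp.sndL 2 ℝ P.X (WithLp 2 (P.Lam × P.Kap)))))

theorem proxData_apply (p : P.PD) : P.proxData p = (PD.x p, P.consensusDual (PD.lam p)) := rfl

namespace IsRegularKKT

variable (hps : P.IsRegularKKT ps)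
include hps

section LocalStep

variable {Sig : ∀ i, Matrix (Fin (P.n i)) (Fin (P.n i)) ℝ} {ρ : ℝ}
  (hSig : ∀ i, (Sig i).PosSemidef) (hρ : 0 ≤ ρ)
include hSig hρ

theorem exists_localStep_bound : ∃ δ > 0, ∃ χ > 0, ∀ᶠ q in 𝓝 ps, ∀ p, P.LocalStep Sig ρ δ q p →
    P.workingSet (PD.x p) = P.workingSet (PD.x ps) ∧ ‖p - ps‖ ≤ χ * ‖q - ps‖ := by
  obtain ⟨χ, hχ, hbound⟩ := hps.regularPoint.exists_proxKKT_bound (proxForm_nonneg hSig hρ)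
  obtain ⟨r, hr, hball⟩ := Metric.eventually_nhds_iff_ball.1 hbound
  obtain ⟨δ, hδ, hblocks⟩ := P.exists_forall_dist_lt_imp_dist_lt (half_pos hr)
  obtain ⟨C, hC, hnorm_le⟩ := P.exists_norm_sub_le_mul_norm_primal_jointMul_sub
  refine ⟨δ, hδ, C * (1 + χ * ‖P.proxData‖), by positivity, ?_⟩
  filter_upwards [P.proxData.continuous.continuousAt (Metric.ball_mem_nhds _ hr),
    continuous_x.continuousAt (Metric.ball_mem_nhds _ (half_pos hr))] with q hq hxq p hstep
  have hxp : dist (PD.x p) (PD.x ps) < r := by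
    linarith [dist_triangle (PD.x p) (PD.x q) (PD.x ps), hblocks _ _ hstep.near,
      Metric.mem_ball.1 hxq]
  obtain ⟨hactive, hnorm⟩ := hball ((PD.x q, P.consensusDual (PD.lam q)), PD.x p)
    (by rw [← ball_prod_same]; exact ⟨hq, hxp⟩) _
    (hstep.proxKKT hps.contDiff_obj hps.contDiff_con hSig)
  rw [Prod.fst, ← proxData_apply, ← proxData_apply, ← map_sub] at hnorm
  refine ⟨by rw [workingSet, hactive, workingSet], ?_⟩
  have hprox : ‖(PD.x p, flatKap (PD.kap p)) - (PD.x ps, flatKap (PD.kap ps))‖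
      ≤ χ * ‖P.proxData‖ * ‖q - ps‖ := by
    rw [mul_assoc]
    exact hnorm.trans (by gcongr; exact P.proxData.le_opNorm _)
  have hlam : ‖PD.lam p - PD.lam ps‖ ≤ ‖q - ps‖ := by
    rw [hstep.lam_eq]
    exact norm_lam_le (q - ps)
  calc ‖p - ps‖ ≤ C * (‖q - ps‖ + χ * ‖P.proxData‖ * ‖q - ps‖) :=
        (hnorm_le p ps).trans (by
          gcongr
          exact (norm_primal_jointMul_sub_le p ps).trans (add_le_add hlam hprox))
    _ = C * (1 + χ * ‖P.proxData‖) * ‖q - ps‖ := by ring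

end LocalStep

end IsRegularKKT

theorem HessApprox.norm_blockForm_sub_lagHess_le (hf : ∀ i, ContDiff ℝ 2 (P.f i))
    (hh : ∀ i, ContDiff ℝ 2 (P.h i)) {e : ℝ} {H : ∀ i, Matrix (Fin (P.n i)) (Fin (P.n i)) ℝ}
    {p : P.PD} (hH : P.HessApprox e H p) (Q : P.X →L[ℝ] P.X →L[ℝ] ℝ) :
    ‖blockForm H - Q‖ ≤ (∑ i, (P.n i : ℝ) * P.n i) * e
      + ‖lagHess P.totalObj P.jointCon (PD.x p) (jointMul p) - Q‖ := by
  have hblock : ‖blockForm H - lagHess P.totalObj P.jointCon (PD.x p) (jointMul p)‖ ≤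
      (∑ i, (P.n i : ℝ) * P.n i) * e := by
    rw [lagHess_joint, lagHess_total hf hh]
    exact norm_blockForm_sub_le fun i => (hH i).2
  exact (norm_sub_le_norm_sub_add_norm_sub _ _ _).trans (add_le_add_left hblock _)

theorem continuous_lagHess_joint (hf : ∀ i, ContDiff ℝ 2 (P.f i))
    (hh : ∀ i, ContDiff ℝ 2 (P.h i)) :
    Continuous fun p : P.PD => lagHess P.totalObj P.jointCon (PD.x p) (jointMul p) :=
  (continuous_lagHess (contDiff_totalObj hf) (contDiff_jointCon hh)).comp P.pdEquiv.continuous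

theorem dotProduct_mulVec_pos_of_blockForm_pos (hh : ∀ i, ContDiff ℝ 2 (P.h i)) {x : P.X}
    {H : ∀ i, Matrix (Fin (P.n i)) (Fin (P.n i)) ℝ}
    (hpos : ∀ u, u ≠ 0 → (∀ s ∈ activeSet P.totalCon x, fderiv ℝ (P.totalCon s) x u = 0) →
      0 < blockForm H u u)
    {i : Fin P.N} {v : Fin (P.n i) → ℝ} (hv : v ≠ 0) (hker : (P.Cact i (x i)).mulVec v = 0) :
    0 < v ⬝ᵥ (H i).mulVec v := by
  let u : P.X := WithLp.toLp 2 (Pi.single i (WithLp.toLp 2 v))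
  have hself : (u i).ofLp = v := by simp [u]
  have hother (k : Fin P.N) (hk : k ≠ i) : (u k).ofLp = 0 := by simp [u, Pi.single_eq_of_ne hk]
  have hu : u ≠ 0 := fun h => hv (by rw [← hself, h]; rfl)
  have hform : blockForm H u u = v ⬝ᵥ (H i).mulVec v := by
    rw [blockForm_apply, Finset.sum_eq_single i (fun k _ hk => by rw [hother k hk,
      zero_dotProduct]) (by simp), hself]
  rw [← hform]
  refine hpos u hu fun ⟨k, j⟩ hj => ?_
  rw [fderiv_totalCon hh]
  rcases eq_or_ne k i with rfl | hk
  · rw [hself]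
    exact (Cact_mulVec_eq_zero_iff v).1 hker j ((mem_activeSet (h := P.totalCon)).1 hj)
  · rw [hother k hk, dotProduct_zero]

namespace IsRegularKKT

variable (hps : P.IsRegularKKT ps)
include hps

theorem eventually_exists_coordStep : ∀ᶠ w : P.PD × ℝ in 𝓝 (ps, 0), ∀ H,
    P.HessApprox w.2 H w.1 → P.workingSet (PD.x w.1) = P.workingSet (PD.x ps) →
      ∀ μ > 0, ∃ q', P.CoordStep μ 0 H w.1 q' := by
  have hf := hps.contDiff_obj
  have hh := hps.contDiff_con
  let D (x : P.X) (s : P.Idx) : P.X →L[ℝ] ℝ := fderiv ℝ (P.totalCon s) x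
  let L (p : P.PD) := lagHess P.totalObj P.jointCon (PD.x p) (jointMul p)
  have hpos : ∀ v, v ≠ 0 → (∀ s ∈ activeSet P.totalCon (PD.x ps), D (PD.x ps) s v = 0) →
      0 < L ps v v := fun v hv hker => by
    simpa only [L, lagHess_joint] using hps.sosc.lagHess_pos hf hh hv hker
  have herr : Tendsto (fun w : P.PD × ℝ => ‖D (PD.x w.1) - D (PD.x ps)‖
      + ((∑ i, (P.n i : ℝ) * P.n i) * w.2 + ‖L w.1 - L ps‖)) (𝓝 (ps, 0)) (𝓝 0) := by
    have hD : Continuous D := hps.regularPoint.continuous_fderiv_con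
    have hL : Continuous L := continuous_lagHess_joint hf hh
    have hx : Continuous fun p : P.PD => PD.x p := continuous_x
    exact Continuous.tendsto' (by fun_prop) _ _ (by simp)
  filter_upwards [eventually_forall_norm_sub_le herr
    (eventually_pos_on_null_space _ (D (PD.x ps)) (L ps) hpos)] with w hw H hH hset μ hμ
  refine exists_coordStep hμ (fun i => (hH i).1) fun i v hv hker =>
    dotProduct_mulVec_pos_of_blockForm_pos hh (fun u hu hu' => ?_) hv hker
  have hactive : activeSet P.totalCon (PD.x w.1) = activeSet P.totalCon (PD.x ps) :=
    Finset.ext fun s => by rw [mem_activeSet, mem_activeSet, ← inr_mem_workingSet, hset,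
      inr_mem_workingSet]
  refine hw (D (PD.x w.1), blockForm H) ?_ u hu (hactive ▸ hu')
  exact norm_prod_le_iff.2 ⟨le_add_of_nonneg_right ((norm_nonneg _).trans
    (hH.norm_blockForm_sub_lagHess_le hf hh (L ps))),
    (hH.norm_blockForm_sub_lagHess_le hf hh (L ps)).trans (le_add_of_nonneg_left (norm_nonneg _))⟩

end IsRegularKKT

end SepProblem

namespace SepProblem

variable {P : SepProblem} {ps : P.PD}

theorem norm_x_sub_le (p q : P.PD) : ‖PD.x p - PD.x q‖ ≤ ‖p - q‖ :=
  WithLp.norm_fst_le _ (p - q)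

theorem norm_sumElim_const_zero_le (P : SepProblem) (θ : ℝ) :
    ‖(Sum.elim (fun _ => θ) 0 : Fin P.nc ⊕ P.Idx → ℝ)‖ ≤ ‖θ‖ := by
  refine (pi_norm_le_iff_of_nonneg (norm_nonneg θ)).2 ?_
  rintro (_ | _) <;> simp

namespace IsRegularKKT

variable (hps : P.IsRegularKKT ps)
include hps

theorem eq_of_coordStep {μ η : ℝ} {H : ∀ i, Matrix (Fin (P.n i)) (Fin (P.n i)) ℝ} {q' : P.PD}
    (hμ : 0 ≤ μ) (hH : P.HessApprox 0 H ps) (hstep : P.CoordStep μ η H ps q') : q' = ps := by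
  obtain ⟨d, Z, hu, hres⟩ := hstep
  have hf := hps.contDiff_obj
  have hh := hps.contDiff_con
  obtain ⟨C, -, hmvec⟩ := hps.exists_norm_mvec_le
  have hmzero : ‖P.mvec ps‖ ≤ 0 := by
    simpa using hmvec.self_of_nhds fun s hs => hps.jointMul_eq_zero (.inr s)
      (mt inr_mem_workingSet.1 hs)
  have hrzero :
      (Sum.elim (PD.lam (P.kktResidual μ H ps q')).ofLp 0 : Fin P.nc ⊕ P.Idx → ℝ) = 0 := by
    rw [← norm_le_zero_iff]
    refine (norm_sumElim_lam_kktResidual_le μ hu).trans (hres.trans ?_)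
    rw [hmzero.antisymm (norm_nonneg _), mul_zero]
  have hHeq : blockForm H = lagHess P.totalObj P.jointCon (PD.x ps) (jointMul ps) := by
    rw [← sub_eq_zero, ← norm_le_zero_iff]
    simpa using hH.norm_blockForm_sub_lagHess_le hf hh
      (lagHess P.totalObj P.jointCon (PD.x ps) (jointMul ps))
  have hsqp := hu.sqpStep hf hh (fun i => (hH i).1) μ
  rw [hrzero, hHeq] at hsqp
  exact P.pdEquiv.injective (hsqp.eq_of_eq hps.lagGrad_jointCon_eq_zero hps.jointCon_eq_zero
    hps.jointMul_eq_zero (hps.injective_saddleMap_joint (fun _ => inv_nonneg.2 hμ) fun _ => rfl))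

section CoordStep

variable (hcalm : (fun x => lagHess P.totalObj P.jointCon x (jointMul ps)
  - lagHess P.totalObj P.jointCon (PD.x ps) (jointMul ps)) =O[𝓝 (PD.x ps)] fun x => x - PD.x ps)
include hcalm

theorem exists_coordStep_sqp_bound : ∃ C > 0, ∀ᶠ w : P.PD × ℝ × ℝ in 𝓝 (ps, 0, 0), ∀ η H q',
    P.workingSet (PD.x w.1) = P.workingSet (PD.x ps) → P.HessApprox w.2.1 H w.1 →
      P.CoordStep w.2.2⁻¹ η H w.1 q' → ‖q' - ps‖ ≤ C * (‖PD.x w.1 - PD.x ps‖ ^ 2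
        + ‖blockForm H - lagHess P.totalObj P.jointCon (PD.x ps) (jointMul ps)‖
          * ‖PD.x w.1 - PD.x ps‖
        + ‖w.2.2‖ * ‖jointMul w.1 - jointMul ps‖ + η * ‖P.mvec w.1‖) := by
  have hf := hps.contDiff_obj
  have hh := hps.contDiff_con
  let L (p : P.PD) := lagHess P.totalObj P.jointCon (PD.x p) (jointMul p)
  have herr : Tendsto (fun w : P.PD × ℝ × ℝ => ‖w.2.2‖
      + (((∑ i, (P.n i : ℝ) * P.n i) * w.2.1 + ‖L w.1 - L ps‖) + ‖PD.x w.1 - PD.x ps‖))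
      (𝓝 (ps, 0, 0)) (𝓝 0) := by
    have hL : Continuous L := continuous_lagHess_joint hf hh
    have hx : Continuous fun p : P.PD => PD.x p := continuous_x
    exact Continuous.tendsto' (by fun_prop) _ _ (by simp)
  obtain ⟨M, hM, hsqp⟩ := exists_sqpStep_bound (contDiff_totalObj hf) (contDiff_jointCon hh)
    hps.lagGrad_jointCon_eq_zero hps.jointCon_eq_zero hps.jointMul_eq_zero
    (hps.injective_saddleMap_joint (fun _ => le_rfl) fun _ => rfl) hcalm
  obtain ⟨C, hC, hnorm⟩ := P.exists_norm_sub_le_mul_norm_primal_jointMul_sub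
  refine ⟨C * M, by positivity, ?_⟩
  filter_upwards [eventually_forall_norm_sub_le herr hsqp] with w hw η H q' hset hH ⟨d, Z, hu, hres⟩
  have hstep := hu.sqpStep hf hh (fun i => (hH i).1) w.2.2⁻¹
  have hθ := P.norm_sumElim_const_zero_le w.2.2
  have hHerr := hH.norm_blockForm_sub_lagHess_le hf hh (L ps)
  rw [hset, inv_inv] at hstep
  rw [mul_assoc]
  refine (hnorm q' ps).trans (mul_le_mul_of_nonneg_left ((hw (Sum.elim (fun _ => w.2.2) 0,
    blockForm H, PD.x w.1) ?_ _ _ _ _ hstep).trans ?_) hC.le)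
  · simp only [Prod.mk_sub_mk, norm_prod_le_iff, sub_zero]
    have := norm_nonneg (PD.x w.1 - PD.x ps)
    have := (norm_nonneg _).trans hHerr
    exact ⟨by linarith, by linarith [norm_nonneg w.2.2], by linarith [norm_nonneg w.2.2]⟩
  · gcongr
    exact (norm_sumElim_lam_kktResidual_le _ hu).trans hres

theorem exists_norm_blockForm_sub_lagHess_le : ∃ C > 0, ∀ᶠ p in 𝓝 ps, ∀ e H, P.HessApprox e H p →
    ‖blockForm H - lagHess P.totalObj P.jointCon (PD.x ps) (jointMul ps)‖ ≤
      (∑ i, (P.n i : ℝ) * P.n i) * e + C * ‖p - ps‖ := by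
  obtain ⟨C, hC, hlag⟩ := (((isBigO_lagHess_sub_prod (contDiff_jointCon hps.contDiff_con)
    hcalm).comp_tendsto P.pdEquiv.continuous.continuousAt).trans
      (isBigO_pdEquiv_sub ps)).exists_pos
  refine ⟨C, hC, hlag.bound.mono fun p hp e H hH => ?_⟩
  exact (hH.norm_blockForm_sub_lagHess_le hps.contDiff_obj hps.contDiff_con _).trans
    (add_le_add_right hp _)

theorem exists_coordStep_bound : ∃ C > 0, ∀ᶠ w : P.PD × ℝ × ℝ in 𝓝 (ps, 0, 0), ∀ η H q', 0 ≤ η →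
    P.workingSet (PD.x w.1) = P.workingSet (PD.x ps) →
      (∀ s, P.totalCon s (PD.x w.1) ≠ 0 → flatKap (PD.kap w.1) s = 0) →
        P.HessApprox w.2.1 H w.1 → P.CoordStep w.2.2⁻¹ η H w.1 q' →
          ‖q' - ps‖ ≤ C * (‖w - (ps, 0, 0)‖ + η) * ‖w.1 - ps‖ := by
  obtain ⟨M, hM, hsqp⟩ := hps.exists_coordStep_sqp_bound hcalm
  obtain ⟨Cm, hCm, hmvec⟩ := hps.exists_norm_mvec_le
  obtain ⟨CL, hCL, hHess⟩ := hps.exists_norm_blockForm_sub_lagHess_le hcalm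
  obtain ⟨Cκ, hCκ, hdual⟩ := P.pdEquiv.toContinuousLinearMap.bound
  let n2 : ℝ := ∑ i, (P.n i : ℝ) * P.n i
  refine ⟨M * (1 + (n2 + CL) + Cκ + Cm), by positivity, ?_⟩
  filter_upwards [hsqp, continuousAt_fst.eventually hmvec, continuousAt_fst.eventually hHess]
    with w hw hmw hHw η H q' hη hset hκ hH hstep
  set D := ‖w.1 - ps‖
  set E := ‖w - (ps, 0, 0)‖
  have hE : 0 ≤ E := norm_nonneg _
  have hDE : D ≤ E := norm_fst_le (w - (ps, 0, 0))
  have hsnd : ‖w.2‖ ≤ E := by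
    rw [← sub_zero w.2]
    exact norm_snd_le (w - (ps, 0, 0))
  have he : w.2.1 ≤ E := (le_abs_self _).trans ((norm_fst_le w.2).trans hsnd)
  have hθ : ‖w.2.2‖ ≤ E := (norm_snd_le w.2).trans hsnd
  have hx : ‖PD.x w.1 - PD.x ps‖ ≤ D := norm_x_sub_le _ _
  have hjoint : ‖jointMul w.1 - jointMul ps‖ ≤ Cκ * D :=
    (norm_snd_le (P.pdEquiv w.1 - P.pdEquiv ps)).trans (by
      rw [← map_sub]
      exact hdual _)
  calc ‖q' - ps‖ ≤ M * (E * D + (n2 * E + CL * E) * D + E * (Cκ * D) + η * (Cm * D)) := by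
        refine (hw η H q' hset hH hstep).trans ?_
        rw [sq]
        gcongr
        · exact hx.trans hDE
        · exact (hHw _ H hH).trans (by gcongr)
        · exact hmw hκ
    _ ≤ M * ((E + η) * D + (n2 * (E + η) + CL * (E + η)) * D + (E + η) * (Cκ * D)
          + (E + η) * (Cm * D)) := by
        gcongr <;> linarith
    _ = _ := by ring

end CoordStep

end IsRegularKKT

end SepProblem

/-! ### The iteration -/

section Rates

variable {E : Type*} [SeminormedAddCommGroup E] {a : E} {χ : ℝ}

theorem tendsto_of_contraction {q p : ℕ → E} {c ε : ℝ} (hc₀ : 0 ≤ c) (hc : c < 1)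
    (h0 : ‖q 0 - a‖ < ε) (hstep : ∀ k, ‖q k - a‖ < ε →
      ‖q (k + 1) - a‖ ≤ c * ‖q k - a‖ ∧ ‖p k - a‖ ≤ χ * ‖q k - a‖) :
    (∀ k, ‖q k - a‖ < ε) ∧ Tendsto q atTop (𝓝 a) ∧ Tendsto p atTop (𝓝 a) := by
  have hball : ∀ k, ‖q k - a‖ < ε := fun k => by
    induction k with
    | zero => exact h0
    | succ k ih =>
      exact ((hstep k ih).1.trans (mul_le_of_le_one_left (norm_nonneg _) hc.le)).trans_lt ih
  have hgeo (k : ℕ) : ‖q k - a‖ ≤ c ^ k * ‖q 0 - a‖ :=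
    le_geom (u := fun j => ‖q j - a‖) hc₀ k fun j _ => (hstep j (hball j)).1
  have hlim : Tendsto (fun k => ‖q k - a‖) atTop (𝓝 0) :=
    squeeze_zero (fun k => norm_nonneg _) hgeo (by
      simpa using (tendsto_pow_atTop_nhds_zero_of_lt_one hc₀ hc).mul_const ‖q 0 - a‖)
  refine ⟨hball, tendsto_iff_norm_sub_tendsto_zero.2 hlim, tendsto_iff_norm_sub_tendsto_zero.2 ?_⟩
  exact squeeze_zero (fun k => norm_nonneg _) (fun k => (hstep k (hball k)).2) (by
    simpa using hlim.const_mul χ)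

variable {step : E → ℝ → E → E → Prop} {C C₁ : ℝ}
  (hstep : ∀ᶠ q in 𝓝 a, ∀ η p q', step q η p q' →
    ‖p - a‖ ≤ χ * ‖q - a‖ ∧ ‖q' - a‖ ≤ C * (C₁ * ‖q - a‖ + η) * ‖q - a‖)
include hstep

theorem exists_linear_rate (hC : 0 < C) : ∃ ε > 0, ∀ (η : ℕ → ℝ) (q p : ℕ → E),
    (∀ k, step (q k) (η k) (p k) (q (k + 1))) → ‖q 0 - a‖ < ε → (∀ k, η k < 1 / (4 * C)) →
      Tendsto q atTop (𝓝 a) ∧ Tendsto p atTop (𝓝 a) ∧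
        ∀ k, ‖q (k + 1) - a‖ ≤ 1 / 2 * ‖q k - a‖ ∧ ‖p k - a‖ ≤ χ * ‖q k - a‖ := by
  have hsmall : ∀ᶠ q in 𝓝 a, C₁ * ‖q - a‖ < 1 / (4 * C) :=
    (Continuous.tendsto' (by fun_prop) a 0 (by simp)).eventually_lt_const (by positivity)
  obtain ⟨ε, hε, hball⟩ := Metric.eventually_nhds_iff_ball.1 (hstep.and hsmall)
  refine ⟨ε, hε, fun η q p hrun h0 hη => ?_⟩
  have hrate (k : ℕ) (hk : ‖q k - a‖ < ε) :
      ‖q (k + 1) - a‖ ≤ 1 / 2 * ‖q k - a‖ ∧ ‖p k - a‖ ≤ χ * ‖q k - a‖ := by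
    obtain ⟨hbound, hqk⟩ := hball (q k) (mem_ball_iff_norm.2 hk)
    obtain ⟨hp, hq⟩ := hbound _ _ _ (hrun k)
    refine ⟨hq.trans (mul_le_mul_of_nonneg_right ?_ (norm_nonneg _)), hp⟩
    calc C * (C₁ * ‖q k - a‖ + η k) ≤ C * (1 / (4 * C) + 1 / (4 * C)) := by
          gcongr
          exact (hη k).le
      _ = 1 / 2 := by
          field_simp
          norm_num
  obtain ⟨hmem, hq, hp⟩ := tendsto_of_contraction (by norm_num) (by norm_num) h0 hrate
  exact ⟨hq, hp, fun k => hrate k (hmem k)⟩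

theorem exists_quadratic_rate (hC : 0 ≤ C) (cη : ℝ) : ∃ ε > 0, ∀ (η : ℕ → ℝ) (q p : ℕ → E),
    (∀ k, step (q k) (η k) (p k) (q (k + 1))) → ‖q 0 - a‖ < ε →
      (∀ k, η k ≤ cη * ‖q k - a‖) → Tendsto q atTop (𝓝 a) ∧ Tendsto p atTop (𝓝 a) ∧
        ∀ k, ‖q (k + 1) - a‖ ≤ C * (C₁ + cη) * ‖q k - a‖ ^ 2 ∧ ‖p k - a‖ ≤ χ * ‖q k - a‖ := by
  have hsmall : ∀ᶠ q in 𝓝 a, C * (C₁ + cη) * ‖q - a‖ < 1 / 2 :=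
    (Continuous.tendsto' (by fun_prop) a 0 (by simp)).eventually_lt_const (by norm_num)
  obtain ⟨ε, hε, hball⟩ := Metric.eventually_nhds_iff_ball.1 (hstep.and hsmall)
  refine ⟨ε, hε, fun η q p hrun h0 hη => ?_⟩
  have hrate (k : ℕ) (hk : ‖q k - a‖ < ε) :
      ‖q (k + 1) - a‖ ≤ C * (C₁ + cη) * ‖q k - a‖ ^ 2 ∧ ‖p k - a‖ ≤ χ * ‖q k - a‖ := by
    obtain ⟨hp, hq⟩ := (hball (q k) (mem_ball_iff_norm.2 hk)).1 _ _ _ (hrun k)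
    refine ⟨?_, hp⟩
    calc ‖q (k + 1) - a‖ ≤ C * (C₁ * ‖q k - a‖ + cη * ‖q k - a‖) * ‖q k - a‖ :=
          hq.trans (by gcongr; exact hη k)
      _ = C * (C₁ + cη) * ‖q k - a‖ ^ 2 := by ring
  obtain ⟨hmem, hq, hp⟩ := tendsto_of_contraction (c := 1 / 2) (by norm_num) (by norm_num) h0
    fun k hk => by
      refine ⟨(hrate k hk).1.trans ?_, (hrate k hk).2⟩
      rw [sq, ← mul_assoc]
      gcongr
      exact (hball (q k) (mem_ball_iff_norm.2 hk)).2.le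
  exact ⟨hq, hp, fun k => hrate k (hmem k)⟩

end Rates

namespace SepProblem

variable {P : SepProblem} {ps : P.PD}

/-- One iteration `q ↦ p ↦ q'` of the method with tolerance `η`, for some penalty `μ` and Hessian
approximation `H` obeying the accuracy conditions with constants `cμ` and `cH` relative to the
solution `ps`. -/
def IterationStep (P : SepProblem) (Sig : ∀ i, Matrix (Fin (P.n i)) (Fin (P.n i)) ℝ)
    (ρ δ cμ cH : ℝ) (ps q : P.PD) (η : ℝ) (p q' : P.PD) : Prop :=
  ∃ μ > 0, ∃ H, 0 ≤ η ∧ P.LocalStep Sig ρ δ q p ∧ P.CoordStep μ η H p q' ∧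
    (q ≠ ps → 1 / μ ≤ cμ * ‖q - ps‖) ∧ P.HessApprox (cH * ‖q - ps‖) H p

theorem IsRun.iterationStep {Sig : ∀ i, Matrix (Fin (P.n i)) (Fin (P.n i)) ℝ} {ρ δ cμ cH : ℝ}
    {μ η : ℕ → ℝ} {H : ℕ → ∀ i, Matrix (Fin (P.n i)) (Fin (P.n i)) ℝ} {q p : ℕ → P.PD}
    (hrun : P.IsRun Sig ρ δ μ η H q p) (hμ : ∀ k, q k ≠ ps → 1 / μ k ≤ cμ * ‖q k - ps‖)
    (hH : ∀ k, P.HessApprox (cH * ‖q k - ps‖) (H k) (p k)) (k : ℕ) :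
    P.IterationStep Sig ρ δ cμ cH ps (q k) (η k) (p k) (q (k + 1)) :=
  let ⟨hpos, hη, hlocal, hcoord⟩ := hrun k
  ⟨μ k, hpos, H k, hη, hlocal, hcoord, hμ k, hH k⟩

namespace IsRegularKKT

variable (hps : P.IsRegularKKT ps) {Sig : ∀ i, Matrix (Fin (P.n i)) (Fin (P.n i)) ℝ}
  {ρ δ χ : ℝ}
include hps

section WellPosed

variable (hSig : ∀ i, (Sig i).PosSemidef) (hρ : 0 ≤ ρ) (hδ : 0 < δ)
include hSig hρ hδ

theorem eventually_exists_localStep : ∀ᶠ q in 𝓝 ps, ∃ p, P.LocalStep Sig ρ δ q p := by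
  filter_upwards [P.proxData.continuous.continuousAt.eventually
    (hps.regularPoint.eventually_exists_proxKKT (proxForm_nonneg hSig hρ) (proxForm_comm hSig) hδ)]
    with q ⟨x, κ, hprox, hnear, hmin⟩
  exact ⟨P.pdEquiv.symm (x, Sum.elim (PD.lam q).ofLp κ), localStep_of_proxKKT hps.contDiff_obj
    hps.contDiff_con hSig rfl hnear hprox hmin⟩

theorem eventually_exists_localStep_coordStep (hloc : ∀ᶠ q in 𝓝 ps, ∀ p, P.LocalStep Sig ρ δ q p →
      P.workingSet (PD.x p) = P.workingSet (PD.x ps) ∧ ‖p - ps‖ ≤ χ * ‖q - ps‖) (cH : ℝ) :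
    ∀ᶠ q in 𝓝 ps, ∃ p, P.LocalStep Sig ρ δ q p ∧ ∀ H, P.HessApprox (cH * ‖q - ps‖) H p →
      ∀ μ > 0, ∃ q', P.CoordStep μ 0 H p q' := by
  have hradius : Tendsto (fun q : P.PD => max (χ * ‖q - ps‖) ‖cH * ‖q - ps‖‖) (𝓝 ps) (𝓝 0) :=
    Continuous.tendsto' (by fun_prop) _ _ (by simp)
  filter_upwards [hps.eventually_exists_localStep hSig hρ hδ, hloc,
    eventually_forall_norm_sub_le hradius hps.eventually_exists_coordStep]
    with q ⟨p, hstep⟩ hlocq hcoord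
  obtain ⟨hset, hp⟩ := hlocq p hstep
  refine ⟨p, hstep, fun H hH => hcoord (p, cH * ‖q - ps‖) ?_ H hH hset⟩
  rw [Prod.mk_sub_mk, sub_zero]
  exact max_le_max_right _ hp

end WellPosed

theorem exists_iteration_bound
    (hcalm : (fun x => lagHess P.totalObj P.jointCon x (jointMul ps)
      - lagHess P.totalObj P.jointCon (PD.x ps) (jointMul ps))
        =O[𝓝 (PD.x ps)] fun x => x - PD.x ps) (hχ : 0 < χ)
    (hloc : ∀ᶠ q in 𝓝 ps, ∀ p, P.LocalStep Sig ρ δ q p →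
      P.workingSet (PD.x p) = P.workingSet (PD.x ps) ∧ ‖p - ps‖ ≤ χ * ‖q - ps‖) :
    ∃ C > 0, ∀ cμ ≥ 0, ∀ cH ≥ 0, ∀ᶠ q in 𝓝 ps, ∀ η p q',
      P.IterationStep Sig ρ δ cμ cH ps q η p q' → ‖p - ps‖ ≤ χ * ‖q - ps‖ ∧
        ‖q' - ps‖ ≤ C * ((χ + cμ + cH) * ‖q - ps‖ + η) * ‖q - ps‖ := by
  obtain ⟨C, hC, hbound⟩ := hps.exists_coordStep_bound hcalm
  refine ⟨C * χ, by positivity, fun cμ hcμ cH hcH => ?_⟩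
  have hradius : Tendsto (fun q : P.PD => (χ + cμ + cH) * ‖q - ps‖) (𝓝 ps) (𝓝 0) :=
    Continuous.tendsto' (by fun_prop) _ _ (by simp)
  filter_upwards [hloc, eventually_forall_norm_sub_le hradius hbound] with q hlocq hboundq η p q'
    ⟨μ, hμ, H, hη, hstep, hcoord, hμq, hH⟩
  obtain ⟨hset, hp⟩ := hlocq p hstep
  refine ⟨hp, ?_⟩
  rcases eq_or_ne q ps with rfl | hq
  · have hpq : p = q := by simpa [sub_eq_zero] using hp
    subst hpq
    simp [hps.eq_of_coordStep hμ.le (by simpa using hH) hcoord]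
  have hμinv : μ⁻¹ ≤ cμ * ‖q - ps‖ := by simpa using hμq hq
  have hnear : ‖(p, cH * ‖q - ps‖, μ⁻¹) - (ps, 0, 0)‖ ≤ (χ + cμ + cH) * ‖q - ps‖ := by
    have hD : 0 ≤ ‖q - ps‖ := norm_nonneg _
    rw [Prod.mk_sub_mk, Prod.mk_sub_mk, sub_zero, sub_zero, norm_prod_le_iff, norm_prod_le_iff,
      Real.norm_of_nonneg (by positivity), Real.norm_of_nonneg (by positivity)]
    have := mul_nonneg hχ.le hD
    have := mul_nonneg hcμ hD
    have := mul_nonneg hcH hD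
    exact ⟨by linarith, by linarith, by linarith⟩
  calc ‖q' - ps‖ ≤ C * ((χ + cμ + cH) * ‖q - ps‖ + η) * (χ * ‖q - ps‖) := by
        refine (hboundq _ hnear η H q' hη hset (fun s hs =>
          (mul_eq_zero.1 (hstep.compl s.1 s.2)).resolve_right hs) hH (by rwa [inv_inv])).trans ?_
        gcongr
    _ = _ := by ring

end IsRegularKKT

end SepProblem

theorem mainTheorem1_general {P : SepProblem} {ps : P.PD} (hps : P.IsRegularKKT ps)
    {Sig : ∀ i, Matrix (Fin (P.n i)) (Fin (P.n i)) ℝ} (hSig : ∀ i, (Sig i).PosSemidef)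
    {ρ : ℝ} (hρ : 0 ≤ ρ)
    (hcalm : (fun x => lagHess P.totalObj P.jointCon x (SepProblem.jointMul ps)
      - lagHess P.totalObj P.jointCon (SepProblem.PD.x ps) (SepProblem.jointMul ps))
        =O[𝓝 (SepProblem.PD.x ps)] fun x => x - SepProblem.PD.x ps) :
    ∃ δ > 0, ∃ χ > 0, ∃ ηbar > 0, ∃ c > 0, c < 1 ∧
      ∀ cμ > 0, ∀ cH ≥ 0,
        (∃ ε > 0, ∀ q : P.PD, ‖q - ps‖ < ε → ∃ p : P.PD, P.LocalStep Sig ρ δ q p ∧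
          ∀ H, P.HessApprox (cH * ‖q - ps‖) H p → ∀ μ > 0, ∃ q' : P.PD, P.CoordStep μ 0 H p q') ∧
        (∃ ε > 0, ∀ (μ η : ℕ → ℝ) (H : ℕ → ∀ i, Matrix (Fin (P.n i)) (Fin (P.n i)) ℝ)
          (q p : ℕ → P.PD), P.IsRun Sig ρ δ μ η H q p → ‖q 0 - ps‖ < ε →
          (∀ k, q k ≠ ps → 1 / μ k ≤ cμ * ‖q k - ps‖) →
          (∀ k, P.HessApprox (cH * ‖q k - ps‖) (H k) (p k)) →
          (∀ k, η k < ηbar) →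
            Tendsto q atTop (𝓝 ps) ∧ Tendsto p atTop (𝓝 ps) ∧
            ∀ k, ‖q (k + 1) - ps‖ ≤ c * ‖q k - ps‖ ∧ ‖p k - ps‖ ≤ χ * ‖q k - ps‖) ∧
        (∀ cη > 0, ∃ ε > 0, ∃ C > 0,
          ∀ (μ η : ℕ → ℝ) (H : ℕ → ∀ i, Matrix (Fin (P.n i)) (Fin (P.n i)) ℝ)
          (q p : ℕ → P.PD), P.IsRun Sig ρ δ μ η H q p → ‖q 0 - ps‖ < ε →
          (∀ k, q k ≠ ps → 1 / μ k ≤ cμ * ‖q k - ps‖) →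
          (∀ k, P.HessApprox (cH * ‖q k - ps‖) (H k) (p k)) →
          (∀ k, η k ≤ cη * ‖q k - ps‖) →
            Tendsto q atTop (𝓝 ps) ∧ Tendsto p atTop (𝓝 ps) ∧
            ∀ k, ‖q (k + 1) - ps‖ ≤ C * ‖q k - ps‖ ^ 2 ∧ ‖p k - ps‖ ≤ χ * ‖q k - ps‖) := by
  obtain ⟨δ, hδ, χ, hχ, hloc⟩ := hps.exists_localStep_bound hSig hρ
  obtain ⟨C, hC, hiter⟩ := hps.exists_iteration_bound hcalm hχ hloc
  refine ⟨δ, hδ, χ, hχ, 1 / (4 * C), by positivity, 1 / 2, by norm_num, by norm_num,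
    fun cμ hcμ cH hcH => ⟨?_, ?_, fun cη hcη => ?_⟩⟩
  · obtain ⟨ε, hε, hwell⟩ := Metric.eventually_nhds_iff_ball.1
      (hps.eventually_exists_localStep_coordStep hSig hρ hδ hloc cH)
    exact ⟨ε, hε, fun q hq => hwell q (mem_ball_iff_norm.2 hq)⟩
  · obtain ⟨ε, hε, hrate⟩ := exists_linear_rate (hiter cμ hcμ.le cH hcH) hC
    exact ⟨ε, hε, fun μ η H q p hrun h0 hμ hH => hrate η q p (hrun.iterationStep hμ hH) h0⟩
  · obtain ⟨ε, hε, hrate⟩ := exists_quadratic_rate (hiter cμ hcμ.le cH hcH) hC.le cη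
    exact ⟨ε, hε, C * ((χ + cμ + cH) + cη), by positivity, fun μ η H q p hrun h0 hμ hH =>
      hrate η q p (hrun.iterationStep hμ hH) h0⟩

end LocalConvergence

theorem mainTheorem1 (P : SepProblem)
    (hf : ∀ i, ContDiff ℝ 2 (P.f i)) (hh : ∀ i, ContDiff ℝ 2 (P.h i))
    (Sig : ∀ i, Matrix (Fin (P.n i)) (Fin (P.n i)) ℝ) (hSig : ∀ i, (Sig i).PosDef)
    (ρ : ℝ) (hρ : 0 < ρ)
    (ps : P.PD) (hKKT : P.IsKKT ps) (hLICQ : P.LICQ (SepProblem.PD.x ps))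
    (hSCC : P.SCC ps) (hSOSC : P.SOSC ps)
    (hLip : ∃ U ∈ 𝓝 ps, ∃ K : NNReal, LipschitzOnWith K (fderiv ℝ P.lagrangian) U ∧
      LipschitzOnWith K (fderiv ℝ (fderiv ℝ P.lagrangian)) U) :
    ∃ δ > 0, ∃ χ > 0, ∃ ηbar > 0, ∃ c > 0, c < 1 ∧
      ∀ cμ > 0, ∀ cH ≥ 0,
        -- the steps can be carried out near the solution
        (∃ ε > 0, ∀ q : P.PD, ‖q - ps‖ < ε → ∃ p : P.PD, P.LocalStep Sig ρ δ q p ∧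
          ∀ H, P.HessApprox (cH * ‖q - ps‖) H p → ∀ μ > 0, ∃ q' : P.PD, P.CoordStep μ 0 H p q') ∧
        -- local convergence at a linear rate
        (∃ ε > 0, ∀ (μ η : ℕ → ℝ) (H : ℕ → ∀ i, Matrix (Fin (P.n i)) (Fin (P.n i)) ℝ)
          (q p : ℕ → P.PD), P.IsRun Sig ρ δ μ η H q p → ‖q 0 - ps‖ < ε →
          (∀ k, q k ≠ ps → 1 / μ k ≤ cμ * ‖q k - ps‖) →
          (∀ k, P.HessApprox (cH * ‖q k - ps‖) (H k) (p k)) →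
          (∀ k, η k < ηbar) →
            Tendsto q atTop (𝓝 ps) ∧ Tendsto p atTop (𝓝 ps) ∧
            ∀ k, ‖q (k + 1) - ps‖ ≤ c * ‖q k - ps‖ ∧ ‖p k - ps‖ ≤ χ * ‖q k - ps‖) ∧
        -- local convergence at a quadratic rate
        (∀ cη > 0, ∃ ε > 0, ∃ C > 0,
          ∀ (μ η : ℕ → ℝ) (H : ℕ → ∀ i, Matrix (Fin (P.n i)) (Fin (P.n i)) ℝ)
          (q p : ℕ → P.PD), P.IsRun Sig ρ δ μ η H q p → ‖q 0 - ps‖ < ε →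
          (∀ k, q k ≠ ps → 1 / μ k ≤ cμ * ‖q k - ps‖) →
          (∀ k, P.HessApprox (cH * ‖q k - ps‖) (H k) (p k)) →
          (∀ k, η k ≤ cη * ‖q k - ps‖) →
            Tendsto q atTop (𝓝 ps) ∧ Tendsto p atTop (𝓝 ps) ∧
            ∀ k, ‖q (k + 1) - ps‖ ≤ C * ‖q k - ps‖ ^ 2 ∧ ‖p k - ps‖ ≤ χ * ‖q k - ps‖) := by
  obtain ⟨U, hU, K, -, hK⟩ := hLip
  exact mainTheorem1_general ⟨hf, hh, hKKT, hLICQ, hSCC, hSOSC⟩ (fun i => (hSig i).posSemidef)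
    hρ.le (SepProblem.isBigO_lagHess_sub hf hh hU hK)
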